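/- Let $n\ge 1$ and let $Cl_n$ be the real Clifford algebra generated by $e_1,\dots,e_n$ with $e_ie_j+e_je_i=-2\delta_{ij}$, with conjugation $\overline{\,\cdot\,}$, reversion $\widetilde{\,\cdot\,}$, main involution $'$ and norm $\|a\|=(\sum_A a_A^2)^{1/2}$. Let $H^+=\{x=x_0+x_1e_1+\dots+x_ne_n : x_n>0\}$. Let $SAV(\mathbb R\oplus\mathbb R^{n-1})$ be the group of matrices $M=\begin{pmatrix}a&b\\c&d\end{pmatrix}$ whose entries are products of paravectors from $\mathbb R\oplus\mathbb R^{n-1}$, with $a\tilde d-b\tilde c=1$, and with $ac^{-1},c^{-1}d\in\mathbb R\oplus\mathbb R^{n-1}$ if $c\ne0$ and $bd^{-1}\in\mathbb R\oplus\mathbb R^{n-1}$ if $c=0$; it acts on $H^+$ by $M\langle x\rangle=(ax+b)(cx+d)^{-1}$. Let $SAV(\mathbb R\oplus\mathbb R^{n-1},\mathbb Q)$ be the set of those $M$ in it for which $a\bar a,b\bar b,c\bar c,d\bar d\in\mathbb Q$, $a\bar c,b\bar d\in\mathbb Q\oplus\mathbb Q^n$, and, for all $x\in\mathbb Q\oplus\mathbb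 Q^n$, $ax\bar b+b\bar x\bar a,\ cx\bar d+d\bar x\bar c\in\mathbb Q$ and $ax\bar d+b\bar x\bar c\in\mathbb Q\oplus\mathbb Q^n$. Let $\mathcal I$ be a $\mathbb Z$-order in the rational Clifford algebra inside $Cl_n$ (a subring that is finitely generated as an additive group and contains a $\mathbb Q$-basis), stable under reversion and main involution, let $\Gamma_{n-1}(\mathcal I)=SAV(\mathbb R\oplus\mathbb R^{n-1},\mathbb Q)\cap \mathrm{Mat}(2,\mathcal I)$, and for $N\in\mathbb N$ let $\Gamma_{n-1}(\mathcal I)[N]$ be the set of its elements with $a-1,b,c,d-1\in N\mathcal I$. Let $N_0(\mathcal I)$ be the least positive integer such that for every $N\ge N_0(\mathcal I)$ neither $-1$ nor any of the matrices $\mathrm{diag}(\widetilde{e_A},e_A^{-1})$, $\emptyset\ne A\subseteq\{1,\dots,n-1\}$, lies in $\Gamma_{n-1}(\mathcal I)[N]$. Put $G_k(y)=\overline{y}/\|y\|^{n+1-k}$ and $$P_{k,n-1,N}(x,w)=\sum_{M\in\Gamma_{n-1}(\mathcal I)[N]}\frac{\overline{cx+d}}{\|cx+d\|^{n+1-k}}\;\frac{\overline{w+M\langle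 x\rangle}}{\|w+M\langle x\rangle\|^{n+1-k}},\qquad x,w\in H^+ .$$ Theorem (non-vanishing). Let $k<-1$ be an even integer and $N\ge N_0(\mathcal I)$. Then the series $P_{k,n-1,N}$ does not vanish identically: it is not the case that it converges (unconditionally) with sum $0$ for all $x,w\in H^+$. Moreover, if $k<-n$, then: (1) the series converges absolutely for all $x,w\in H^+$, and its sum is not identically $0$; (2) every $M\in\Gamma_{n-1}(\mathcal I)[N]$ maps $H^+$ to itself and $P_{k,n-1,N}(x,w)=G_k(cx+d)\,P_{k,n-1,N}(M\langle x\rangle,w)$; (3) for every $R=\begin{pmatrix}a&b\\c&d\end{pmatrix}\in\Gamma_{n-1}(\mathcal I)$ and $w\in H^+$, $\lim_{t\to+\infty}G_k(cte_n+d)\,P_{k,n-1,N}(R\langle te_n\rangle,w)=0$; (4) $P_{k,n-1,N}(\cdot,w)$ is real differentiable on $H^+$ for every $w\in H^+$, and for some $w\in H^+$ it is not $k$-hypermonogenic, i.e. it does not satisfy $Df+k\,(Qf)'/x_n=0$ on $H^+$, where $D=\partial_{x_0}+\sum_i e_i\partial_{x_i}$ and $f=Pf+(Qf)e_n$ with $Pf,Qf$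 valued in $Cl_{n-1}$; (5) with $j=-k>0$, the function $g(x,w)=x_n^{j}P_{-j,n-1,N}(x,w)$ is not identically $0$ and satisfies $g(x,w)=G_{j}(cx+d)\,g(M\langle x\rangle,w)$ for all $M\in\Gamma_{n-1}(\mathcal I)[N]$. So this gives non-zero functions with the automorphic transformation law for all even $j>n$. -/

import Mathlib

open scoped Topology

noncomputable section

namespace CliffordPoincare

/-! ### The real Clifford algebra `Cl_n` -/

/-- The quadratic form `v ↦ -(v₁² + ⋯ + vₙ²)` on `ℝⁿ`. -/
abbrev negSq (n : ℕ) : QuadraticForm ℝ (Fin n → ℝ) :=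
  QuadraticMap.weightedSumSquares ℝ (fun _ : Fin n => (-1 : ℝ))

/-- The real Clifford algebra `Cl_n`, with `e_i e_j + e_j e_i = -2 δ_{ij}`. Conjugation is `star`
(the anti-automorphism with `e_i ↦ -e_i`), reversion is `CliffordAlgebra.reverse`, and the main
involution is `CliffordAlgebra.involute`. -/
abbrev Cl (n : ℕ) : Type := CliffordAlgebra (negSq n)

/-- The generators; `e i` is the usual `e_{i+1}`, for `i = 0, …, n-1`. -/
def e {n : ℕ} (i : Fin n) : Cl n := CliffordAlgebra.ι (negSq n) (Pi.single i 1)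

/-- `e_A`, the product of the `e_i` with `i ∈ A` in increasing order. -/
def eA {n : ℕ} (A : Finset (Fin n)) : Cl n := ((A.sort (· ≤ ·)).map e).prod

theorem contractLeft_zero_of_forall {n : ℕ} (d : Module.Dual ℝ (Fin n → ℝ)) (l : List (Fin n))
    (h : ∀ j ∈ l, d (Pi.single j 1) = 0) :
    CliffordAlgebra.contractLeft (Q := (0 : QuadraticForm ℝ (Fin n → ℝ))) d
      ((l.map fun j => CliffordAlgebra.ι 0 (Pi.single j (1 : ℝ))).prod) = 0 := by
  induction l with
  | nil => simp
  | cons a l ih =>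
    rw [List.map_cons, List.prod_cons, CliffordAlgebra.contractLeft_ι_mul,
      ih (fun j hj => h j (List.mem_cons_of_mem _ hj)), h a List.mem_cons_self]
    simp

theorem associated_negSq_single {n : ℕ} {i j : Fin n} (hij : i ≠ j) :
    QuadraticMap.associated (R := ℝ) (-(negSq n)) (Pi.single i (1 : ℝ)) (Pi.single j 1) = 0 := by
  rw [QuadraticMap.associated_apply]
  simp only [neg_apply, QuadraticMap.weightedSumSquares_apply, Pi.add_apply]
  have : ∀ x : Fin n, (Pi.single i (1 : ℝ) : Fin n → ℝ) x * (Pi.single j (1 : ℝ) : Fin n → ℝ) x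
      = 0 := by
    intro x
    by_cases hx : x = i
    · subst hx; simp [hij]
    · simp [hx]
  have h2 : ∑ x : Fin n, (-1 : ℝ) • (((Pi.single i (1 : ℝ) : Fin n → ℝ) x
        + (Pi.single j (1 : ℝ) : Fin n → ℝ) x) * ((Pi.single i (1 : ℝ) : Fin n → ℝ) x
        + (Pi.single j (1 : ℝ) : Fin n → ℝ) x))
      = ∑ x : Fin n, (-1 : ℝ) • ((Pi.single i (1 : ℝ) : Fin n → ℝ) x
          * (Pi.single i (1 : ℝ) : Fin n → ℝ) x)
        + ∑ x : Fin n, (-1 : ℝ) • ((Pi.single j (1 : ℝ) : Fin n → ℝ) x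
          * (Pi.single j (1 : ℝ) : Fin n → ℝ) x) := by
    rw [← Finset.sum_add_distrib]
    refine Finset.sum_congr rfl fun x _ => ?_
    simp only [smul_eq_mul]
    linear_combination (-2) * this x
  rw [h2]
  simp

theorem equivExterior_prod {n : ℕ} (l : List (Fin n)) (hl : l.Nodup) :
    CliffordAlgebra.equivExterior (negSq n) ((l.map e).prod)
      = (l.map fun j => ExteriorAlgebra.ι ℝ (Pi.single j (1 : ℝ) : Fin n → ℝ)).prod := by
  induction l with
  | nil => simp
  | cons a l ih =>
    rw [List.nodup_cons] at hl
    have ih' := ih hl.2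
    rw [List.map_cons, List.prod_cons, List.map_cons, List.prod_cons]
    change CliffordAlgebra.changeForm
      (CliffordAlgebra.changeForm.associated_neg_proof (Q := negSq n))
      (CliffordAlgebra.ι _ _ * _) = _
    rw [CliffordAlgebra.changeForm_ι_mul]
    change CliffordAlgebra.changeForm
      (CliffordAlgebra.changeForm.associated_neg_proof (Q := negSq n)) _ = _ at ih'
    rw [ih']
    have := contractLeft_zero_of_forall
      (QuadraticMap.associated (R := ℝ) (-(negSq n)) (Pi.single a (1 : ℝ))) l
      (fun j hj => associated_negSq_single (fun h => hl.1 (h ▸ hj)))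
    erw [this, sub_zero]

/-- The basis `(e_A)_A` of `Cl_n`; see `basis_apply`. -/
def basis (n : ℕ) : Module.Basis (Finset (Fin n)) ℝ (Cl n) :=
  ((Pi.basisFun ℝ (Fin n)).ExteriorAlgebra).map (CliffordAlgebra.equivExterior (negSq n)).symm

theorem basis_apply {n : ℕ} (A : Finset (Fin n)) : basis n A = eA A := by
  rw [basis, Module.Basis.map_apply, LinearEquiv.symm_apply_eq, eA,
    equivExterior_prod _ (Finset.sort_nodup _ _), ExteriorAlgebra.basis_apply_ofCard _ rfl,
    ExteriorAlgebra.ιMulti_family, ExteriorAlgebra.ιMulti_apply]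
  congr 1
  apply List.ext_getElem
  · simp
  · intro i h1 h2
    simp [Set.powersetCard.ofFinEmbEquiv_symm_apply, Finset.orderEmbOfFin_apply]

/-- The component `a_A` of `a = ∑_A a_A e_A`. -/
def coeff {n : ℕ} (A : Finset (Fin n)) (a : Cl n) : ℝ := (basis n).repr a A

/-- The components of a Clifford number as a vector in Euclidean space. -/
def toEuclidean (n : ℕ) : Cl n ≃ₗ[ℝ] EuclideanSpace ℝ (Finset (Fin n)) :=
  (basis n).equivFun.trans (WithLp.linearEquiv 2 ℝ (Finset (Fin n) → ℝ)).symm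

/-- The norm `‖a‖ = (∑_A a_A²)^{1/2}` on `Cl_n`; see `norm_eq`. -/
instance instNormedAddCommGroup (n : ℕ) : NormedAddCommGroup (Cl n) :=
  NormedAddCommGroup.induced (Cl n) (EuclideanSpace ℝ (Finset (Fin n)))
    (toEuclidean n) (toEuclidean n).injective

instance instNormedSpace (n : ℕ) : NormedSpace ℝ (Cl n) :=
  NormedSpace.induced ℝ (Cl n) (EuclideanSpace ℝ (Finset (Fin n))) (toEuclidean n)

theorem norm_eq {n : ℕ} (a : Cl n) : ‖a‖ = Real.sqrt (∑ A, coeff A a ^ 2) := by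
  change ‖toEuclidean n a‖ = _
  rw [EuclideanSpace.norm_eq]
  simp [toEuclidean, coeff]

/-! ### Paravectors and upper half-space -/

/-- The paravectors `ℝ ⊕ ℝⁿ`, spanned by `1, e_1, …, e_n`. -/
def paravec (n : ℕ) : Submodule ℝ (Cl n) := Submodule.span ℝ (insert 1 (Set.range e))

/-- The index of the last generator `e_n`. -/
def lastIdx (n : ℕ) [NeZero n] : Fin n := ⟨n - 1, Nat.sub_one_lt (NeZero.ne n)⟩

/-- The paravectors `ℝ ⊕ ℝⁿ⁻¹`, spanned by `1, e_1, …, e_{n-1}`. -/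
def lowParavec (n : ℕ) [NeZero n] : Submodule ℝ (Cl n) :=
  Submodule.span ℝ (insert 1 (e '' {i | i ≠ lastIdx n}))

/-- The rational paravectors `ℚ ⊕ ℚⁿ`. -/
def ratParavec (n : ℕ) : Submodule ℚ (Cl n) := Submodule.span ℚ (insert 1 (Set.range e))

/-- The coordinate `x_n`. -/
def xn {n : ℕ} [NeZero n] (x : Cl n) : ℝ := coeff {lastIdx n} x

/-- Upper half-space `H⁺ = {x ∈ ℝ ⊕ ℝⁿ : x_n > 0}`. -/
def upperHalf (n : ℕ) [NeZero n] : Set (Cl n) := {x | x ∈ paravec n ∧ 0 < xn x}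

/-! ### Arithmetic groups -/

/-- The rational Clifford algebra inside `Cl_n`. -/
def ratCl (n : ℕ) : Subalgebra ℚ (Cl n) := Algebra.adjoin ℚ (Set.range e)

/-- `I` is a `ℤ`-order in the rational Clifford algebra that is stable under reversion and the main
involution. -/
structure IsInvolutiveOrder {n : ℕ} (I : Subring (Cl n)) : Prop where
  rational : ∀ a ∈ I, a ∈ ratCl n
  fg : I.toAddSubgroup.FG
  span_eq : Submodule.span ℚ (I : Set (Cl n)) = Subalgebra.toSubmodule (ratCl n)
  reverse_mem : ∀ a ∈ I, CliffordAlgebra.reverse a ∈ I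
  involute_mem : ∀ a ∈ I, CliffordAlgebra.involute a ∈ I

/-- `2 × 2` matrices `(a b; c d)` over `Cl_n`, with `a = M 0 0`, `b = M 0 1`, `c = M 1 0`,
`d = M 1 1`. -/
abbrev Mat (n : ℕ) : Type := Matrix (Fin 2) (Fin 2) (Cl n)

/-- The special Ahlfors-Vahlen group `SAV(ℝ ⊕ ℝⁿ⁻¹)`. All inverses below are inverses of units,
since non-zero products of paravectors are invertible. -/
structure IsSAV {n : ℕ} [NeZero n] (M : Mat n) : Prop where
  prod_paravec : ∀ i j, M i j ∈ Submonoid.closure (lowParavec n : Set (Cl n))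
  det : M 0 0 * CliffordAlgebra.reverse (M 1 1) - M 0 1 * CliffordAlgebra.reverse (M 1 0) = 1
  ac : M 1 0 ≠ 0 → M 0 0 * Ring.inverse (M 1 0) ∈ lowParavec n
  cd : M 1 0 ≠ 0 → Ring.inverse (M 1 0) * M 1 1 ∈ lowParavec n
  bd : M 1 0 = 0 → M 0 1 * Ring.inverse (M 1 1) ∈ lowParavec n

/-- The Clifford number `a` is a rational scalar. -/
def IsRatScalar {n : ℕ} (a : Cl n) : Prop := ∃ q : ℚ, a = algebraMap ℚ (Cl n) q

/-- The rationality conditions that single out `SAV(ℝ ⊕ ℝⁿ⁻¹, ℚ)` in `SAV(ℝ ⊕ ℝⁿ⁻¹)`. -/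
structure IsRational {n : ℕ} (M : Mat n) : Prop where
  norms : ∀ i j, IsRatScalar (M i j * star (M i j))
  ac : M 0 0 * star (M 1 0) ∈ ratParavec n
  bd : M 0 1 * star (M 1 1) ∈ ratParavec n
  ab : ∀ x ∈ ratParavec n,
    IsRatScalar (M 0 0 * x * star (M 0 1) + M 0 1 * star x * star (M 0 0))
  cd : ∀ x ∈ ratParavec n,
    IsRatScalar (M 1 0 * x * star (M 1 1) + M 1 1 * star x * star (M 1 0))
  adbc : ∀ x ∈ ratParavec n,
    M 0 0 * x * star (M 1 1) + M 0 1 * star x * star (M 1 0) ∈ ratParavec n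

/-- The group `Γ_{n-1}(I) = SAV(ℝ ⊕ ℝⁿ⁻¹, ℚ) ∩ Mat(2, I)`. -/
def Gam {n : ℕ} [NeZero n] (I : Subring (Cl n)) : Set (Mat n) :=
  {M | IsSAV M ∧ IsRational M ∧ ∀ i j, M i j ∈ I}

/-- The principal congruence subgroup `Γ_{n-1}(I)[N]`: `a - 1, b, c, d - 1 ∈ N I`. -/
def GamN {n : ℕ} [NeZero n] (I : Subring (Cl n)) (N : ℕ) : Set (Mat n) :=
  {M | M ∈ Gam I ∧ ∀ i j, ∃ q ∈ I, (M - 1) i j = N • q}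

/-- `N_0(I)`: the least positive integer such that, for all `N ≥ N_0(I)`, neither `-1` nor one of
the matrices `diag(ẽ_A, e_A⁻¹)`, `∅ ≠ A ⊆ {1, …, n-1}`, lies in `Γ_{n-1}(I)[N]`. -/
def N0 {n : ℕ} [NeZero n] (I : Subring (Cl n)) : ℕ :=
  sInf {m | 0 < m ∧ ∀ N, m ≤ N → (-1 : Mat n) ∉ GamN I N ∧
    ∀ A : Finset (Fin n), A.Nonempty → lastIdx n ∉ A →
      !![CliffordAlgebra.reverse (eA A), 0; 0, Ring.inverse (eA A)] ∉ GamN I N}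

/-! ### Poincaré series -/

/-- The Möbius transformation `M⟨x⟩ = (a x + b)(c x + d)⁻¹`. -/
def mob {n : ℕ} (M : Mat n) (x : Cl n) : Cl n :=
  (M 0 0 * x + M 0 1) * Ring.inverse (M 1 0 * x + M 1 1)

/-- The kernel `G_k(y) = ȳ / ‖y‖^{n+1-k}`. -/
def kernel {n : ℕ} (k : ℤ) (y : Cl n) : Cl n := (‖y‖ ^ ((n : ℤ) + 1 - k))⁻¹ • star y

/-- The automorphy factor `G_k(c x + d)`. -/
def autFactor {n : ℕ} (k : ℤ) (M : Mat n) (x : Cl n) : Cl n := kernel k (M 1 0 * x + M 1 1)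

/-- The summand of the Poincaré series that belongs to `M`. -/
def term {n : ℕ} (k : ℤ) (M : Mat n) (x w : Cl n) : Cl n :=
  autFactor k M x * kernel k (w + mob M x)

/-- The Poincaré series `P_{k,n-1,N}(x, w)`. -/
def poincare {n : ℕ} [NeZero n] (I : Subring (Cl n)) (N : ℕ) (k : ℤ) (x w : Cl n) : Cl n :=
  ∑' M : GamN I N, term k (M : Mat n) x w

/-! ### `k`-hypermonogenic functions -/

/-- The component `Q a` in `a = P a + (Q a) e_n` with `P a, Q a ∈ Cl_{n-1}`. -/
def qPart {n : ℕ} [NeZero n] (a : Cl n) : Cl n :=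
  ∑ A : Finset (Fin n) with lastIdx n ∉ A, coeff (insert (lastIdx n) A) a • eA A

/-- The Dirac operator `D f = ∂f/∂x_0 + e_1 ∂f/∂x_1 + ⋯ + e_n ∂f/∂x_n`. -/
def dirac {n : ℕ} (f : Cl n → Cl n) (x : Cl n) : Cl n :=
  lineDeriv ℝ f x 1 + ∑ i : Fin n, e i * lineDeriv ℝ f x (e i)

/-- `f` is `k`-hypermonogenic on upper half-space: `D f + k (Q f)' / x_n = 0`. -/
def IsHypermonogenic {n : ℕ} [NeZero n] (k : ℤ) (f : Cl n → Cl n) : Prop :=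
  DifferentiableOn ℝ f (upperHalf n) ∧ ∀ x ∈ upperHalf n,
    dirac f x + ((k : ℝ) / xn x) • CliffordAlgebra.involute (qPart (f x)) = 0

end CliffordPoincare

end

open CliffordPoincare

/-!
# Non-vanishing of Clifford-valued Poincaré series

Write `V_M(x, w) = (a x + b) + w (c x + d) = (w + M⟨x⟩)(c x + d)` (`vVal`). The norm is multiplicative
whenever one factor is a product of paravectors, so the summand of the series is the kernel
`G_k(V_M(x, w))`, of norm `‖V_M(x, w)‖^{-(n - k)}`. Three facts carry the argument.

*Level.* Since `-1 ≡ 1` modulo `1` and `2`, the hypothesis `N₀ ≤ N` forces `N ≥ 3`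
(`three_le_of_N0_le`). By an argument in the manner of Minkowski an element of norm one in the order that
is congruent to `1` modulo `N ≥ 3` equals `1`, so that the matrices of `Γ[N]` with `c = 0` are
translations (`eq_transl_of_mem_GamN`).

*Group.* The conditions on `SAV` are equivalent to symmetric ones without inverses (`SAV`), which are
visibly stable under products and under the adjoint `(d̃, -b̃; -c̃, ã)`. A matrix of this kind with rational
entries satisfies all rationality conditions automatically (`SAV.isRational`). Hence `Γ` and `Γ[N]` are
groups.

*Size.* On the vertical axis the norm is known exactly,
`‖V_M(s e_n, t e_n)‖² = ‖b‖² + s² ‖a‖² + t² ‖d‖² + s² t² ‖c‖² + 2 s t` (`norm_vVal_axis_sq`), and values at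
other points are comparable to the value at `x = w = e_n` (`norm_vVal_en_le`).

Absolute convergence for `k < -n` follows by sorting the points `M⟨e_n⟩` into Whitney cubes, each of which
receives a bounded number of matrices because the order is discrete (`summable_Gam_en`). Automorphy is the
cocycle law `term_mul`, and decay at the cusps is dominated convergence.

For non-vanishing put `x = w = t e_n` and let `t → ∞`. If the series converges absolutely, the matrices with
`c ≠ 0` contribute at most `o(1)` times the number of translations of length at most `t`, times `t^{-(n - k)}`
(`tsum_movesCusp_le`): two such matrices with the same bottom row whose image points lie in the same cube of
side `t` differ by a short translation, and `∑ ‖c t e_n + d‖^{-(n - k)}` over the bottom rows tends to `0`. The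
translations themselves contribute `e_n`-components of constant sign, each short one at least a constant times
`t^{-(n - k)}`, so they cannot be cancelled (`not_hasSum_zero`). The same lemma, applied to the scalar part of
`D f + k (Q f)' / x_n`, which for the kernel is `-k w_n / x_n · ‖w + x‖^{-(n + 1 - k)}` and again has constant
sign, shows that the series is not `k`-hypermonogenic.
-/

noncomputable section

namespace CliffordPoincare

open CliffordAlgebra (ι reverse involute)
open scoped RealInnerProductSpace

/-! ### Multiplication of basis elements -/

theorem e_mul_self {n : ℕ} (i : Fin n) : e i * e i = -1 := by
  rw [e, CliffordAlgebra.ι_sq_scalar, QuadraticMap.weightedSumSquares_apply,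
    Finset.sum_eq_single i]
  · simp
  · intro j _ hj; simp [hj]
  · simp

theorem e_mul_e {n : ℕ} {i j : Fin n} (h : i ≠ j) : e i * e j = -(e j * e i) := by
  have h1 := CliffordAlgebra.ι_mul_ι_add_swap (Q := negSq n) (Pi.single i (1 : ℝ)) (Pi.single j 1)
  have h2 : QuadraticMap.polar (negSq n) (Pi.single i (1 : ℝ)) (Pi.single j 1) = 0 := by
    have h3 := congrArg (fun B => B (Pi.single i (1 : ℝ)) (Pi.single j 1))
      (QuadraticMap.two_nsmul_associated ℝ (-(negSq n)))
    simp only [LinearMap.smul_apply, associated_negSq_single h, smul_zero] at h3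
    have h4 := QuadraticMap.polar_neg (negSq n) (Pi.single i (1 : ℝ)) (Pi.single j 1)
    rw [QuadraticMap.polarBilin_apply_apply] at h3
    have h5 : -(⇑(negSq n)) = ⇑(-(negSq n)) := rfl
    rw [h5] at h4
    linarith [h3.trans h4]
  rw [h2, map_zero] at h1
  exact eq_neg_of_add_eq_zero_left h1

theorem eA_empty {n : ℕ} : eA (∅ : Finset (Fin n)) = 1 := by simp [eA]

theorem eA_insert {n : ℕ} {i : Fin n} {A : Finset (Fin n)} (h : ∀ j ∈ A, i < j) :
    eA (insert i A) = e i * eA A := by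
  rw [eA, Finset.sort_insert _ (fun b hb => (h b hb).le) (fun hi => lt_irrefl _ (h i hi))]
  simp [eA]

theorem eA_singleton {n : ℕ} (i : Fin n) : eA {i} = e i := by simp [eA]

theorem e_mul_eA {n : ℕ} (i : Fin n) (A : Finset (Fin n)) :
    e i * eA A = eA (symmDiff {i} A) ∨ e i * eA A = -eA (symmDiff {i} A) := by
  induction A using Finset.induction_on_min with
  | empty => left; rw [eA_empty, ← Finset.bot_eq_empty, symmDiff_bot, eA_singleton, mul_one]
  | insert m A hm ih =>
    rcases lt_trichotomy i m with h | h | h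
    · left
      have : symmDiff {i} (insert m A) = insert i (insert m A) := by
        ext j
        simp only [Finset.mem_symmDiff, Finset.mem_singleton, Finset.mem_insert]
        have := hm i
        grind
      rw [this, eA_insert (A := insert m A)]
      intro j hj
      rcases Finset.mem_insert.1 hj with rfl | hj
      · exact h
      · exact h.trans (hm j hj)
    · subst h
      right
      have : symmDiff {i} (insert i A) = A := by
        ext j
        simp only [Finset.mem_symmDiff, Finset.mem_singleton, Finset.mem_insert]
        have := hm i
        grind
      rw [this, eA_insert hm, ← mul_assoc, e_mul_self, neg_one_mul]
    · have h1 : symmDiff {i} (insert m A) = insert m (symmDiff {i} A) := by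
        ext j
        simp only [Finset.mem_symmDiff, Finset.mem_singleton, Finset.mem_insert]
        grind
      have h2 : ∀ j ∈ symmDiff {i} A, m < j := by
        intro j hj
        simp only [Finset.mem_symmDiff, Finset.mem_singleton] at hj
        have := hm j
        grind
      rw [h1, eA_insert h2, eA_insert hm, ← mul_assoc, e_mul_e h.ne', neg_mul, mul_assoc]
      rcases ih with ih | ih <;> rw [ih] <;> simp

theorem eA_mul_eA {n : ℕ} (A B : Finset (Fin n)) :
    eA A * eA B = eA (symmDiff A B) ∨ eA A * eA B = -eA (symmDiff A B) := by
  induction A using Finset.induction_on_min with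
  | empty => left; rw [eA_empty, ← Finset.bot_eq_empty, bot_symmDiff, one_mul]
  | insert m A hm ih =>
    have h1 : symmDiff (insert m A) B = symmDiff {m} (symmDiff A B) := by
      rw [← symmDiff_assoc]
      congr 1
      ext j
      simp only [Finset.mem_symmDiff, Finset.mem_singleton, Finset.mem_insert]
      have := hm m
      grind
    rw [eA_insert hm, mul_assoc, h1]
    rcases ih with ih | ih <;> rcases e_mul_eA m (symmDiff A B) with h' | h' <;> simp [ih, h']

theorem star_e {n : ℕ} (i : Fin n) : star (e i) = -e i := by rw [e, CliffordAlgebra.star_ι]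

theorem reverse_e {n : ℕ} (i : Fin n) : reverse (e i) = e i := by
  rw [e, CliffordAlgebra.reverse_ι]

theorem involute_e {n : ℕ} (i : Fin n) : involute (e i) = -e i := by
  rw [e, CliffordAlgebra.involute_ι]

theorem star_eA_mul_self {n : ℕ} (A : Finset (Fin n)) : star (eA A) * eA A = 1 := by
  induction A using Finset.induction_on_min with
  | empty => simp [eA_empty]
  | insert m A hm ih =>
    rw [eA_insert hm, star_mul, star_e, mul_assoc, ← mul_assoc (-e m), neg_mul, e_mul_self]
    simpa using ih

theorem star_eA {n : ℕ} (A : Finset (Fin n)) : star (eA A) = eA A ∨ star (eA A) = -eA A := by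
  have h := star_eA_mul_self A
  have h2 : eA A * eA A = 1 ∨ eA A * eA A = -1 := by simpa [eA_empty] using eA_mul_eA A A
  rcases h2 with h2 | h2
  · left
    calc star (eA A) = star (eA A) * (eA A * eA A) := by rw [h2, mul_one]
      _ = eA A := by rw [← mul_assoc, h, one_mul]
  · right
    calc star (eA A) = -(star (eA A) * (eA A * eA A)) := by rw [h2]; simp
      _ = -eA A := by rw [← mul_assoc, h, one_mul]

theorem coeff_eA {n : ℕ} (A B : Finset (Fin n)) : coeff A (eA B) = if A = B then 1 else 0 := by
  rw [coeff, ← basis_apply, Module.Basis.repr_self, Finsupp.single_apply]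
  simp [eq_comm]

/-- `coeff A` as a linear form. -/
def coeffLin {n : ℕ} (A : Finset (Fin n)) : Cl n →ₗ[ℝ] ℝ := (basis n).coord A

@[simp] theorem coeffLin_apply {n : ℕ} (A : Finset (Fin n)) (a : Cl n) :
    coeffLin A a = coeff A a := rfl

theorem coeff_add {n : ℕ} (A : Finset (Fin n)) (a b : Cl n) :
    coeff A (a + b) = coeff A a + coeff A b := map_add (coeffLin A) a b

theorem coeff_sub {n : ℕ} (A : Finset (Fin n)) (a b : Cl n) :
    coeff A (a - b) = coeff A a - coeff A b := map_sub (coeffLin A) a b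

theorem coeff_neg {n : ℕ} (A : Finset (Fin n)) (a : Cl n) :
    coeff A (-a) = -coeff A a := map_neg (coeffLin A) a

theorem coeff_smul {n : ℕ} (A : Finset (Fin n)) (r : ℝ) (a : Cl n) :
    coeff A (r • a) = r * coeff A a := map_smul (coeffLin A) r a

theorem coeff_zero {n : ℕ} (A : Finset (Fin n)) : coeff A (0 : Cl n) = 0 := map_zero (coeffLin A)

theorem coeff_one {n : ℕ} (A : Finset (Fin n)) :
    coeff A (1 : Cl n) = if A = ∅ then 1 else 0 := by rw [← eA_empty, coeff_eA]

theorem sum_coeff {n : ℕ} (a : Cl n) : ∑ A, coeff A a • eA A = a := by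
  simpa [coeff, basis_apply] using (basis n).sum_repr a

theorem ext_coeff {n : ℕ} {a b : Cl n} (h : ∀ A, coeff A a = coeff A b) : a = b :=
  (basis n).ext_elem h

instance instFiniteDimensional (n : ℕ) : FiniteDimensional ℝ (Cl n) := (basis n).finiteDimensional_of_finite

/-! ### The scalar part and the inner product -/

/-- The scalar part of a Clifford number. -/
def sc {n : ℕ} : Cl n →ₗ[ℝ] ℝ := coeffLin ∅

theorem sc_apply {n : ℕ} (a : Cl n) : sc a = coeff ∅ a := rfl

@[simp] theorem sc_one {n : ℕ} : sc (1 : Cl n) = 1 := by simp [sc_apply, coeff_one]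

theorem sc_eA {n : ℕ} {A : Finset (Fin n)} (h : A.Nonempty) : sc (eA A) = 0 := by
  rw [sc_apply, coeff_eA, if_neg h.ne_empty.symm]

@[simp] theorem sc_algebraMap {n : ℕ} (r : ℝ) : sc (algebraMap ℝ (Cl n) r) = r := by
  rw [Algebra.algebraMap_eq_smul_one, map_smul]; simp

theorem sc_mul_comm {n : ℕ} (a b : Cl n) : sc (a * b) = sc (b * a) := by
  have key : (LinearMap.mul ℝ (Cl n)).compr₂ sc = (LinearMap.mul ℝ (Cl n)).flip.compr₂ sc := by
    refine LinearMap.ext_basis (basis n) (basis n) fun A B => ?_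
    simp only [LinearMap.compr₂_apply, LinearMap.mul_apply', LinearMap.flip_apply, basis_apply]
    rcases eq_or_ne A B with rfl | h
    · rfl
    · have h1 : (symmDiff A B).Nonempty := by
        rw [Finset.nonempty_iff_ne_empty]; exact fun h' => h (symmDiff_eq_bot.1 h')
      have h2 : (symmDiff B A).Nonempty := by rwa [symmDiff_comm]
      rcases eA_mul_eA A B with h' | h' <;> rcases eA_mul_eA B A with h'' | h'' <;>
        simp [h', h'', sc_eA h1, sc_eA h2]
  exact LinearMap.congr_fun₂ key a b

/-- Conjugation as a linear map. -/
def starLin {n : ℕ} : Cl n →ₗ[ℝ] Cl n where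
  toFun := star
  map_add' := star_add
  map_smul' r a := by simp

@[simp] theorem starLin_apply {n : ℕ} (a : Cl n) : starLin a = star a := rfl

theorem sc_star_mul {n : ℕ} (a b : Cl n) : sc (star a * b) = ∑ A, coeff A a * coeff A b := by
  have key : ((LinearMap.mul ℝ (Cl n)).comp starLin).compr₂ sc
      = ∑ A, (LinearMap.mul ℝ ℝ).compl₁₂ (coeffLin A) (coeffLin A) := by
    refine LinearMap.ext_basis (basis n) (basis n) fun A B => ?_
    simp only [LinearMap.compr₂_apply, LinearMap.mul_apply', LinearMap.comp_apply, starLin_apply,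
      basis_apply, LinearMap.sum_apply, LinearMap.compl₁₂_apply, coeffLin_apply, coeff_eA]
    rcases eq_or_ne A B with rfl | h
    · simp [star_eA_mul_self]
    · have h1 : (symmDiff A B).Nonempty := by
        rw [Finset.nonempty_iff_ne_empty]; exact fun h' => h (symmDiff_eq_bot.1 h')
      rcases eA_mul_eA A B with h' | h' <;> rcases star_eA A with h'' | h'' <;>
        simp [h', h'', sc_eA h1, h.symm]
  simpa [LinearMap.sum_apply] using LinearMap.congr_fun₂ key a b

/-- The inner product on `Cl_n` that induces the norm `‖a‖ = (∑ a_A²)^{1/2}`; it is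
`⟪a, b⟫ = ∑ a_A b_A`, the scalar part of `ā b`. -/
instance instInnerProductSpace (n : ℕ) : InnerProductSpace ℝ (Cl n) where
  inner a b := sc (star a * b)
  norm_sq_eq_re_inner a := by
    rw [norm_eq, Real.sq_sqrt (Finset.sum_nonneg fun _ _ => sq_nonneg _)]
    simp [sc_star_mul, sq]
  conj_inner_symm a b := by simp [sc_star_mul, mul_comm]
  add_left a b c := by simp [add_mul]
  smul_left a b r := by simp

theorem inner_def {n : ℕ} (a b : Cl n) : ⟪a, b⟫ = sc (star a * b) := rfl

theorem inner_eq_sum {n : ℕ} (a b : Cl n) : ⟪a, b⟫ = ∑ A, coeff A a * coeff A b := sc_star_mul a b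

theorem inner_eA {n : ℕ} (A : Finset (Fin n)) (a : Cl n) : ⟪eA A, a⟫ = coeff A a := by
  simp [inner_eq_sum, coeff_eA]

theorem sc_star {n : ℕ} (a : Cl n) : sc (star a) = sc a := by
  have := real_inner_comm (1 : Cl n) a
  simpa [inner_def] using this

theorem sc_star_mul_self {n : ℕ} (a : Cl n) : sc (star a * a) = ‖a‖ ^ 2 :=
  real_inner_self_eq_norm_sq a

theorem sc_involute {n : ℕ} (a : Cl n) : sc (involute a) = sc a := by
  have key : sc.comp (involute (Q := negSq n)).toLinearMap = sc := by
    refine (basis n).ext fun A => ?_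
    simp only [basis_apply, LinearMap.comp_apply, AlgHom.toLinearMap_apply]
    have h : involute (eA A) = eA A ∨ involute (eA A) = -eA A := by
      induction A using Finset.induction_on_min with
      | empty => left; simp [eA_empty]
      | insert m A hm ih =>
        rw [eA_insert hm, map_mul, involute_e]
        rcases ih with h | h <;> simp [h]
    rcases A.eq_empty_or_nonempty with rfl | hA
    · simp [eA_empty]
    · rcases h with h | h <;> simp [h, sc_eA hA]
  exact LinearMap.congr_fun key a

theorem star_involute {n : ℕ} (a : Cl n) : star (involute a) = reverse a := by
  rw [CliffordAlgebra.star_def, CliffordAlgebra.involute_involute]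

theorem star_reverse {n : ℕ} (a : Cl n) : star (reverse a) = involute a := by
  rw [CliffordAlgebra.star_def', CliffordAlgebra.reverse_reverse]

theorem involute_star {n : ℕ} (a : Cl n) : involute (star a) = reverse a := by
  rw [CliffordAlgebra.star_def', CliffordAlgebra.involute_involute]

theorem reverse_star {n : ℕ} (a : Cl n) : reverse (star a) = involute a := by
  rw [CliffordAlgebra.star_def, CliffordAlgebra.reverse_reverse]

theorem reverse_involute {n : ℕ} (a : Cl n) : reverse (involute a) = star a := rfl

theorem involute_reverse {n : ℕ} (a : Cl n) : involute (reverse a) = star a :=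
  (CliffordAlgebra.star_def' a).symm

theorem sc_reverse {n : ℕ} (a : Cl n) : sc (reverse a) = sc a := by
  rw [← involute_star, sc_involute, sc_star]

theorem inner_mul_left {n : ℕ} (u a b : Cl n) : ⟪u * a, b⟫ = ⟪a, star u * b⟫ := by
  simp [inner_def, mul_assoc]

theorem inner_mul_right {n : ℕ} (u a b : Cl n) : ⟪a * u, b⟫ = ⟪a, b * star u⟫ := by
  rw [inner_def, inner_def, star_mul, mul_assoc, sc_mul_comm, mul_assoc]

@[simp] theorem norm_one' {n : ℕ} : ‖(1 : Cl n)‖ = 1 := by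
  have : ‖(1 : Cl n)‖ ^ 2 = 1 := by rw [← sc_star_mul_self]; simp
  exact (pow_eq_one_iff_of_nonneg (norm_nonneg _) two_ne_zero).1 this

@[simp] theorem norm_star' {n : ℕ} (a : Cl n) : ‖star a‖ = ‖a‖ := by
  refine (sq_eq_sq₀ (norm_nonneg _) (norm_nonneg _)).1 ?_
  rw [← sc_star_mul_self, ← sc_star_mul_self, star_star, sc_mul_comm]

@[simp] theorem norm_involute {n : ℕ} (a : Cl n) : ‖involute a‖ = ‖a‖ := by
  refine (sq_eq_sq₀ (norm_nonneg _) (norm_nonneg _)).1 ?_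
  rw [← sc_star_mul_self, ← sc_star_mul_self, star_involute, ← involute_star, ← map_mul, sc_involute]

@[simp] theorem norm_reverse {n : ℕ} (a : Cl n) : ‖reverse a‖ = ‖a‖ := by
  rw [← star_involute, norm_star', norm_involute]

theorem abs_coeff_le_norm {n : ℕ} (A : Finset (Fin n)) (a : Cl n) : |coeff A a| ≤ ‖a‖ := by
  rw [norm_eq]
  refine Real.abs_le_sqrt ?_
  exact Finset.single_le_sum (f := fun A => coeff A a ^ 2) (fun _ _ => sq_nonneg _) (Finset.mem_univ A)

theorem abs_sc_le_norm {n : ℕ} (a : Cl n) : |sc a| ≤ ‖a‖ := abs_coeff_le_norm ∅ a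

theorem norm_eA {n : ℕ} (A : Finset (Fin n)) : ‖eA A‖ = 1 := by
  have : ‖eA A‖ ^ 2 = 1 := by rw [← sc_star_mul_self, star_eA_mul_self]; simp
  exact (pow_eq_one_iff_of_nonneg (norm_nonneg _) two_ne_zero).1 this

theorem norm_e {n : ℕ} (i : Fin n) : ‖e i‖ = 1 := by rw [← eA_singleton, norm_eA]

/-! ### Paravectors and their products -/

theorem algebraMap_mem_paravec {n : ℕ} (r : ℝ) : algebraMap ℝ (Cl n) r ∈ paravec n := by
  rw [Algebra.algebraMap_eq_smul_one]
  exact Submodule.smul_mem _ _ (Submodule.subset_span (by simp))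

theorem one_mem_paravec {n : ℕ} : (1 : Cl n) ∈ paravec n := Submodule.subset_span (by simp)

theorem e_mem_paravec {n : ℕ} (i : Fin n) : e i ∈ paravec n := Submodule.subset_span (by simp)

theorem mem_paravec_iff {n : ℕ} {x : Cl n} :
    x ∈ paravec n ↔ ∃ (r : ℝ) (v : Fin n → ℝ), x = algebraMap ℝ (Cl n) r + ι (negSq n) v := by
  constructor
  · intro hx
    induction hx using Submodule.span_induction with
    | mem x hx =>
      rcases hx with rfl | ⟨i, rfl⟩
      · exact ⟨1, 0, by simp⟩
      · exact ⟨0, Pi.single i 1, by simp [e]⟩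
    | zero => exact ⟨0, 0, by simp⟩
    | add x y _ _ hx hy =>
      obtain ⟨r, v, rfl⟩ := hx
      obtain ⟨s, w, rfl⟩ := hy
      exact ⟨r + s, v + w, by simp only [map_add]; abel⟩
    | smul c x _ hx =>
      obtain ⟨r, v, rfl⟩ := hx
      exact ⟨c * r, c • v, by simp [Algebra.algebraMap_eq_smul_one, mul_smul]⟩
  · rintro ⟨r, v, rfl⟩
    refine add_mem (algebraMap_mem_paravec r) ?_
    have : ι (negSq n) v = ∑ i, v i • e i := by
      conv_lhs => rw [← Finset.univ_sum_single v]
      rw [map_sum]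
      refine Finset.sum_congr rfl fun i _ => ?_
      rw [e, ← map_smul, ← Pi.single_smul, smul_eq_mul, mul_one]
    rw [this]
    exact sum_mem fun i _ => Submodule.smul_mem _ _ (e_mem_paravec i)

theorem star_mem_paravec {n : ℕ} {x : Cl n} (hx : x ∈ paravec n) : star x ∈ paravec n := by
  obtain ⟨r, v, rfl⟩ := mem_paravec_iff.1 hx
  exact mem_paravec_iff.2 ⟨r, -v, by simp⟩

theorem involute_mem_paravec {n : ℕ} {x : Cl n} (hx : x ∈ paravec n) : involute x ∈ paravec n := by
  obtain ⟨r, v, rfl⟩ := mem_paravec_iff.1 hx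
  exact mem_paravec_iff.2 ⟨r, -v, by simp⟩

theorem reverse_of_mem_paravec {n : ℕ} {x : Cl n} (hx : x ∈ paravec n) : reverse x = x := by
  obtain ⟨r, v, rfl⟩ := mem_paravec_iff.1 hx
  simp

/-- The multiplicative monoid generated by all paravectors, the paravectors with an `e_n`-component
included. -/
def pvProd (n : ℕ) : Submonoid (Cl n) := Submonoid.closure (paravec n : Set (Cl n))

theorem mem_pvProd_of_mem_paravec {n : ℕ} {x : Cl n} (hx : x ∈ paravec n) : x ∈ pvProd n :=
  Submonoid.subset_closure hx

theorem exists_star_mul_self_of_mem_paravec {n : ℕ} {x : Cl n} (hx : x ∈ paravec n) :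
    ∃ r : ℝ, star x * x = algebraMap ℝ (Cl n) r ∧ x * star x = algebraMap ℝ (Cl n) r := by
  obtain ⟨r, v, rfl⟩ := mem_paravec_iff.1 hx
  refine ⟨r ^ 2 - negSq n v, ?_, ?_⟩
  all_goals
    simp only [star_add, CliffordAlgebra.star_algebraMap, CliffordAlgebra.star_ι, map_sub,
      ← CliffordAlgebra.ι_sq_scalar, map_pow]
    have := Algebra.commutes r (ι (negSq n) v)
    simp only [add_mul, mul_add, neg_mul, mul_neg, this, sq]
    abel

theorem star_mem_pvProd {n : ℕ} {u : Cl n} (hu : u ∈ pvProd n) : star u ∈ pvProd n := by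
  induction hu using Submonoid.closure_induction with
  | mem x hx => exact mem_pvProd_of_mem_paravec (star_mem_paravec hx)
  | one => simp
  | mul x y _ _ hx hy => rw [star_mul]; exact mul_mem hy hx

theorem involute_mem_pvProd {n : ℕ} {u : Cl n} (hu : u ∈ pvProd n) : involute u ∈ pvProd n := by
  induction hu using Submonoid.closure_induction with
  | mem x hx => exact mem_pvProd_of_mem_paravec (involute_mem_paravec hx)
  | one => simp
  | mul x y _ _ hx hy => rw [map_mul]; exact mul_mem hx hy

theorem reverse_mem_pvProd {n : ℕ} {u : Cl n} (hu : u ∈ pvProd n) : reverse u ∈ pvProd n := by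
  rw [← involute_star]; exact involute_mem_pvProd (star_mem_pvProd hu)

theorem star_mul_self_of_mem_pvProd {n : ℕ} {u : Cl n} (hu : u ∈ pvProd n) :
    star u * u = algebraMap ℝ (Cl n) (‖u‖ ^ 2) := by
  have h : ∃ r : ℝ, star u * u = algebraMap ℝ (Cl n) r := by
    induction hu using Submonoid.closure_induction with
    | mem x hx => exact (exists_star_mul_self_of_mem_paravec hx).imp fun _ h => h.1
    | one => exact ⟨1, by simp⟩
    | mul x y _ _ hx hy =>
      obtain ⟨r, hr⟩ := hx
      obtain ⟨s, hs⟩ := hy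
      refine ⟨r * s, ?_⟩
      rw [star_mul, mul_assoc, ← mul_assoc (star x), hr, Algebra.commutes, ← mul_assoc, hs, map_mul,
        Algebra.commutes]
  obtain ⟨r, hr⟩ := h
  rw [← sc_star_mul_self, hr, sc_algebraMap]

theorem mul_star_self_of_mem_pvProd {n : ℕ} {u : Cl n} (hu : u ∈ pvProd n) :
    u * star u = algebraMap ℝ (Cl n) (‖u‖ ^ 2) := by
  simpa using star_mul_self_of_mem_pvProd (star_mem_pvProd hu)

/-- Left multiplication by a product of paravectors scales the norm. -/
theorem norm_mul_left {n : ℕ} {u : Cl n} (hu : u ∈ pvProd n) (a : Cl n) :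
    ‖u * a‖ = ‖u‖ * ‖a‖ := by
  refine (sq_eq_sq₀ (norm_nonneg _) (by positivity)).1 ?_
  rw [← real_inner_self_eq_norm_sq, inner_mul_left, ← mul_assoc, star_mul_self_of_mem_pvProd hu,
    ← Algebra.smul_def, real_inner_smul_right, real_inner_self_eq_norm_sq]
  ring

/-- Right multiplication by a product of paravectors scales the norm. -/
theorem norm_mul_right {n : ℕ} {u : Cl n} (hu : u ∈ pvProd n) (a : Cl n) :
    ‖a * u‖ = ‖a‖ * ‖u‖ := by
  refine (sq_eq_sq₀ (norm_nonneg _) (by positivity)).1 ?_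
  rw [← real_inner_self_eq_norm_sq, inner_mul_right, mul_assoc, mul_star_self_of_mem_pvProd hu,
    ← Algebra.commutes, ← Algebra.smul_def, real_inner_smul_right, real_inner_self_eq_norm_sq]
  ring

theorem isUnit_of_mem_pvProd {n : ℕ} {u : Cl n} (hu : u ∈ pvProd n) (h0 : u ≠ 0) : IsUnit u := by
  have h : (‖u‖ ^ 2) ≠ 0 := by simpa using h0
  refine ⟨⟨u, (‖u‖ ^ 2)⁻¹ • star u, ?_, ?_⟩, rfl⟩
  · rw [mul_smul_comm, mul_star_self_of_mem_pvProd hu, Algebra.algebraMap_eq_smul_one, smul_smul,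
      inv_mul_cancel₀ h, one_smul]
  · rw [smul_mul_assoc, star_mul_self_of_mem_pvProd hu, Algebra.algebraMap_eq_smul_one, smul_smul,
      inv_mul_cancel₀ h, one_smul]

theorem inverse_of_mem_pvProd {n : ℕ} {u : Cl n} (hu : u ∈ pvProd n) :
    Ring.inverse u = (‖u‖ ^ 2)⁻¹ • star u := by
  rcases eq_or_ne u 0 with rfl | h0
  · simp
  · have hU := isUnit_of_mem_pvProd hu h0
    have h : (‖u‖ ^ 2) ≠ 0 := by simpa using h0
    refine hU.mul_left_cancel ?_
    rw [Ring.mul_inverse_cancel _ hU, mul_smul_comm, mul_star_self_of_mem_pvProd hu,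
      Algebra.algebraMap_eq_smul_one, smul_smul, inv_mul_cancel₀ h, one_smul]

/-- The twisted action `y ↦ u y ũ` of products of paravectors preserves the paravectors. -/
theorem mul_mul_reverse_mem_paravec {n : ℕ} {u : Cl n} (hu : u ∈ pvProd n) :
    ∀ {y : Cl n}, y ∈ paravec n → u * y * reverse u ∈ paravec n := by
  induction hu using Submonoid.closure_induction with
  | mem v hv =>
    intro y hy
    rw [SetLike.mem_coe] at hv
    have h1 := star_mul_self_of_mem_pvProd (mem_pvProd_of_mem_paravec (add_mem (star_mem_paravec hy) hv))
    have h2 := star_mul_self_of_mem_pvProd (mem_pvProd_of_mem_paravec (star_mem_paravec hy))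
    have h3 := star_mul_self_of_mem_pvProd (mem_pvProd_of_mem_paravec hv)
    have h4 := mul_star_self_of_mem_pvProd (mem_pvProd_of_mem_paravec hv)
    simp only [star_add, star_star, add_mul, mul_add] at h1 h2
    -- polarisation: `y v + v̄ ȳ` is a scalar
    have h5 : y * v = algebraMap ℝ (Cl n)
        (‖star y + v‖ ^ 2 - ‖star y‖ ^ 2 - ‖v‖ ^ 2) - star v * star y := by
      rw [map_sub, map_sub, ← h1, ← h2, ← h3]; abel
    rw [reverse_of_mem_paravec hv, mul_assoc, h5, mul_sub, ← mul_assoc v (star v), h4,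
      ← Algebra.commutes, ← Algebra.smul_def, ← Algebra.smul_def]
    exact sub_mem (Submodule.smul_mem _ _ hv) (Submodule.smul_mem _ _ (star_mem_paravec hy))
  | one => intro y hy; simpa
  | mul u v _ _ hu hv =>
    intro y hy
    rw [reverse.map_mul]
    have := hu (hv hy)
    simpa [mul_assoc] using this

/-! ### The adjoint of a Vahlen matrix -/

/-- The matrix `(d̃, -b̃; -c̃, ã)`, the inverse of a Vahlen matrix `(a, b; c, d)`. -/
def adj {n : ℕ} (M : Mat n) : Mat n := !![reverse (M 1 1), -reverse (M 0 1); -reverse (M 1 0), reverse (M 0 0)]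

theorem adj_mul {n : ℕ} (M M' : Mat n) : adj (M * M') = adj M' * adj M := by
  ext i j
  fin_cases i <;> fin_cases j <;>
    simp [adj, Matrix.mul_apply, Fin.sum_univ_two, reverse.map_mul] <;> abel

/-- Conjugating with a product of paravectors, for a paravector on the other side. -/
theorem star_mul_mul_involute_mem_paravec {n : ℕ} {u y : Cl n} (hu : u ∈ pvProd n) (hy : y ∈ paravec n) :
    star u * y * involute u ∈ paravec n := by
  have := mul_mul_reverse_mem_paravec (star_mem_pvProd hu) hy
  rwa [reverse_star] at this

theorem reverse_mul_mul_mem_paravec {n : ℕ} {u y : Cl n} (hu : u ∈ pvProd n) (hy : y ∈ paravec n) :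
    reverse u * y * u ∈ paravec n := by
  have := mul_mul_reverse_mem_paravec (reverse_mem_pvProd hu) hy
  rwa [CliffordAlgebra.reverse_reverse] at this

theorem involute_mul_mul_star_mem_paravec {n : ℕ} {u y : Cl n} (hu : u ∈ pvProd n) (hy : y ∈ paravec n) :
    involute u * y * star u ∈ paravec n := by
  have := mul_mul_reverse_mem_paravec (involute_mem_pvProd hu) hy
  rwa [reverse_involute] at this

/-- If `x̄ y` is a paravector then `y` is `x` times a paravector, provided `x ≠ 0`. -/
theorem exists_eq_mul_paravec {n : ℕ} {x y : Cl n} (hx : x ∈ pvProd n) (h0 : x ≠ 0)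
    (h : star x * y ∈ paravec n) : ∃ p ∈ paravec n, y = x * p := by
  have h1 : (‖x‖ ^ 2) ≠ 0 := by simpa using h0
  refine ⟨(‖x‖ ^ 2)⁻¹ • (star x * y), Submodule.smul_mem _ _ h, ?_⟩
  rw [mul_smul_comm, ← mul_assoc, mul_star_self_of_mem_pvProd hx, ← Algebra.smul_def, smul_smul,
    inv_mul_cancel₀ h1, one_smul]

/-- If `x ȳ` is a paravector then `x` is a paravector times `y`, provided `y ≠ 0`. -/
theorem exists_eq_paravec_mul {n : ℕ} {x y : Cl n} (hy : y ∈ pvProd n) (h0 : y ≠ 0)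
    (h : x * star y ∈ paravec n) : ∃ p ∈ paravec n, x = p * y := by
  have h1 : (‖y‖ ^ 2) ≠ 0 := by simpa using h0
  refine ⟨(‖y‖ ^ 2)⁻¹ • (x * star y), Submodule.smul_mem _ _ h, ?_⟩
  rw [smul_mul_assoc, mul_assoc, star_mul_self_of_mem_pvProd hy, ← Algebra.commutes,
    ← Algebra.smul_def, smul_smul, inv_mul_cancel₀ h1, one_smul]

/-- If `x̄ y` is a paravector then `x ỹ = y x̃`. -/
theorem mul_reverse_comm {n : ℕ} {x y : Cl n} (hx : x ∈ pvProd n) (h : star x * y ∈ paravec n) :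
    x * reverse y = y * reverse x := by
  rcases eq_or_ne x 0 with rfl | h0
  · simp
  · obtain ⟨p, hp, rfl⟩ := exists_eq_mul_paravec hx h0 h
    rw [reverse.map_mul, reverse_of_mem_paravec hp, mul_assoc]

theorem mul_eq_one_symm {n : ℕ} {A B : Mat n} (h : A * B = 1) : B * A = 1 := by
  have : IsNoetherianRing (Cl n) := IsNoetherianRing.of_finite ℝ (Cl n)
  exact mul_eq_one_comm.1 h

theorem reverse_mul_involute_self {n : ℕ} {d : Cl n} (hd : d ∈ pvProd n) :
    reverse d * involute d = algebraMap ℝ (Cl n) (‖d‖ ^ 2) := by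
  have := mul_star_self_of_mem_pvProd (reverse_mem_pvProd hd)
  rwa [star_reverse, norm_reverse] at this

theorem eq_smul_involute_of_mul_reverse {n : ℕ} {a d : Cl n} (hd : d ∈ pvProd n)
    (det : a * reverse d = 1) : a = (‖d‖ ^ 2)⁻¹ • involute d := by
  have hd0 : d ≠ 0 := by rintro rfl; simpa using congrArg sc det
  have h1 : (‖d‖ ^ 2) ≠ 0 := by simpa using hd0
  have h3 := congrArg (· * involute d) det
  simp only [one_mul, mul_assoc, reverse_mul_involute_self hd] at h3
  rw [← Algebra.commutes, ← Algebra.smul_def] at h3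
  rw [← h3, smul_smul, inv_mul_cancel₀ h1, one_smul]

/-- The structure of a Vahlen matrix with `c ≠ 0`: `a = P c`, `d = c p` and `b = P c p - c̃⁻¹` with
paravectors `P`, `p`; here `c̃⁻¹ = c' / ‖c‖²`. -/
theorem exists_decomposition {n : ℕ} {a b c d : Cl n} (hc : c ∈ pvProd n) (h0 : c ≠ 0)
    (det : a * reverse d - b * reverse c = 1) (hac : a * star c ∈ paravec n)
    (hcd : star c * d ∈ paravec n) :
    ∃ P ∈ paravec n, ∃ p ∈ paravec n, a = P * c ∧ d = c * p ∧
      b = P * c * p - (‖c‖ ^ 2)⁻¹ • involute c := by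
  obtain ⟨P, hP, rfl⟩ := exists_eq_paravec_mul hc h0 hac
  obtain ⟨p, hp, rfl⟩ := exists_eq_mul_paravec hc h0 hcd
  refine ⟨P, hP, p, hp, rfl, rfl, ?_⟩
  have h1 : (‖c‖ ^ 2) ≠ 0 := by simpa using h0
  have h2 := reverse_mul_involute_self hc
  rw [reverse.map_mul, reverse_of_mem_paravec hp] at det
  have h3 := congrArg (· * involute c) det
  simp only [sub_mul, one_mul, mul_assoc, h2] at h3
  rw [← Algebra.commutes, ← Algebra.commutes, ← Algebra.smul_def] at h3
  rw [← h3, ← Algebra.smul_def, mul_smul_comm, mul_smul_comm, smul_sub, smul_smul, smul_smul,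
    inv_mul_cancel₀ h1, one_smul, one_smul, mul_assoc]
  abel

/-- The numerator of `M⟨p⟩`, cleared of the denominator, is a paravector. -/
theorem mul_star_mem_paravec {n : ℕ} {a b c d p : Cl n} (ha : a ∈ pvProd n)
    (hc : c ∈ pvProd n) (hd : d ∈ pvProd n)
    (det : a * reverse d - b * reverse c = 1) (hac : a * star c ∈ paravec n)
    (hbd : c = 0 → b * star d ∈ paravec n)
    (hcd : star c * d ∈ paravec n) (hp : p ∈ paravec n) :
    (a * p + b) * star (c * p + d) ∈ paravec n := by
  rcases eq_or_ne c 0 with rfl | h0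
  · simp only [map_zero, mul_zero, sub_zero] at det
    have hd0 : d ≠ 0 := by rintro rfl; simp at det
    have h3 := eq_smul_involute_of_mul_reverse hd det
    rw [zero_mul, zero_add, add_mul]
    refine add_mem ?_ (hbd rfl)
    rw [h3, smul_mul_assoc, smul_mul_assoc]
    exact Submodule.smul_mem _ _ (involute_mul_mul_star_mem_paravec hd hp)
  · obtain ⟨P, hP, q, hq, rfl, rfl, rfl⟩ := exists_decomposition hc h0 det hac hcd
    have hy : p + q ∈ paravec n := add_mem hp hq
    have h1 : (P * c * p + (P * c * q - (‖c‖ ^ 2)⁻¹ • involute c)) * star (c * p + c * q)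
        = P * (c * ((p + q) * star (p + q)) * star c)
          - (‖c‖ ^ 2)⁻¹ • (involute c * star (p + q) * star c) := by
      rw [← mul_add, star_mul, sub_eq_add_neg, sub_eq_add_neg, ← add_assoc, ← mul_add, add_mul, neg_mul,
        smul_mul_assoc]
      simp only [mul_assoc]
    rw [h1, mul_star_self_of_mem_pvProd (mem_pvProd_of_mem_paravec hy), ← Algebra.commutes,
      mul_assoc, mul_star_self_of_mem_pvProd hc, ← map_mul, ← Algebra.commutes, ← Algebra.smul_def]
    exact sub_mem (Submodule.smul_mem _ _ hP) (Submodule.smul_mem _ _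
      (involute_mul_mul_star_mem_paravec hc (star_mem_paravec hy)))

/-! ### The subalgebra `Cl_{n-1}` and the last coordinate -/

/-- The last generator `e_n`. -/
abbrev en (n : ℕ) [NeZero n] : Cl n := e (lastIdx n)

/-- The subalgebra `Cl_{n-1}` of `Cl_n`, described by its commutation rule `e_n y = y' e_n` with the
last generator. -/
def lowAlg (n : ℕ) [NeZero n] : Subalgebra ℝ (Cl n) where
  carrier := {y | en n * y = involute y * en n}
  mul_mem' {a b} ha hb := by
    simp only [Set.mem_ofPred_eq] at *
    rw [← mul_assoc, ha, mul_assoc, hb, map_mul, mul_assoc]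
  add_mem' {a b} ha hb := by
    simp only [Set.mem_ofPred_eq] at *
    rw [mul_add, ha, hb, map_add, add_mul]
  algebraMap_mem' r := by
    simp only [Set.mem_ofPred_eq, AlgHom.commutes]
    rw [Algebra.commutes]

section
variable {n : ℕ} [NeZero n]

theorem en_mul {y : Cl n} (hy : y ∈ lowAlg n) : en n * y = involute y * en n := hy

theorem involute_mem_lowAlg {y : Cl n} (hy : y ∈ lowAlg n) : involute y ∈ lowAlg n := by
  have := congrArg involute (en_mul hy)
  rw [map_mul, map_mul, involute_e, neg_mul, mul_neg, neg_inj] at this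
  exact this

theorem mul_en {y : Cl n} (hy : y ∈ lowAlg n) : y * en n = en n * involute y := by
  rw [en_mul (involute_mem_lowAlg hy), CliffordAlgebra.involute_involute]

theorem reverse_mem_lowAlg {y : Cl n} (hy : y ∈ lowAlg n) : reverse y ∈ lowAlg n := by
  have := congrArg reverse (mul_en hy)
  rw [reverse.map_mul, reverse.map_mul, reverse_e, reverse_involute] at this
  change _ = _
  rw [this, involute_reverse]

theorem star_mem_lowAlg {y : Cl n} (hy : y ∈ lowAlg n) : star y ∈ lowAlg n :=
  reverse_mem_lowAlg (involute_mem_lowAlg hy)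

theorem lowParavec_le_paravec : lowParavec n ≤ paravec n :=
  Submodule.span_mono (Set.insert_subset_insert (Set.image_subset_range _ _))

theorem mem_lowAlg_of_mem_lowParavec {y : Cl n} (hy : y ∈ lowParavec n) : y ∈ lowAlg n := by
  have h : lowParavec n ≤ (lowAlg n).toSubmodule := by
    refine Submodule.span_le.2 ?_
    rintro x (rfl | ⟨i, hi, rfl⟩)
    · exact one_mem (lowAlg n)
    · change _ = _
      rw [involute_e, e_mul_e (Ne.symm hi), neg_mul]
  exact h hy

/-- Elements of `Cl_{n-1}` and of `Cl_{n-1} e_n` are orthogonal. -/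
theorem inner_mul_en_of_mem_lowAlg {p q : Cl n} (hp : p ∈ lowAlg n) (hq : q ∈ lowAlg n) :
    ⟪p, q * en n⟫ = 0 := by
  have hu : star p * q ∈ lowAlg n := mul_mem (star_mem_lowAlg hp) hq
  rw [inner_def, ← mul_assoc]
  have h1 : sc (star p * q * en n) = sc (involute (star p * q) * en n) := by
    rw [sc_mul_comm, en_mul hu]
  have h2 : sc (star p * q * en n) = -sc (involute (star p * q) * en n) := by
    rw [← sc_involute, map_mul, involute_e, mul_neg, map_neg]
  linarith

theorem en_mem_pvProd : en n ∈ pvProd n := mem_pvProd_of_mem_paravec (e_mem_paravec _)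

theorem norm_mul_en (a : Cl n) : ‖a * en n‖ = ‖a‖ := by
  rw [norm_mul_right en_mem_pvProd, norm_e, mul_one]

theorem norm_sq_add_mul_en {p q : Cl n} (hp : p ∈ lowAlg n) (hq : q ∈ lowAlg n) :
    ‖p + q * en n‖ ^ 2 = ‖p‖ ^ 2 + ‖q‖ ^ 2 := by
  rw [norm_add_sq_real, inner_mul_en_of_mem_lowAlg hp hq, norm_mul_en]; ring

/-! ### Coordinates of paravectors -/

theorem xn_eq_inner (x : Cl n) : xn x = ⟪en n, x⟫ := by
  rw [en, ← eA_singleton, inner_eA]; rfl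

theorem xn_add (x y : Cl n) : xn (x + y) = xn x + xn y := coeff_add _ _ _
theorem xn_sub (x y : Cl n) : xn (x - y) = xn x - xn y := coeff_sub _ _ _
theorem xn_smul (r : ℝ) (x : Cl n) : xn (r • x) = r * xn x := coeff_smul _ _ _
theorem xn_en : xn (en n) = 1 := by rw [xn_eq_inner, real_inner_self_eq_norm_sq, norm_e]; norm_num

theorem abs_xn_le_norm (x : Cl n) : |xn x| ≤ ‖x‖ := abs_coeff_le_norm _ _

theorem xn_of_mem_lowAlg {x : Cl n} (hx : x ∈ lowAlg n) : xn x = 0 := by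
  rw [xn_eq_inner, real_inner_comm, ← one_mul (en n)]
  exact inner_mul_en_of_mem_lowAlg hx (one_mem _)

theorem sub_xn_smul_mem_lowParavec {x : Cl n} (hx : x ∈ paravec n) :
    x - xn x • en n ∈ lowParavec n := by
  induction hx using Submodule.span_induction with
  | mem x hx =>
    rcases hx with rfl | ⟨i, rfl⟩
    · rw [xn_of_mem_lowAlg (one_mem _), zero_smul, sub_zero]
      exact Submodule.subset_span (by simp)
    · rcases eq_or_ne i (lastIdx n) with rfl | hi
      · rw [xn_en]; simp
      · have h : e i ∈ lowParavec n := Submodule.subset_span (Set.mem_insert_of_mem _ ⟨i, hi, rfl⟩)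
        rwa [xn_of_mem_lowAlg (mem_lowAlg_of_mem_lowParavec h), zero_smul, sub_zero]
  | zero => rw [xn_of_mem_lowAlg (zero_mem _)]; simp
  | add x y _ _ hx hy =>
    rw [xn_add, add_smul, add_sub_add_comm]; exact add_mem hx hy
  | smul c x _ hx =>
    rw [xn_smul, mul_smul, ← smul_sub]; exact Submodule.smul_mem _ _ hx

theorem mem_lowParavec_iff {x : Cl n} : x ∈ lowParavec n ↔ x ∈ paravec n ∧ x ∈ lowAlg n := by
  refine ⟨fun h => ⟨lowParavec_le_paravec h, mem_lowAlg_of_mem_lowParavec h⟩, fun ⟨h1, h2⟩ => ?_⟩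
  simpa [xn_of_mem_lowAlg h2] using sub_xn_smul_mem_lowParavec h1

/-- The multiplicative monoid of products of paravectors from `ℝ ⊕ ℝⁿ⁻¹`. -/
abbrev lowProd (n : ℕ) [NeZero n] : Submonoid (Cl n) := Submonoid.closure (lowParavec n : Set (Cl n))

theorem mem_pvProd_of_mem_lowProd {u : Cl n} (hu : u ∈ lowProd n) : u ∈ pvProd n :=
  Submonoid.closure_mono (SetLike.coe_subset_coe.2 lowParavec_le_paravec) hu

theorem mem_lowAlg_of_mem_lowProd {u : Cl n} (hu : u ∈ lowProd n) : u ∈ lowAlg n := by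
  have : lowProd n ≤ (lowAlg n).toSubmonoid :=
    Submonoid.closure_le.2 fun _ hx => mem_lowAlg_of_mem_lowParavec hx
  exact this hu

theorem mem_lowProd_of_mem_lowParavec {x : Cl n} (hx : x ∈ lowParavec n) : x ∈ lowProd n :=
  Submonoid.subset_closure hx

theorem zero_mem_lowProd : (0 : Cl n) ∈ lowProd n := mem_lowProd_of_mem_lowParavec (zero_mem _)

theorem smul_mem_lowProd {u : Cl n} (r : ℝ) (hu : u ∈ lowProd n) : r • u ∈ lowProd n := by
  rw [← one_mul u, ← smul_mul_assoc]
  refine mul_mem (mem_lowProd_of_mem_lowParavec (Submodule.smul_mem _ _ ?_)) hu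
  exact mem_lowParavec_iff.2 ⟨one_mem_paravec, one_mem _⟩

theorem neg_mem_lowProd {u : Cl n} (hu : u ∈ lowProd n) : -u ∈ lowProd n := by
  simpa using smul_mem_lowProd (-1) hu

theorem reverse_mem_lowProd {u : Cl n} (hu : u ∈ lowProd n) : reverse u ∈ lowProd n := by
  induction hu using Submonoid.closure_induction with
  | mem x hx =>
    rw [reverse_of_mem_paravec (lowParavec_le_paravec hx)]
    exact mem_lowProd_of_mem_lowParavec hx
  | one => simp
  | mul x y _ _ hx hy => rw [reverse.map_mul]; exact mul_mem hy hx

/-! ### Ahlfors-Vahlen matrices -/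

/-- The `SAV` conditions in a form without inverses that treats the four neighbouring pairs of
entries alike: `a c̄`, `b d̄`, `c̄ d`, `ā b` are paravectors. -/
structure SAV (M : Mat n) : Prop where
  mem : ∀ i j, M i j ∈ lowProd n
  det : M 0 0 * reverse (M 1 1) - M 0 1 * reverse (M 1 0) = 1
  ac : M 0 0 * star (M 1 0) ∈ paravec n
  bd : M 0 1 * star (M 1 1) ∈ paravec n
  cd : star (M 1 0) * M 1 1 ∈ paravec n
  ab : star (M 0 0) * M 0 1 ∈ paravec n

theorem SAV.row_comm_zero {M : Mat n} (h : SAV M) :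
    M 0 0 * reverse (M 0 1) = M 0 1 * reverse (M 0 0) :=
  mul_reverse_comm (mem_pvProd_of_mem_lowProd (h.mem _ _)) h.ab

theorem SAV.row_comm_one {M : Mat n} (h : SAV M) :
    M 1 0 * reverse (M 1 1) = M 1 1 * reverse (M 1 0) :=
  mul_reverse_comm (mem_pvProd_of_mem_lowProd (h.mem _ _)) h.cd

/-- The adjoint is a right inverse; the off-diagonal entries vanish by the row conditions. -/
theorem SAV.mul_adj {M : Mat n} (h : SAV M) : M * adj M = 1 := by
  have hd := congrArg reverse h.det
  rw [map_sub, reverse.map_mul, reverse.map_mul, CliffordAlgebra.reverse_reverse,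
    CliffordAlgebra.reverse_reverse, reverse.map_one] at hd
  ext i j
  fin_cases i <;> fin_cases j <;> simp [adj, Matrix.mul_apply, Fin.sum_univ_two]
  · rw [← sub_eq_add_neg]; exact h.det
  · rw [h.row_comm_zero]; abel
  · rw [h.row_comm_one]; abel
  · rw [neg_add_eq_sub]; exact hd

theorem SAV.adj_mul_self {M : Mat n} (h : SAV M) : adj M * M = 1 := mul_eq_one_symm h.mul_adj

theorem SAV.adj {M : Mat n} (h : SAV M) : SAV (adj M) where
  mem i j := by
    fin_cases i <;> fin_cases j <;> simp only [CliffordPoincare.adj, Fin.zero_eta, Fin.mk_one, Matrix.of_apply,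
      Matrix.cons_val] <;>
    first
    | exact reverse_mem_lowProd (h.mem _ _)
    | exact neg_mem_lowProd (reverse_mem_lowProd (h.mem _ _))
  det := by
    have := congrFun (congrFun h.adj_mul_self 0) 0
    simpa [CliffordPoincare.adj, Matrix.mul_apply, Fin.sum_univ_two, sub_eq_add_neg] using this
  ac := by
    have h2 := reverse_of_mem_paravec h.cd
    rw [reverse.map_mul, reverse_star] at h2
    simpa [CliffordPoincare.adj, star_reverse, h2] using h.cd
  bd := by
    have h2 := reverse_of_mem_paravec h.ab
    rw [reverse.map_mul, reverse_star] at h2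
    simpa [CliffordPoincare.adj, star_reverse, h2] using h.ab
  cd := by
    have h2 := reverse_of_mem_paravec h.ac
    rw [reverse.map_mul, reverse_star] at h2
    simpa [CliffordPoincare.adj, star_reverse, h2] using h.ac
  ab := by
    have h2 := reverse_of_mem_paravec h.bd
    rw [reverse.map_mul, reverse_star] at h2
    simpa [CliffordPoincare.adj, star_reverse, h2] using h.bd

theorem SAV.mul_star_mem_paravec {M : Mat n} (h : SAV M) {p : Cl n} (hp : p ∈ paravec n) :
    (M 0 0 * p + M 0 1) * star (M 1 0 * p + M 1 1) ∈ paravec n :=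
  CliffordPoincare.mul_star_mem_paravec (mem_pvProd_of_mem_lowProd (h.mem _ _))
    (mem_pvProd_of_mem_lowProd (h.mem _ _)) (mem_pvProd_of_mem_lowProd (h.mem _ _)) h.det h.ac (fun _ => h.bd) h.cd hp

theorem SAV.row_mem_pvProd {M : Mat n} (h : SAV M) (i : Fin 2) {p : Cl n} (hp : p ∈ paravec n) :
    M i 0 * p + M i 1 ∈ pvProd n := by
  have h1 : star (M i 0) * M i 1 ∈ paravec n := by
    fin_cases i
    · exact h.ab
    · exact h.cd
  rcases eq_or_ne (M i 0) 0 with h0 | h0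
  · simpa [h0] using mem_pvProd_of_mem_lowProd (h.mem i 1)
  · obtain ⟨q, hq, hq'⟩ := exists_eq_mul_paravec (mem_pvProd_of_mem_lowProd (h.mem i 0)) h0 h1
    rw [hq', ← mul_add]
    exact mul_mem (mem_pvProd_of_mem_lowProd (h.mem i 0)) (mem_pvProd_of_mem_paravec (add_mem hp hq))

/-- A column `(x, y)` of a Vahlen matrix is carried to products of low paravectors. -/
theorem SAV.mul_column_mem {M : Mat n} (h : SAV M) (i : Fin 2) {x y : Cl n} (hx : x ∈ lowProd n)
    (hy : y ∈ lowProd n) (hxy : x * star y ∈ paravec n) :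
    M i 0 * x + M i 1 * y ∈ lowProd n := by
  rcases eq_or_ne y 0 with rfl | hy0
  · simpa using mul_mem (h.mem i 0) hx
  obtain ⟨p, hp, hp'⟩ := exists_eq_paravec_mul (mem_pvProd_of_mem_lowProd hy) hy0 hxy
  have hpl : p ∈ lowAlg n := by
    have h1 : (‖y‖ ^ 2) ≠ 0 := by simpa using hy0
    have h2 : p = (‖y‖ ^ 2)⁻¹ • (x * star y) := by
      rw [hp', mul_assoc, mul_star_self_of_mem_pvProd (mem_pvProd_of_mem_lowProd hy), ← Algebra.commutes,
        ← Algebra.smul_def, smul_smul, inv_mul_cancel₀ h1, one_smul]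
    rw [h2]
    exact Subalgebra.smul_mem _ (mul_mem (mem_lowAlg_of_mem_lowProd hx)
      (star_mem_lowAlg (mem_lowAlg_of_mem_lowProd hy))) _
  have h1 : star (M i 0) * M i 1 ∈ paravec n := by
    fin_cases i
    · exact h.ab
    · exact h.cd
  rw [hp', ← mul_assoc, ← add_mul]
  refine mul_mem ?_ hy
  rcases eq_or_ne (M i 0) 0 with h0 | h0
  · simpa [h0] using h.mem i 1
  · have hl : star (M i 0) * M i 1 ∈ lowParavec n := mem_lowParavec_iff.2
      ⟨h1, mul_mem (star_mem_lowAlg (mem_lowAlg_of_mem_lowProd (h.mem _ _)))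
        (mem_lowAlg_of_mem_lowProd (h.mem _ _))⟩
    have h2 : (‖M i 0‖ ^ 2) ≠ 0 := by simpa using h0
    have h3 : M i 0 * p + M i 1 = M i 0 * (p + (‖M i 0‖ ^ 2)⁻¹ • (star (M i 0) * M i 1)) := by
      rw [mul_add, mul_smul_comm, ← mul_assoc,
        mul_star_self_of_mem_pvProd (mem_pvProd_of_mem_lowProd (h.mem i 0)), ← Algebra.smul_def, smul_smul,
        inv_mul_cancel₀ h2, one_smul]
    rw [h3]
    exact mul_mem (h.mem i 0) (mem_lowProd_of_mem_lowParavec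
      (add_mem (mem_lowParavec_iff.2 ⟨hp, hpl⟩) (Submodule.smul_mem _ _ hl)))

/-- The image of a column of a Vahlen matrix satisfies the column condition again. -/
theorem SAV.mul_column_paravec {M : Mat n} (h : SAV M) {x y : Cl n} (hx : x ∈ lowProd n)
    (hy : y ∈ lowProd n) (hxy : x * star y ∈ paravec n) :
    (M 0 0 * x + M 0 1 * y) * star (M 1 0 * x + M 1 1 * y) ∈ paravec n := by
  rcases eq_or_ne y 0 with rfl | hy0
  · simp only [mul_zero, add_zero, star_mul]
    rw [mul_assoc, ← mul_assoc x, mul_star_self_of_mem_pvProd (mem_pvProd_of_mem_lowProd hx),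
      ← Algebra.smul_def, mul_smul_comm]
    exact Submodule.smul_mem _ _ h.ac
  · obtain ⟨p, hp, rfl⟩ := exists_eq_paravec_mul (mem_pvProd_of_mem_lowProd hy) hy0 hxy
    rw [← mul_assoc, ← mul_assoc, ← add_mul, ← add_mul, star_mul, mul_assoc, ← mul_assoc y,
      mul_star_self_of_mem_pvProd (mem_pvProd_of_mem_lowProd hy), ← Algebra.smul_def, mul_smul_comm]
    exact Submodule.smul_mem _ _ (h.mul_star_mem_paravec hp)

theorem SAV.mul {M M' : Mat n} (h : SAV M) (h' : SAV M') : SAV (M * M') := by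
  have col : ∀ {M M' : Mat n}, SAV M → SAV M' →
      (M * M') 0 0 * star ((M * M') 1 0) ∈ paravec n ∧
      (M * M') 0 1 * star ((M * M') 1 1) ∈ paravec n := by
    intro M M' h h'
    simp only [Matrix.mul_apply, Fin.sum_univ_two]
    exact ⟨h.mul_column_paravec (h'.mem _ _) (h'.mem _ _) h'.ac,
      h.mul_column_paravec (h'.mem _ _) (h'.mem _ _) h'.bd⟩
  -- the row conditions for `M M'` are the column conditions for `adj M' * adj M`
  have row := col h'.adj h.adj
  rw [← adj_mul] at row
  have hinv : M * M' * CliffordPoincare.adj (M * M') = 1 := by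
    rw [adj_mul, mul_assoc, ← mul_assoc M', h'.mul_adj, one_mul, h.mul_adj]
  refine ⟨?_, ?_, (col h h').1, (col h h').2, ?_, ?_⟩
  · intro i j
    simp only [Matrix.mul_apply, Fin.sum_univ_two]
    refine h.mul_column_mem i (h'.mem _ _) (h'.mem _ _) ?_
    fin_cases j
    · exact h'.ac
    · exact h'.bd
  · have := congrFun (congrFun hinv 0) 0
    rw [Matrix.mul_apply, Fin.sum_univ_two] at this
    simpa [CliffordPoincare.adj, sub_eq_add_neg] using this
  · have h2 := row.1
    have h3 := reverse_of_mem_paravec row.1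
    simp only [CliffordPoincare.adj, Matrix.of_apply, Matrix.cons_val, star_neg, star_reverse, mul_neg,
      map_neg, neg_mem_iff, neg_inj, reverse.map_mul, reverse_involute,
      CliffordAlgebra.reverse_reverse] at h2 h3
    rwa [h3]
  · have h2 := row.2
    have h3 := reverse_of_mem_paravec row.2
    simp only [CliffordPoincare.adj, Matrix.of_apply, Matrix.cons_val, neg_mul, star_reverse,
      map_neg, neg_mem_iff, neg_inj, reverse.map_mul, reverse_involute,
      CliffordAlgebra.reverse_reverse] at h2 h3
    rwa [h3]

theorem IsSAV.toSAV {M : Mat n} (h : IsSAV M) : SAV M := by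
  have hm : ∀ i j, M i j ∈ pvProd n := fun i j => mem_pvProd_of_mem_lowProd (h.prod_paravec i j)
  rcases eq_or_ne (M 1 0) 0 with h0 | h0
  · have hdet := h.det
    simp only [h0, map_zero, mul_zero, sub_zero] at hdet
    have hd0 : M 1 1 ≠ 0 := by intro hd; simpa [hd] using congrArg sc hdet
    have h1 : (‖M 1 1‖ ^ 2) ≠ 0 := by simpa using hd0
    have hbd : M 0 1 * star (M 1 1) ∈ paravec n := by
      have h2 := Submodule.smul_mem _ (‖M 1 1‖ ^ 2) (lowParavec_le_paravec (h.bd h0))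
      rwa [inverse_of_mem_pvProd (hm 1 1), mul_smul_comm, smul_smul, mul_inv_cancel₀ h1, one_smul] at h2
    refine ⟨h.prod_paravec, h.det, by simp [h0], hbd, by simp [h0], ?_⟩
    obtain ⟨q, hq, hq'⟩ := exists_eq_paravec_mul (hm 1 1) hd0 hbd
    rw [hq', eq_smul_involute_of_mul_reverse (hm 1 1) hdet, CliffordAlgebra.star_smul, star_involute,
      smul_mul_assoc, ← mul_assoc]
    exact Submodule.smul_mem _ _ (reverse_mul_mul_mem_paravec (hm 1 1) hq)
  · have h1 : (‖M 1 0‖ ^ 2) ≠ 0 := by simpa using h0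
    have hac : M 0 0 * star (M 1 0) ∈ paravec n := by
      have h2 := Submodule.smul_mem _ (‖M 1 0‖ ^ 2) (lowParavec_le_paravec (h.ac h0))
      rwa [inverse_of_mem_pvProd (hm 1 0), mul_smul_comm, smul_smul, mul_inv_cancel₀ h1, one_smul] at h2
    have hcd : star (M 1 0) * M 1 1 ∈ paravec n := by
      have h2 := Submodule.smul_mem _ (‖M 1 0‖ ^ 2) (lowParavec_le_paravec (h.cd h0))
      rwa [inverse_of_mem_pvProd (hm 1 0), smul_mul_assoc, smul_smul, mul_inv_cancel₀ h1, one_smul] at h2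
    refine ⟨h.prod_paravec, h.det, hac, ?_, hcd, ?_⟩
    · simpa using mul_star_mem_paravec (hm 0 0) (hm 1 0) (hm 1 1) h.det hac (fun h' => (h0 h').elim) hcd
        (zero_mem _)
    · obtain ⟨P, hP, p, hp, h2, h3, h4⟩ := exists_decomposition (hm 1 0) h0 h.det hac hcd
      have h5 : star (M 0 0) * M 0 1 = ‖M 0 0‖ ^ 2 • p
          - (‖M 1 0‖ ^ 2)⁻¹ • (star (M 1 0) * star P * involute (M 1 0)) := by
        rw [h4, ← h2, mul_sub, ← mul_assoc, star_mul_self_of_mem_pvProd (hm 0 0), ← Algebra.smul_def,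
          h2, star_mul, mul_smul_comm]
      rw [h5]
      exact sub_mem (Submodule.smul_mem _ _ hp) (Submodule.smul_mem _ _
        (star_mul_mul_involute_mem_paravec (hm 1 0) (star_mem_paravec hP)))

theorem SAV.isSAV {M : Mat n} (h : SAV M) : IsSAV M := by
  have hm : ∀ i j, M i j ∈ pvProd n := fun i j => mem_pvProd_of_mem_lowProd (h.mem i j)
  have hl : ∀ i j, M i j ∈ lowAlg n := fun i j => mem_lowAlg_of_mem_lowProd (h.mem i j)
  refine ⟨h.mem, h.det, fun _ => ?_, fun _ => ?_, fun _ => ?_⟩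
  · rw [inverse_of_mem_pvProd (hm 1 0), mul_smul_comm]
    exact Submodule.smul_mem _ _ (mem_lowParavec_iff.2 ⟨h.ac, mul_mem (hl _ _) (star_mem_lowAlg (hl _ _))⟩)
  · rw [inverse_of_mem_pvProd (hm 1 0), smul_mul_assoc]
    exact Submodule.smul_mem _ _ (mem_lowParavec_iff.2 ⟨h.cd, mul_mem (star_mem_lowAlg (hl _ _)) (hl _ _)⟩)
  · rw [inverse_of_mem_pvProd (hm 1 1), mul_smul_comm]
    exact Submodule.smul_mem _ _ (mem_lowParavec_iff.2 ⟨h.bd, mul_mem (hl _ _) (star_mem_lowAlg (hl _ _))⟩)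

/-- Translations by low paravectors. -/
def transl (b : Cl n) : Mat n := !![1, b; 0, 1]

theorem SAV.transl {b : Cl n} (hb : b ∈ lowParavec n) : SAV (transl b) where
  mem i j := by
    fin_cases i <;> fin_cases j <;> simp only [CliffordPoincare.transl, Fin.zero_eta, Fin.mk_one,
      Matrix.of_apply, Matrix.cons_val]
    · exact one_mem _
    · exact mem_lowProd_of_mem_lowParavec hb
    · exact zero_mem_lowProd
    · exact one_mem _
  det := by simp [CliffordPoincare.transl]
  ac := by simp [CliffordPoincare.transl]
  bd := by simpa [CliffordPoincare.transl] using lowParavec_le_paravec hb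
  cd := by simp [CliffordPoincare.transl]
  ab := by simpa [CliffordPoincare.transl] using lowParavec_le_paravec hb

theorem SAV.neg_one : SAV (-1 : Mat n) where
  mem i j := by
    fin_cases i <;> fin_cases j <;> simp
    · exact neg_mem_lowProd (one_mem _)
    · exact zero_mem_lowProd
    · exact zero_mem_lowProd
    · exact neg_mem_lowProd (one_mem _)
  det := by simp
  ac := by simp
  bd := by simp
  cd := by simp
  ab := by simp

/-! ### The action on upper half-space -/

/-- The value `(a x + b) + w (c x + d)`. The summand of the Poincaré series that belongs to `M` is the
kernel evaluated there. -/
def vVal (M : Mat n) (x w : Cl n) : Cl n := (M 0 0 * x + M 0 1) + w * (M 1 0 * x + M 1 1)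

/-- The denominator `c x + d`. -/
def den (M : Mat n) (x : Cl n) : Cl n := M 1 0 * x + M 1 1

theorem den_mem_pvProd {M : Mat n} (h : SAV M) {x : Cl n} (hx : x ∈ paravec n) : den M x ∈ pvProd n :=
  h.row_mem_pvProd 1 hx

theorem mob_eq_smul {M : Mat n} (h : SAV M) {x : Cl n} (hx : x ∈ paravec n) :
    mob M x = (‖den M x‖ ^ 2)⁻¹ • ((M 0 0 * x + M 0 1) * star (den M x)) := by
  rw [mob, inverse_of_mem_pvProd (h.row_mem_pvProd 1 hx), mul_smul_comm]; rfl

theorem mob_mem_paravec {M : Mat n} (h : SAV M) {x : Cl n} (hx : x ∈ paravec n) :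
    mob M x ∈ paravec n := by
  rw [mob_eq_smul h hx]
  exact Submodule.smul_mem _ _ (h.mul_star_mem_paravec hx)

/-- The numerator of `M⟨x⟩` has the same last coordinate as `x`. -/
theorem xn_num {M : Mat n} (h : SAV M) {x : Cl n} (hx : x ∈ paravec n) :
    xn ((M 0 0 * x + M 0 1) * star (den M x)) = xn x := by
  have hl : ∀ i j, M i j ∈ lowAlg n := fun i j => mem_lowAlg_of_mem_lowProd (h.mem i j)
  set y := x - xn x • en n with hy
  have hyl : y ∈ lowAlg n := mem_lowAlg_of_mem_lowParavec (sub_xn_smul_mem_lowParavec hx)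
  have hxy : x = y + xn x • en n := by rw [hy]; abel
  have key : (M 0 0 * x + M 0 1) * star (den M x) =
      (M 0 0 * (x * star x) * star (M 1 0) + M 0 0 * y * star (M 1 1) + M 0 1 * star y * star (M 1 0)
        + M 0 1 * star (M 1 1))
      + xn x • ((M 0 0 * (en n * star (M 1 1))) - M 0 1 * (en n * star (M 1 0))) := by
    have e1 : M 0 0 * x * star (M 1 1) = M 0 0 * y * star (M 1 1)
        + xn x • (M 0 0 * (en n * star (M 1 1))) := by
      conv_lhs => rw [hxy]
      rw [mul_add, add_mul, mul_smul_comm, smul_mul_assoc, mul_assoc (M 0 0) (en n)]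
    have e2 : M 0 1 * star x * star (M 1 0) = M 0 1 * star y * star (M 1 0)
        - xn x • (M 0 1 * (en n * star (M 1 0))) := by
      conv_lhs => rw [hxy]
      rw [star_add, CliffordAlgebra.star_smul, star_e, mul_add, add_mul, smul_neg, mul_neg, neg_mul,
        mul_smul_comm, smul_mul_assoc, mul_assoc (M 0 1) (en n), ← sub_eq_add_neg]
    have e3 : (M 0 0 * x + M 0 1) * star (den M x) = M 0 0 * (x * star x) * star (M 1 0)
        + M 0 0 * x * star (M 1 1) + M 0 1 * star x * star (M 1 0) + M 0 1 * star (M 1 1) := by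
      rw [den, star_add, star_mul]; noncomm_ring
    rw [e3, e1, e2, smul_sub]; abel
  have h1 : M 0 0 * (en n * star (M 1 1)) - M 0 1 * (en n * star (M 1 0)) = en n := by
    rw [en_mul (star_mem_lowAlg (hl 1 1)), en_mul (star_mem_lowAlg (hl 1 0)), involute_star,
      involute_star, ← mul_assoc, ← mul_assoc, ← sub_mul, h.det, one_mul]
  rw [key, h1, xn_add, xn_smul, xn_en, mul_one, xn_of_mem_lowAlg, zero_add]
  rw [mul_star_self_of_mem_pvProd (mem_pvProd_of_mem_paravec hx)]
  have hs := star_mem_lowAlg hyl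
  have hs0 := star_mem_lowAlg (hl 1 0)
  have hs1 := star_mem_lowAlg (hl 1 1)
  refine add_mem (add_mem (add_mem ?_ ?_) ?_) ?_
  · exact mul_mem (mul_mem (hl 0 0) (Subalgebra.algebraMap_mem _ _)) hs0
  · exact mul_mem (mul_mem (hl 0 0) hyl) hs1
  · exact mul_mem (mul_mem (hl 0 1) hs) hs0
  · exact mul_mem (hl 0 1) hs1

theorem den_ne_zero {M : Mat n} (h : SAV M) {x : Cl n} (hx : x ∈ upperHalf n) : den M x ≠ 0 := by
  intro h0
  have := xn_num h hx.1
  rw [h0, star_zero, mul_zero, xn_of_mem_lowAlg (zero_mem _)] at this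
  exact hx.2.ne this

theorem norm_den_pos {M : Mat n} (h : SAV M) {x : Cl n} (hx : x ∈ upperHalf n) : 0 < ‖den M x‖ :=
  norm_pos_iff.2 (den_ne_zero h hx)

theorem xn_mob {M : Mat n} (h : SAV M) {x : Cl n} (hx : x ∈ paravec n) :
    xn (mob M x) = xn x / ‖den M x‖ ^ 2 := by
  rw [mob_eq_smul h hx, xn_smul, xn_num h hx, inv_mul_eq_div]

theorem mob_mem_upperHalf {M : Mat n} (h : SAV M) {x : Cl n} (hx : x ∈ upperHalf n) :
    mob M x ∈ upperHalf n := by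
  refine ⟨mob_mem_paravec h hx.1, ?_⟩
  rw [xn_mob h hx.1]
  exact div_pos hx.2 (pow_pos (norm_den_pos h hx) 2)

theorem mob_mul_den {M : Mat n} (h : SAV M) {x : Cl n} (hx : x ∈ upperHalf n) :
    mob M x * den M x = M 0 0 * x + M 0 1 := by
  rw [mob, mul_assoc]
  change _ * (Ring.inverse (den M x) * den M x) = _
  rw [Ring.inverse_mul_cancel _ (isUnit_of_mem_pvProd (den_mem_pvProd h hx.1) (den_ne_zero h hx)), mul_one]

theorem vVal_eq {M : Mat n} (h : SAV M) {x : Cl n} (hx : x ∈ upperHalf n) (w : Cl n) :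
    vVal M x w = (w + mob M x) * den M x := by
  rw [add_mul, mob_mul_den h hx, add_comm]; rfl

theorem den_mul {M' M : Mat n} (h : SAV M) {x : Cl n} (hx : x ∈ upperHalf n) :
    den (M' * M) x = den M' (mob M x) * den M x := by
  have : den M' (mob M x) * den M x = M' 1 0 * (mob M x * den M x) + M' 1 1 * den M x := by
    rw [den, add_mul, mul_assoc]
  rw [this, mob_mul_den h hx]
  simp only [den, Matrix.mul_apply, Fin.sum_univ_two]
  noncomm_ring

theorem mob_mul {M' M : Mat n} (h' : SAV M') (h : SAV M) {x : Cl n} (hx : x ∈ upperHalf n) :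
    mob (M' * M) x = mob M' (mob M x) := by
  have hU := isUnit_of_mem_pvProd (den_mem_pvProd (h'.mul h) hx.1) (den_ne_zero (h'.mul h) hx)
  refine hU.mul_right_cancel ?_
  rw [mob_mul_den (h'.mul h) hx, den_mul h hx, ← mul_assoc, mob_mul_den h' (mob_mem_upperHalf h hx),
    add_mul, mul_assoc, mob_mul_den h hx]
  simp only [den, Matrix.mul_apply, Fin.sum_univ_two]
  noncomm_ring

theorem add_ne_zero_of_mem_upperHalf {x w : Cl n} (hx : x ∈ upperHalf n) (hw : w ∈ upperHalf n) :
    w + x ≠ 0 := by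
  intro h
  have := xn_add w x
  rw [h, xn_of_mem_lowAlg (zero_mem _)] at this
  linarith [hx.2, hw.2]

theorem norm_vVal {M : Mat n} (h : SAV M) {x : Cl n} (hx : x ∈ upperHalf n) (w : Cl n) :
    ‖vVal M x w‖ = ‖w + mob M x‖ * ‖den M x‖ := by
  rw [vVal_eq h hx, norm_mul_right (den_mem_pvProd h hx.1)]

theorem vVal_ne_zero {M : Mat n} (h : SAV M) {x w : Cl n} (hx : x ∈ upperHalf n) (hw : w ∈ upperHalf n) :
    vVal M x w ≠ 0 := by
  rw [← norm_pos_iff, norm_vVal h hx]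
  exact mul_pos (norm_pos_iff.2 (add_ne_zero_of_mem_upperHalf (mob_mem_upperHalf h hx) hw))
    (norm_den_pos h hx)

/-- The distance formula for Möbius transformations. -/
theorem norm_mob_sub_mob {M : Mat n} (h : SAV M) {x y : Cl n} (hx : x ∈ upperHalf n)
    (hy : y ∈ upperHalf n) :
    ‖mob M x - mob M y‖ * ‖den M x‖ * ‖den M y‖ = ‖x - y‖ := by
  have hR : reverse (den M x) * mob M x = x * reverse (M 0 0) + reverse (M 0 1) := by
    have := congrArg reverse (mob_mul_den h hx)
    rwa [reverse.map_mul, map_add, reverse.map_mul, reverse_of_mem_paravec hx.1,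
      reverse_of_mem_paravec (mob_mem_paravec h hx.1)] at this
  have hD : reverse (den M x) = x * reverse (M 1 0) + reverse (M 1 1) := by
    rw [den, map_add, reverse.map_mul, reverse_of_mem_paravec hx.1]
  have e1 := h.adj.row_comm_zero
  have e2 := h.adj.row_comm_one
  have e3 := congrFun (congrFun h.adj_mul_self 0) 0
  have e4 := congrFun (congrFun h.adj_mul_self 1) 1
  simp only [CliffordPoincare.adj, Matrix.mul_apply, Fin.sum_univ_two, Matrix.of_apply, Matrix.cons_val,
    map_neg, CliffordAlgebra.reverse_reverse, mul_neg, neg_mul, neg_inj, Matrix.one_apply_eq] at e1 e2 e3 e4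
  have key : reverse (den M x) * (mob M x - mob M y) * den M y = x - y := by
    rw [mul_sub, sub_mul, hR, mul_assoc, mob_mul_den h hy, hD, den]
    have : (x * reverse (M 0 0) + reverse (M 0 1)) * (M 1 0 * y + M 1 1)
        - (x * reverse (M 1 0) + reverse (M 1 1)) * (M 0 0 * y + M 0 1)
        = x * (reverse (M 0 0) * M 1 0 - reverse (M 1 0) * M 0 0) * y
          + x * (-(reverse (M 1 0) * M 0 1) + reverse (M 0 0) * M 1 1)
          - (reverse (M 1 1) * M 0 0 + -(reverse (M 0 1) * M 1 0)) * y
          + (reverse (M 0 1) * M 1 1 - reverse (M 1 1) * M 0 1) := by noncomm_ring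
    rw [this, e3, e4, e1, ← e2]
    simp
  rw [← key, norm_mul_right (den_mem_pvProd h hy.1),
    norm_mul_left (reverse_mem_pvProd (den_mem_pvProd h hx.1)), norm_reverse]
  ring

end

/-! ### The kernel -/

theorem kernel_eq {n : ℕ} {k : ℤ} {κ : ℕ} (hk : k = -κ) (y : Cl n) :
    kernel k y = (‖y‖ ^ (n + κ + 1))⁻¹ • star y := by
  have : ((n : ℤ) + 1 - k) = ((n + κ + 1 : ℕ) : ℤ) := by rw [hk]; push_cast; ring
  rw [kernel, this, zpow_natCast]

theorem norm_kernel {n : ℕ} {k : ℤ} {κ : ℕ} (hk : k = -κ) {y : Cl n} (hy : y ≠ 0) :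
    ‖kernel k y‖ = (‖y‖ ^ (n + κ))⁻¹ := by
  have h : ‖y‖ ≠ 0 := norm_ne_zero_iff.2 hy
  rw [kernel_eq hk, norm_smul, norm_star', norm_inv, norm_pow, norm_norm, pow_succ, mul_inv, mul_assoc,
    inv_mul_cancel₀ h, mul_one]

theorem kernel_mul {n : ℕ} (k : ℤ) {u : Cl n} (hu : u ∈ pvProd n) (v : Cl n) :
    kernel k (v * u) = kernel k u * kernel k v := by
  rw [kernel, kernel, kernel, norm_mul_right hu, star_mul, smul_mul_smul_comm, mul_zpow, mul_inv_rev]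

section
variable {n : ℕ} [NeZero n]

/-! ### Norms along the vertical axis -/

theorem en_mul_en : en n * en n = -1 := e_mul_self _

theorem en_mem_paravec : en n ∈ paravec n := e_mem_paravec _

theorem smul_en_mem_upperHalf {t : ℝ} (ht : 0 < t) : t • en n ∈ upperHalf n :=
  ⟨Submodule.smul_mem _ _ en_mem_paravec, by rw [xn_smul, xn_en, mul_one]; exact ht⟩

theorem en_mem_upperHalf : en n ∈ upperHalf n := ⟨en_mem_paravec, by rw [xn_en]; exact one_pos⟩

theorem vVal_axis {M : Mat n} (h : SAV M) (s t : ℝ) :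
    vVal M (s • en n) (t • en n) =
      (M 0 1 - (t * s) • involute (M 1 0)) + (s • M 0 0 + t • involute (M 1 1)) * en n := by
  have hl : ∀ i j, M i j ∈ lowAlg n := fun i j => mem_lowAlg_of_mem_lowProd (h.mem i j)
  have h1 : en n * M 1 0 * en n = -involute (M 1 0) := by
    rw [en_mul (hl _ _), mul_assoc, en_mul_en, mul_neg, mul_one]
  rw [vVal, mul_add, mul_smul_comm, mul_smul_comm, smul_mul_assoc, smul_mul_assoc, mul_smul_comm,
    ← mul_assoc, h1, en_mul (hl 1 1), add_mul, smul_mul_assoc, smul_mul_assoc, smul_neg, smul_neg,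
    smul_smul]
  abel

/-- The exact norm on the vertical axis: the mixed terms combine to the determinant, which is `1`. No sign
of `s` and `t` is prescribed. -/
theorem norm_vVal_axis_sq {M : Mat n} (h : SAV M) (s t : ℝ) :
    ‖vVal M (s • en n) (t • en n)‖ ^ 2 = ‖M 0 1‖ ^ 2 + s ^ 2 * ‖M 0 0‖ ^ 2 + t ^ 2 * ‖M 1 1‖ ^ 2
      + t ^ 2 * s ^ 2 * ‖M 1 0‖ ^ 2 + 2 * t * s := by
  have hl : ∀ i j, M i j ∈ lowAlg n := fun i j => mem_lowAlg_of_mem_lowProd (h.mem i j)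
  have h1 : ⟪M 0 0, involute (M 1 1)⟫ - ⟪M 0 1, involute (M 1 0)⟫ = 1 := by
    have : ∀ a b : Cl n, ⟪a, involute b⟫ = sc (a * reverse b) := by
      intro a b
      rw [real_inner_comm, inner_def, star_involute, sc_mul_comm]
    rw [this, this, ← map_sub, h.det, sc_one]
  rw [vVal_axis h, norm_sq_add_mul_en
    (sub_mem (hl _ _) (Subalgebra.smul_mem _ (involute_mem_lowAlg (hl _ _)) _))
    (add_mem (Subalgebra.smul_mem _ (hl _ _) _)
      (Subalgebra.smul_mem _ (involute_mem_lowAlg (hl _ _)) _)),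
    norm_sub_sq_real, norm_add_sq_real, real_inner_smul_left, real_inner_smul_right,
    real_inner_smul_right, norm_smul, norm_smul, norm_smul, norm_involute, norm_involute]
  simp only [mul_pow, Real.norm_eq_abs, sq_abs]
  linear_combination (2 * t * s) * h1

theorem norm_den_axis_sq {M : Mat n} (h : SAV M) (s : ℝ) :
    ‖den M (s • en n)‖ ^ 2 = s ^ 2 * ‖M 1 0‖ ^ 2 + ‖M 1 1‖ ^ 2 := by
  have hl : ∀ i j, M i j ∈ lowAlg n := fun i j => mem_lowAlg_of_mem_lowProd (h.mem i j)
  rw [den, mul_smul_comm, ← smul_mul_assoc, add_comm,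
    norm_sq_add_mul_en (hl _ _) (Subalgebra.smul_mem _ (hl _ _) _), norm_smul, mul_pow, add_comm]
  simp

/-- The size of an entry is controlled by the value at `x = w = e_n`. -/
theorem norm_entry_le {M : Mat n} (h : SAV M) (i j : Fin 2) : ‖M i j‖ ≤ ‖vVal M (en n) (en n)‖ := by
  have h1 := norm_vVal_axis_sq h 1 1
  simp only [one_smul, one_pow, one_mul, mul_one] at h1
  refine (le_abs_self _).trans (abs_le_of_sq_le_sq ?_ (norm_nonneg _))
  rw [h1]
  have := sq_nonneg ‖M 0 0‖; have := sq_nonneg ‖M 0 1‖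
  have := sq_nonneg ‖M 1 0‖; have := sq_nonneg ‖M 1 1‖
  fin_cases i <;> fin_cases j <;> simp only [Fin.zero_eta, Fin.mk_one] <;> linarith

/-- The value on the axis grows with both parameters. -/
theorem norm_vVal_axis_mono {M : Mat n} (h : SAV M) {s t : ℝ} (hs : 1 ≤ s) (ht : 1 ≤ t) :
    ‖vVal M (en n) (en n)‖ ≤ ‖vVal M (s • en n) (t • en n)‖ := by
  have h1 := norm_vVal_axis_sq h 1 1
  simp only [one_smul, one_pow, one_mul, mul_one] at h1
  refine (le_abs_self _).trans (abs_le_of_sq_le_sq ?_ (norm_nonneg _))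
  rw [h1, norm_vVal_axis_sq h]
  have hs2 : 1 ≤ s ^ 2 := one_le_pow₀ hs
  have ht2 : 1 ≤ t ^ 2 := one_le_pow₀ ht
  have hst : 1 ≤ t ^ 2 * s ^ 2 := one_le_mul_of_one_le_of_one_le ht2 hs2
  have hst' : 1 ≤ t * s := one_le_mul_of_one_le_of_one_le ht hs
  have := le_mul_of_one_le_left (sq_nonneg ‖M 0 0‖) hs2
  have := le_mul_of_one_le_left (sq_nonneg ‖M 1 1‖) ht2
  have := le_mul_of_one_le_left (sq_nonneg ‖M 1 0‖) hst
  linarith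

/-! ### Comparison of different base points -/

theorem xn_le_norm {x : Cl n} : xn x ≤ ‖x‖ := (le_abs_self _).trans (abs_xn_le_norm x)

/-- `‖c x + d‖ ≥ x_n ‖c‖`. -/
theorem xn_mul_norm_le_norm_den {M : Mat n} (h : SAV M) {x : Cl n} (hx : x ∈ upperHalf n) :
    xn x * ‖M 1 0‖ ≤ ‖den M x‖ := by
  have hl : ∀ i j, M i j ∈ lowAlg n := fun i j => mem_lowAlg_of_mem_lowProd (h.mem i j)
  have hy := mem_lowAlg_of_mem_lowParavec (sub_xn_smul_mem_lowParavec hx.1)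
  have h1 : den M x = (M 1 0 * (x - xn x • en n) + M 1 1) + (xn x • M 1 0) * en n := by
    rw [den, mul_sub, mul_smul_comm, smul_mul_assoc]; abel
  refine (le_abs_self _).trans (abs_le_of_sq_le_sq ?_ (norm_nonneg _))
  rw [h1, norm_sq_add_mul_en (add_mem (mul_mem (hl _ _) hy) (hl _ _)) (Subalgebra.smul_mem _ (hl _ _) _),
    norm_smul, Real.norm_eq_abs, abs_of_pos hx.2]
  linarith [sq_nonneg ‖M 1 0 * (x - xn x • en n) + M 1 1‖]

theorem norm_den_le {M : Mat n} (h : SAV M) {x y : Cl n} (hx : x ∈ upperHalf n) :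
    ‖den M y‖ ≤ (1 + ‖x - y‖ / xn x) * ‖den M x‖ := by
  have h1 : den M y = den M x + M 1 0 * (y - x) := by rw [den, den]; noncomm_ring
  have h2 := xn_mul_norm_le_norm_den h hx
  rw [h1]
  refine (norm_add_le _ _).trans ?_
  rw [norm_mul_left (mem_pvProd_of_mem_lowProd (h.mem 1 0)), norm_sub_rev y x, add_mul, one_mul]
  refine add_le_add le_rfl ?_
  rw [div_mul_eq_mul_div, le_div_iff₀ hx.2]
  nlinarith [norm_nonneg (x - y)]

/-- Moving the first argument changes the value by a bounded factor, uniformly in `M`. -/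
theorem norm_vVal_le_left {M : Mat n} (h : SAV M) {x y w : Cl n} (hx : x ∈ upperHalf n)
    (hy : y ∈ upperHalf n) (hw : w ∈ upperHalf n) :
    ‖vVal M y w‖ ≤ (1 + 2 * (‖x - y‖ / xn x)) * ‖vVal M x w‖ := by
  have hx0 := norm_den_pos h hx
  have hy0 := norm_den_pos h hy
  have hxn := hx.2
  have h1 := norm_mob_sub_mob h hx hy
  have h2 := norm_den_le (y := y) h hx
  have h3 : xn x / ‖den M x‖ ^ 2 ≤ ‖w + mob M x‖ := by
    rw [← xn_mob h hx.1]
    refine le_trans ?_ xn_le_norm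
    rw [xn_add]; linarith [hw.2]
  rw [norm_vVal h hx, norm_vVal h hy]
  have h4 : ‖w + mob M y‖ ≤ ‖w + mob M x‖ + ‖mob M x - mob M y‖ := by
    have : w + mob M y = (w + mob M x) - (mob M x - mob M y) := by abel
    rw [this]; exact norm_sub_le _ _
  have h5 : ‖mob M x - mob M y‖ * ‖den M y‖ ≤ ‖x - y‖ / xn x * (‖w + mob M x‖ * ‖den M x‖) := by
    have e1 : ‖mob M x - mob M y‖ * ‖den M y‖ = ‖x - y‖ / ‖den M x‖ := by
      rw [eq_div_iff hx0.ne', ← h1]; ring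
    have e2 : 1 / ‖den M x‖ = (xn x / ‖den M x‖ ^ 2 * ‖den M x‖) / xn x := by
      field_simp
    have e3 : 1 / ‖den M x‖ ≤ (‖w + mob M x‖ * ‖den M x‖) / xn x := by
      rw [e2]; gcongr
    calc ‖mob M x - mob M y‖ * ‖den M y‖ = ‖x - y‖ * (1 / ‖den M x‖) := by rw [e1]; ring
      _ ≤ ‖x - y‖ * ((‖w + mob M x‖ * ‖den M x‖) / xn x) := by gcongr
      _ = _ := by ring
  calc ‖w + mob M y‖ * ‖den M y‖ ≤ (‖w + mob M x‖ + ‖mob M x - mob M y‖) * ‖den M y‖ := by gcongr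
    _ = ‖w + mob M x‖ * ‖den M y‖ + ‖mob M x - mob M y‖ * ‖den M y‖ := by ring
    _ ≤ ‖w + mob M x‖ * ((1 + ‖x - y‖ / xn x) * ‖den M x‖)
        + ‖x - y‖ / xn x * (‖w + mob M x‖ * ‖den M x‖) := by gcongr
    _ = _ := by ring

theorem norm_vVal_le_right {M : Mat n} (h : SAV M) {x w v : Cl n} (hx : x ∈ upperHalf n)
    (hw : w ∈ upperHalf n) :
    ‖vVal M x v‖ ≤ (1 + ‖w - v‖ / xn w) * ‖vVal M x w‖ := by
  rw [norm_vVal h hx, norm_vVal h hx, ← mul_assoc]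
  gcongr
  have h1 : v + mob M x = (w + mob M x) - (w - v) := by abel
  have h2 : xn w ≤ ‖w + mob M x‖ := by
    refine le_trans ?_ xn_le_norm
    rw [xn_add]; linarith [(mob_mem_upperHalf h hx).2]
  rw [h1]
  refine (norm_sub_le _ _).trans ?_
  rw [add_mul, one_mul]
  refine add_le_add le_rfl ?_
  rw [div_mul_eq_mul_div, le_div_iff₀ hw.2]
  gcongr

theorem norm_vVal_en_le {M : Mat n} (h : SAV M) {x w : Cl n} (hx : x ∈ upperHalf n)
    (hw : w ∈ upperHalf n) :
    ‖vVal M (en n) (en n)‖ ≤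
      (1 + 2 * (‖x - en n‖ / xn x)) * (1 + ‖w - en n‖ / xn w) * ‖vVal M x w‖ := by
  refine (norm_vVal_le_left h hx en_mem_upperHalf en_mem_upperHalf).trans ?_
  rw [mul_assoc]
  have := hx.2
  gcongr
  exact norm_vVal_le_right h hx hw

/-! ### The summands of the Poincaré series -/

theorem term_eq_kernel (k : ℤ) {M : Mat n} (h : SAV M) {x : Cl n} (hx : x ∈ upperHalf n) (w : Cl n) :
    term k M x w = kernel k (vVal M x w) := by
  rw [vVal_eq h hx, kernel_mul k (den_mem_pvProd h hx.1)]; rfl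

/-- The cocycle law behind automorphy. -/
theorem term_mul (k : ℤ) {M' M : Mat n} (h : SAV M) (h' : SAV M') {x : Cl n} (hx : x ∈ upperHalf n)
    (w : Cl n) : term k (M' * M) x w = autFactor k M x * term k M' (mob M x) w := by
  rw [term, term, mob_mul h' h hx, ← mul_assoc]
  congr 1
  change kernel k (den (M' * M) x) = kernel k (den M x) * kernel k (den M' (mob M x))
  rw [den_mul h hx, kernel_mul k (den_mem_pvProd h hx.1)]

end

/-! ### Rationality -/

/-- All coefficients of `a` are rational. -/
def HasRatCoeff {n : ℕ} (a : Cl n) : Prop := ∀ A, ∃ q : ℚ, coeff A a = q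

theorem HasRatCoeff.add {n : ℕ} {a b : Cl n} (ha : HasRatCoeff a) (hb : HasRatCoeff b) :
    HasRatCoeff (a + b) := fun A => by
  obtain ⟨p, hp⟩ := ha A
  obtain ⟨q, hq⟩ := hb A
  exact ⟨p + q, by rw [coeff_add, hp, hq]; push_cast; rfl⟩

theorem HasRatCoeff.smul {n : ℕ} {a : Cl n} (q : ℚ) (ha : HasRatCoeff a) :
    HasRatCoeff ((q : ℝ) • a) := fun A => by
  obtain ⟨p, hp⟩ := ha A
  exact ⟨q * p, by rw [coeff_smul, hp]; push_cast; rfl⟩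

theorem HasRatCoeff.neg {n : ℕ} {a : Cl n} (ha : HasRatCoeff a) : HasRatCoeff (-a) := by
  simpa using ha.smul (-1)

theorem HasRatCoeff.eA {n : ℕ} (A : Finset (Fin n)) : HasRatCoeff (eA A) := fun B => by
  rw [coeff_eA]; split_ifs
  · exact ⟨1, by simp⟩
  · exact ⟨0, by simp⟩

theorem HasRatCoeff.sum {n : ℕ} {ι : Type*} (s : Finset ι) (f : ι → Cl n)
    (h : ∀ i ∈ s, HasRatCoeff (f i)) : HasRatCoeff (∑ i ∈ s, f i) :=
  Finset.sum_induction f HasRatCoeff (fun _ _ => HasRatCoeff.add)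
    (fun A => ⟨0, by rw [coeff_zero]; simp⟩) h

theorem HasRatCoeff.exists_sum {n : ℕ} {a : Cl n} (ha : HasRatCoeff a) :
    ∃ q : Finset (Fin n) → ℚ, a = ∑ A, (q A : ℝ) • CliffordPoincare.eA A := by
  choose q hq using ha
  exact ⟨q, by simp only [← hq, sum_coeff]⟩

theorem HasRatCoeff.mul {n : ℕ} {a b : Cl n} (ha : HasRatCoeff a) (hb : HasRatCoeff b) :
    HasRatCoeff (a * b) := by
  obtain ⟨p, rfl⟩ := ha.exists_sum
  obtain ⟨q, rfl⟩ := hb.exists_sum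
  rw [Finset.sum_mul_sum]
  refine .sum _ _ fun A _ => .sum _ _ fun B _ => ?_
  rw [smul_mul_assoc, mul_smul_comm]
  refine .smul _ (.smul _ ?_)
  rcases eA_mul_eA A B with h | h <;> rw [h]
  · exact .eA _
  · exact (HasRatCoeff.eA _).neg

theorem HasRatCoeff.star {n : ℕ} {a : Cl n} (ha : HasRatCoeff a) : HasRatCoeff (star a) := by
  obtain ⟨p, rfl⟩ := ha.exists_sum
  rw [star_sum]
  refine .sum _ _ fun A _ => ?_
  rw [CliffordAlgebra.star_smul]
  refine .smul _ ?_
  rcases star_eA A with h | h <;> rw [h]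
  · exact .eA _
  · exact (HasRatCoeff.eA _).neg

theorem hasRatCoeff_e {n : ℕ} (i : Fin n) : HasRatCoeff (e i) := by
  rw [← eA_singleton]; exact .eA _

theorem hasRatCoeff_of_mem_ratCl {n : ℕ} {a : Cl n} (ha : a ∈ ratCl n) : HasRatCoeff a := by
  induction ha using Algebra.adjoin_induction with
  | mem x hx => obtain ⟨i, rfl⟩ := hx; exact hasRatCoeff_e i
  | algebraMap q =>
    rw [IsScalarTower.algebraMap_apply ℚ ℝ, Algebra.algebraMap_eq_smul_one, ← eA_empty]
    exact .smul q (.eA _)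
  | add x y _ _ hx hy => exact hx.add hy
  | mul x y _ _ hx hy => exact hx.mul hy

theorem paravec_eq_sum {n : ℕ} {x : Cl n} (hx : x ∈ paravec n) :
    x = coeff ∅ x • 1 + ∑ i, coeff {i} x • e i := by
  induction hx using Submodule.span_induction with
  | mem x hx =>
    rcases hx with rfl | ⟨i, rfl⟩
    · simp [coeff_one]
    · simp_rw [← eA_singleton, coeff_eA, Finset.singleton_inj]
      simp
  | zero => simp [coeff_zero]
  | add x y _ _ hx hy =>
    simp only [coeff_add, add_smul, Finset.sum_add_distrib]
    nth_rewrite 1 [hx]; nth_rewrite 1 [hy]; abel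
  | smul c x _ hx =>
    simp only [coeff_smul, mul_smul, ← Finset.smul_sum, ← smul_add]
    rw [← hx]

theorem mem_ratParavec {n : ℕ} {x : Cl n} (hx : x ∈ paravec n) (h : HasRatCoeff x) :
    x ∈ ratParavec n := by
  choose q hq using h
  rw [paravec_eq_sum hx]
  simp only [hq, Rat.cast_smul_eq_qsmul]
  refine add_mem (Submodule.smul_mem _ _ (Submodule.subset_span (by simp)))
    (sum_mem fun i _ => Submodule.smul_mem _ _ (Submodule.subset_span (by simp)))

theorem of_mem_ratParavec {n : ℕ} {x : Cl n} (hx : x ∈ ratParavec n) :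
    x ∈ paravec n ∧ HasRatCoeff x := by
  induction hx using Submodule.span_induction with
  | mem x hx =>
    refine ⟨Submodule.subset_span hx, ?_⟩
    rcases hx with rfl | ⟨i, rfl⟩
    · rw [← eA_empty]; exact .eA _
    · exact hasRatCoeff_e i
  | zero => exact ⟨zero_mem _, fun A => ⟨0, by rw [coeff_zero]; simp⟩⟩
  | add x y _ _ hx hy => exact ⟨add_mem hx.1 hy.1, hx.2.add hy.2⟩
  | smul q x _ hx =>
    rw [← Rat.cast_smul_eq_qsmul ℝ]
    exact ⟨Submodule.smul_mem _ _ hx.1, hx.2.smul q⟩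

theorem isRatScalar_of_eq_algebraMap {n : ℕ} {a : Cl n} {r : ℝ} (h : a = algebraMap ℝ (Cl n) r)
    (ha : HasRatCoeff a) : IsRatScalar a := by
  obtain ⟨q, hq⟩ := ha ∅
  refine ⟨q, ?_⟩
  have : r = q := by rw [← hq, h, ← sc_apply, sc_algebraMap]
  rw [h, this, IsScalarTower.algebraMap_apply ℚ ℝ]; rfl

section
variable {n : ℕ} [NeZero n]

/-- For a Vahlen matrix with rational entries the rationality conditions hold automatically. -/
theorem SAV.isRational {M : Mat n} (h : SAV M) (hr : ∀ i j, HasRatCoeff (M i j)) : IsRational M := by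
  have hm : ∀ i j, M i j ∈ pvProd n := fun i j => mem_pvProd_of_mem_lowProd (h.mem i j)
  have row : ∀ i, ∀ x ∈ ratParavec n,
      IsRatScalar (M i 0 * x * star (M i 1) + M i 1 * star x * star (M i 0)) := by
    intro i x hx
    obtain ⟨hx, hxr⟩ := of_mem_ratParavec hx
    -- polarise the scalar `(a x + b) (a x + b)‾`
    have h1 := mul_star_self_of_mem_pvProd (h.row_mem_pvProd i hx)
    have h2 := mul_star_self_of_mem_pvProd (mem_pvProd_of_mem_paravec hx)
    have h3 := mul_star_self_of_mem_pvProd (hm i 0)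
    have h4 := mul_star_self_of_mem_pvProd (hm i 1)
    have h5 : M i 0 * x * star (M i 1) + M i 1 * star x * star (M i 0) = algebraMap ℝ (Cl n)
        (‖M i 0 * x + M i 1‖ ^ 2 - ‖x‖ ^ 2 * ‖M i 0‖ ^ 2 - ‖M i 1‖ ^ 2) := by
      have h6 : M i 0 * (x * star x) * star (M i 0) =
          algebraMap ℝ (Cl n) (‖x‖ ^ 2 * ‖M i 0‖ ^ 2) := by
        rw [h2, ← Algebra.commutes, mul_assoc, h3, map_mul]
      rw [map_sub, map_sub, ← h1, ← h4, ← h6, star_add, star_mul]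
      noncomm_ring
    exact isRatScalar_of_eq_algebraMap h5
      ((((hr _ _).mul hxr).mul (hr _ _).star).add (((hr _ _).mul hxr.star).mul (hr _ _).star))
  refine ⟨fun i j => ?_, ?_, ?_, row 0, row 1, fun x hx => ?_⟩
  · exact isRatScalar_of_eq_algebraMap (mul_star_self_of_mem_pvProd (hm i j)) ((hr _ _).mul (hr _ _).star)
  · exact mem_ratParavec h.ac ((hr _ _).mul (hr _ _).star)
  · exact mem_ratParavec h.bd ((hr _ _).mul (hr _ _).star)
  · obtain ⟨hx, hxr⟩ := of_mem_ratParavec hx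
    refine mem_ratParavec ?_
      ((((hr _ _).mul hxr).mul (hr _ _).star).add (((hr _ _).mul hxr.star).mul (hr _ _).star))
    have h1 := h.mul_star_mem_paravec hx
    have h2 : M 0 0 * x * star (M 1 1) + M 0 1 * star x * star (M 1 0)
        = (M 0 0 * x + M 0 1) * star (M 1 0 * x + M 1 1) - ‖x‖ ^ 2 • (M 0 0 * star (M 1 0))
          - M 0 1 * star (M 1 1) := by
      have h3 : ‖x‖ ^ 2 • (M 0 0 * star (M 1 0)) = M 0 0 * (x * star x) * star (M 1 0) := by
        rw [mul_star_self_of_mem_pvProd (mem_pvProd_of_mem_paravec hx), ← Algebra.commutes, mul_assoc,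
          ← Algebra.smul_def]
      rw [h3, star_add, star_mul]
      noncomm_ring
    rw [h2]
    exact sub_mem (sub_mem h1 (Submodule.smul_mem _ _ h.ac)) h.bd

/-! ### The arithmetic groups -/

theorem mem_Gam_iff {I : Subring (Cl n)} (hI : IsInvolutiveOrder I) {M : Mat n} :
    M ∈ Gam I ↔ SAV M ∧ ∀ i j, M i j ∈ I := by
  constructor
  · rintro ⟨h1, -, h2⟩; exact ⟨h1.toSAV, h2⟩
  · rintro ⟨h1, h2⟩
    exact ⟨h1.isSAV, h1.isRational fun i j => hasRatCoeff_of_mem_ratCl (hI.rational _ (h2 i j)), h2⟩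

variable {I : Subring (Cl n)}

theorem Gam.sav {M : Mat n} (h : M ∈ Gam I) : SAV M := h.1.toSAV

theorem GamN.sav {N : ℕ} {M : Mat n} (h : M ∈ GamN I N) : SAV M := Gam.sav h.1

theorem mul_mem_Gam (hI : IsInvolutiveOrder I) {M M' : Mat n} (h : M ∈ Gam I) (h' : M' ∈ Gam I) :
    M * M' ∈ Gam I := by
  rw [mem_Gam_iff hI] at *
  refine ⟨h.1.mul h'.1, fun i j => ?_⟩
  rw [Matrix.mul_apply]
  exact sum_mem fun l _ => mul_mem (h.2 _ _) (h'.2 _ _)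

theorem adj_mem_Gam (hI : IsInvolutiveOrder I) {M : Mat n} (h : M ∈ Gam I) : adj M ∈ Gam I := by
  rw [mem_Gam_iff hI] at *
  refine ⟨h.1.adj, fun i j => ?_⟩
  fin_cases i <;> fin_cases j <;> simp only [adj, Fin.zero_eta, Fin.mk_one, Matrix.of_apply,
    Matrix.cons_val]
  · exact hI.reverse_mem _ (h.2 _ _)
  · exact neg_mem (hI.reverse_mem _ (h.2 _ _))
  · exact neg_mem (hI.reverse_mem _ (h.2 _ _))
  · exact hI.reverse_mem _ (h.2 _ _)

theorem mul_mem_GamN (hI : IsInvolutiveOrder I) {N : ℕ} {M M' : Mat n} (h : M ∈ GamN I N)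
    (h' : M' ∈ GamN I N) : M * M' ∈ GamN I N := by
  refine ⟨mul_mem_Gam hI h.1 h'.1, fun i j => ?_⟩
  have h1 : M * M' - 1 = (M - 1) * M' + (M' - 1) := by noncomm_ring
  choose q hq hq' using h.2
  choose p hp hp' using h'.2
  refine ⟨∑ l, q i l * M' l j + p i j, add_mem (sum_mem fun l _ => mul_mem (hq _ _) (h'.1.2.2 _ _)) (hp _ _), ?_⟩
  rw [h1, Matrix.add_apply, Matrix.mul_apply, hp', smul_add, Finset.smul_sum]
  congr 1
  refine Finset.sum_congr rfl fun l _ => ?_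
  rw [hq', smul_mul_assoc]

theorem adj_mem_GamN (hI : IsInvolutiveOrder I) {N : ℕ} {M : Mat n} (h : M ∈ GamN I N) :
    adj M ∈ GamN I N := by
  refine ⟨adj_mem_Gam hI h.1, fun i j => ?_⟩
  choose q hq hq' using h.2
  have hr : ∀ i j, reverse ((M - 1) i j) = N • reverse (q i j) := fun i j => by rw [hq', map_nsmul]
  have h00 := hr 0 0
  have h01 := hr 0 1
  have h10 := hr 1 0
  have h11 := hr 1 1
  simp only [Matrix.sub_apply, Matrix.one_apply_eq, map_sub, reverse.map_one, ne_eq, one_ne_zero, zero_ne_one,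
    not_false_eq_true, Matrix.one_apply_ne, sub_zero] at h00 h01 h10 h11
  fin_cases i <;> fin_cases j <;> simp only [adj, Fin.zero_eta, Fin.mk_one, Matrix.of_apply,
    Matrix.cons_val, Matrix.sub_apply, Matrix.one_apply_eq, ne_eq, one_ne_zero, zero_ne_one,
    not_false_eq_true, Matrix.one_apply_ne, sub_zero]
  · exact ⟨_, hI.reverse_mem _ (hq 1 1), h11⟩
  · exact ⟨_, neg_mem (hI.reverse_mem _ (hq 0 1)), by rw [h01, smul_neg]⟩
  · exact ⟨_, neg_mem (hI.reverse_mem _ (hq 1 0)), by rw [h10, smul_neg]⟩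
  · exact ⟨_, hI.reverse_mem _ (hq 0 0), h00⟩

theorem neg_one_mem_Gam (hI : IsInvolutiveOrder I) : (-1 : Mat n) ∈ Gam I := by
  refine (mem_Gam_iff hI).2 ⟨SAV.neg_one, fun i j => ?_⟩
  rw [Matrix.neg_apply, Matrix.one_apply]
  split_ifs
  · exact neg_mem (one_mem _)
  · simp

theorem one_mem_GamN (hI : IsInvolutiveOrder I) (N : ℕ) : (1 : Mat n) ∈ GamN I N := by
  have h : (1 : Mat n) ∈ Gam I := by
    simpa using mul_mem_Gam hI (neg_one_mem_Gam hI) (neg_one_mem_Gam hI)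
  exact ⟨h, fun i j => ⟨0, zero_mem _, by simp⟩⟩

theorem transl_mem_GamN (hI : IsInvolutiveOrder I) {N : ℕ} {b : Cl n} (hb : b ∈ I)
    (hb' : b ∈ lowParavec n) : transl (N • b) ∈ GamN I N := by
  have h : transl (N • b) ∈ Gam I := by
    refine (mem_Gam_iff hI).2 ⟨SAV.transl (nsmul_mem hb' N), fun i j => ?_⟩
    fin_cases i <;> fin_cases j <;> simp only [transl, Fin.zero_eta, Fin.mk_one, Matrix.of_apply,
      Matrix.cons_val]
    · exact one_mem _
    · exact nsmul_mem hb N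
    · exact zero_mem _
    · exact one_mem _
  refine ⟨h, fun i j => ?_⟩
  fin_cases i <;> fin_cases j <;> simp [transl]
  · exact ⟨0, zero_mem _, by simp⟩
  · exact ⟨b, hb, rfl⟩
  · exact ⟨0, zero_mem _, by simp⟩
  · exact ⟨0, zero_mem _, by simp⟩

/-! ### Discreteness of the order -/

/-- The coordinates of all elements of an order have a common denominator. -/
theorem exists_denominator {n : ℕ} {I : Subring (Cl n)} (hI : IsInvolutiveOrder I) :
    ∃ D : ℕ, 0 < D ∧ ∀ a ∈ I, ∀ A, ∃ z : ℤ, coeff A a * D = z := by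
  obtain ⟨S, hS⟩ := hI.fg
  have hSI : ∀ s ∈ S, s ∈ I := fun s hs => by
    have : s ∈ I.toAddSubgroup := hS ▸ AddSubgroup.subset_closure hs
    exact this
  have hq : ∀ s : S, ∀ A, ∃ q : ℚ, coeff A (s : Cl n) = q := fun s =>
    hasRatCoeff_of_mem_ratCl (hI.rational _ (hSI s s.2))
  choose q hq using hq
  refine ⟨∏ s, ∏ A, (q s A).den, Finset.prod_pos fun s _ => Finset.prod_pos fun A _ => (q s A).den_pos, ?_⟩
  intro a ha A
  have ha' : a ∈ AddSubgroup.closure (S : Set (Cl n)) := by rw [hS]; exact ha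
  clear ha
  induction ha' using AddSubgroup.closure_induction with
  | mem s hs =>
    have hd : (q ⟨s, hs⟩ A).den ∣ ∏ s, ∏ A, (q s A).den :=
      (Finset.dvd_prod_of_mem (fun A => (q ⟨s, hs⟩ A).den) (Finset.mem_univ A)).trans
        (Finset.dvd_prod_of_mem (fun s => ∏ A, (q s A).den) (Finset.mem_univ _))
    obtain ⟨m, hm⟩ := hd
    refine ⟨(q ⟨s, hs⟩ A).num * m, ?_⟩
    rw [hm, hq ⟨s, hs⟩ A]
    have h2 : ((q ⟨s, hs⟩ A : ℚ) : ℝ) * (q ⟨s, hs⟩ A).den = (q ⟨s, hs⟩ A).num := by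
      exact_mod_cast Rat.mul_den_eq_num (q ⟨s, hs⟩ A)
    push_cast
    rw [← mul_assoc, h2]
  | zero => exact ⟨0, by rw [coeff_zero]; simp⟩
  | add x y _ _ hx hy =>
    obtain ⟨z, hz⟩ := hx
    obtain ⟨z', hz'⟩ := hy
    exact ⟨z + z', by rw [coeff_add, add_mul, hz, hz']; push_cast; rfl⟩
  | neg x _ hx =>
    obtain ⟨z, hz⟩ := hx
    exact ⟨-z, by rw [coeff_neg, neg_mul, hz]; push_cast; rfl⟩

theorem exists_le_norm {n : ℕ} {I : Subring (Cl n)} (hI : IsInvolutiveOrder I) :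
    ∃ δ : ℝ, 0 < δ ∧ ∀ a ∈ I, a ≠ 0 → δ ≤ ‖a‖ := by
  obtain ⟨D, hD, h⟩ := exists_denominator hI
  have hD' : (0 : ℝ) < D := by exact_mod_cast hD
  refine ⟨1 / D, by positivity, fun a ha h0 => ?_⟩
  obtain ⟨A, hA⟩ : ∃ A, coeff A a ≠ 0 := by
    by_contra! hc
    exact h0 (ext_coeff fun A => by rw [hc, coeff_zero])
  obtain ⟨z, hz⟩ := h a ha A
  have hz0 : z ≠ 0 := by
    rintro rfl
    simp only [Int.cast_zero, mul_eq_zero] at hz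
    exact hz.elim hA hD'.ne'
  have h1 : (1 : ℝ) ≤ |(z : ℝ)| := by exact_mod_cast Int.one_le_abs hz0
  rw [← hz, abs_mul, abs_of_pos hD'] at h1
  rw [div_le_iff₀ hD']
  exact h1.trans (by gcongr; exact abs_coeff_le_norm A a)

theorem finite_norm_le {n : ℕ} {I : Subring (Cl n)} (hI : IsInvolutiveOrder I) (R : ℝ) :
    {a : Cl n | a ∈ I ∧ ‖a‖ ≤ R}.Finite := by
  obtain ⟨D, hD, h⟩ := exists_denominator hI
  have hD' : (0 : ℝ) < D := by exact_mod_cast hD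
  let f : Cl n → (Finset (Fin n) → ℤ) := fun a A => ⌊coeff A a * D⌋
  have hf : ∀ a ∈ I, ∀ A, coeff A a * D = f a A := by
    intro a ha A
    obtain ⟨z, hz⟩ := h a ha A
    simp [f, hz]
  refine Set.Finite.of_injOn (f := f)
    (t := Set.Icc (fun _ => -⌈R * D⌉) (fun _ => ⌈R * D⌉)) ?_ ?_ (Set.finite_Icc _ _)
  · rintro a ⟨ha, haR⟩
    have h1 : ∀ A, |((f a A : ℤ) : ℝ)| ≤ ⌈R * D⌉ := by
      intro A
      rw [← hf a ha A, abs_mul, abs_of_pos hD']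
      refine le_trans ?_ (Int.le_ceil _)
      gcongr
      exact (abs_coeff_le_norm A a).trans haR
    have h2 : ∀ A, |f a A| ≤ ⌈R * D⌉ := fun A => by exact_mod_cast h1 A
    exact ⟨fun A => (abs_le.1 (h2 A)).1, fun A => (abs_le.1 (h2 A)).2⟩
  · rintro a ⟨ha, -⟩ b ⟨hb, -⟩ hab
    refine ext_coeff fun A => ?_
    have h1 := hf a ha A
    rw [hab, ← hf b hb A] at h1
    exact mul_right_cancel₀ hD'.ne' h1

/-- Some positive multiple of all generators lies in the order. -/
theorem exists_nsmul_e_mem {n : ℕ} {I : Subring (Cl n)} (hI : IsInvolutiveOrder I) :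
    ∃ m : ℕ, 0 < m ∧ ∀ i, m • e i ∈ I := by
  have h : ∀ x ∈ Submodule.span ℚ (I : Set (Cl n)), ∃ m : ℕ, 0 < m ∧ m • x ∈ I := by
    intro x hx
    induction hx using Submodule.span_induction with
    | mem x hx => exact ⟨1, one_pos, by simpa using hx⟩
    | zero => exact ⟨1, one_pos, by simp⟩
    | add x y _ _ hx hy =>
      obtain ⟨m, hm, hm'⟩ := hx
      obtain ⟨k, hk, hk'⟩ := hy
      refine ⟨m * k, Nat.mul_pos hm hk, ?_⟩
      rw [smul_add, mul_comm m k, mul_smul, mul_comm k m, mul_smul]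
      exact add_mem (nsmul_mem hm' k) (nsmul_mem hk' m)
    | smul q x _ hx =>
      obtain ⟨m, hm, hm'⟩ := hx
      refine ⟨m * q.den, Nat.mul_pos hm q.den_pos, ?_⟩
      have h1 : (m * q.den) • q • x = q.num • (m • x) := by
        rw [← Nat.cast_smul_eq_nsmul ℚ, smul_smul, ← Int.cast_smul_eq_zsmul ℚ, ← Nat.cast_smul_eq_nsmul ℚ,
          smul_smul]
        congr 1
        push_cast
        rw [mul_assoc, Rat.den_mul_eq_num]
        ring
      rw [h1]
      exact zsmul_mem hm' _
  have he : ∀ i, ∃ m : ℕ, 0 < m ∧ m • e i ∈ I := fun i => h _ (by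
    rw [hI.span_eq]; exact Algebra.subset_adjoin ⟨i, rfl⟩)
  choose m hm hm' using he
  refine ⟨∏ i, m i, Finset.prod_pos fun i _ => hm i, fun i => ?_⟩
  rw [← Finset.prod_erase_mul _ _ (Finset.mem_univ i), mul_smul]
  exact nsmul_mem (hm' i) _

/-! ### The level -/

/-- The bound `N₀(I) ≤ N` forces `N ≥ 3`, because `-1` is congruent to `1` modulo `1` and `2`. -/
theorem three_le_of_N0_le (hI : IsInvolutiveOrder I) {N : ℕ} (hN : N0 I ≤ N) : 3 ≤ N := by
  obtain ⟨δ, hδ, h⟩ := exists_le_norm hI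
  -- the set defining `N₀` is not empty: non-zero elements of `N I` are long when `N` is large
  have hne : ({m | 0 < m ∧ ∀ N, m ≤ N → (-1 : Mat n) ∉ GamN I N ∧
      ∀ A : Finset (Fin n), A.Nonempty → lastIdx n ∉ A →
        !![reverse (eA A), 0; 0, Ring.inverse (eA A)] ∉ GamN I N} : Set ℕ).Nonempty := by
    obtain ⟨m, hm⟩ := exists_nat_gt (2 / δ)
    have hm0 : (0 : ℝ) < m := lt_trans (by positivity) hm
    have key : ∀ N, m ≤ N → ∀ a : Cl n, a - 1 ≠ 0 → ‖a‖ ≤ 1 → ¬ ∃ q ∈ I, a - 1 = N • q := by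
      rintro N hmN a ha ha1 ⟨q, hq, hq'⟩
      have hq0 : q ≠ 0 := by rintro rfl; simp [hq'] at ha
      have h1 : ‖a - 1‖ ≤ 2 := (norm_sub_le _ _).trans (by rw [norm_one']; linarith)
      rw [hq', ← Nat.cast_smul_eq_nsmul ℝ, norm_smul, Real.norm_natCast] at h1
      have h2 := h q hq hq0
      have h3 : (m : ℝ) ≤ N := by exact_mod_cast hmN
      rw [div_lt_iff₀ hδ] at hm
      have h4 : (m : ℝ) * δ ≤ N * ‖q‖ := by gcongr
      linarith
    refine ⟨m, by exact_mod_cast hm0, fun N hmN => ⟨fun hmem => ?_, fun A hA _ hmem => ?_⟩⟩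
    · refine key N hmN (-1) ?_ (by simp) (by simpa using hmem.2 0 0)
      intro h0
      have := congrArg sc h0
      rw [map_sub, map_neg, sc_one, map_zero] at this
      norm_num at this
    · refine key N hmN (reverse (eA A)) ?_ (by rw [norm_reverse, norm_eA]) (by simpa using hmem.2 0 0)
      intro h0
      have := congrArg sc h0
      rw [map_sub, sc_reverse, sc_eA hA, sc_one, map_zero] at this
      norm_num at this
  have hmem := Nat.sInf_mem hne
  have hpos : 0 < N := hmem.1.trans_le hN
  have hneg : (-1 : Mat n) ∉ GamN I N := (hmem.2 N hN).1
  by_contra hlt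
  refine hneg ⟨neg_one_mem_Gam hI, fun i j => ?_⟩
  have h12 : N = 1 ∨ N = 2 := by omega
  have hent : ((-1 : Mat n) - 1) i j = 2 • (-(1 : Mat n) i j) := by
    rw [Matrix.sub_apply, Matrix.neg_apply, two_smul, sub_eq_add_neg]
  have hI1 : -(1 : Mat n) i j ∈ I := by
    rw [Matrix.one_apply]
    split_ifs
    · exact neg_mem (one_mem _)
    · simp
  rcases h12 with rfl | rfl
  · exact ⟨_, nsmul_mem hI1 2, by rw [hent, one_smul]⟩
  · exact ⟨_, hI1, hent⟩

/-- A normal element with a vanishing power is zero. -/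
theorem eq_zero_of_pow_eq_zero {n : ℕ} {q : Cl n} (hq : q * star q = star q * q) {m : ℕ} (h : q ^ m = 0) :
    q = 0 := by
  have hn : ∀ y, ‖star q * y‖ = ‖q * y‖ := fun y => by
    refine (sq_eq_sq₀ (norm_nonneg _) (norm_nonneg _)).1 ?_
    rw [← real_inner_self_eq_norm_sq, ← real_inner_self_eq_norm_sq, inner_mul_left, inner_mul_left, star_star,
      ← mul_assoc, ← mul_assoc, hq]
  have h2 : ∀ y, q * (q * y) = 0 → q * y = 0 := fun y hy => by
    have h3 := hn (q * y)
    rw [hy, norm_zero, norm_eq_zero] at h3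
    rw [← inner_self_eq_zero (𝕜 := ℝ), inner_mul_left, h3, inner_zero_right]
  have h4 : ∀ m : ℕ, q ^ (m + 1) = 0 → q = 0 := by
    intro m
    induction m with
    | zero => simp
    | succ m ih =>
      intro hm
      refine ih ?_
      rw [pow_succ', pow_succ'] at hm
      rw [pow_succ']
      exact h2 _ hm
  cases m with
  | zero =>
    have := congrArg sc h
    simp at this
  | succ m => exact h4 m h

/-- An element of norm one in an order is trivial if it is congruent to `1` modulo `N ≥ 3`: the powers
of `(d - 1) / N` tend to zero in a discrete set, and `d` is normal. -/
theorem eq_one_of_congruent {n : ℕ} {I : Subring (Cl n)} (hI : IsInvolutiveOrder I) {N : ℕ} (hN : 3 ≤ N)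
    {d q : Cl n} (hd : d ∈ pvProd n) (hd1 : ‖d‖ = 1) (hq : q ∈ I) (h : d - 1 = N • q) : d = 1 := by
  obtain ⟨δ, hδ, hI'⟩ := exists_le_norm hI
  have hN' : (3 : ℝ) ≤ N := by exact_mod_cast hN
  have h' : d - 1 = (N : ℝ) • q := by rw [h, Nat.cast_smul_eq_nsmul]
  have hqd : q = (N : ℝ)⁻¹ • (d - 1) := by
    rw [h', smul_smul, inv_mul_cancel₀ (by positivity), one_smul]
  have hnorm : ∀ y, ‖q * y‖ ≤ 2 / 3 * ‖y‖ := fun y => by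
    rw [hqd, smul_mul_assoc, norm_smul, norm_inv, Real.norm_natCast, sub_mul, one_mul]
    have h1 : ‖d * y - y‖ ≤ 2 * ‖y‖ := by
      refine (norm_sub_le _ _).trans ?_
      rw [norm_mul_left hd, hd1]; linarith
    calc (N : ℝ)⁻¹ * ‖d * y - y‖ ≤ 3⁻¹ * (2 * ‖y‖) := by gcongr
      _ = _ := by ring
  have hpow : ∀ m : ℕ, ‖q ^ m‖ ≤ (2 / 3) ^ m := by
    intro m
    induction m with
    | zero => simp
    | succ m ih =>
      rw [pow_succ']
      refine (hnorm _).trans ?_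
      rw [pow_succ']
      gcongr
  obtain ⟨m, hm⟩ := exists_pow_lt_of_lt_one hδ (by norm_num : (2 / 3 : ℝ) < 1)
  have hqm : q ^ m = 0 := by
    by_contra h0
    linarith [hI' _ (pow_mem hq m) h0, hpow m]
  have hnormal : q * star q = star q * q := by
    have h1 : d * star d = star d * d := by
      rw [mul_star_self_of_mem_pvProd hd, star_mul_self_of_mem_pvProd hd]
    have e1 : (d - 1) * (star d - 1) = d * star d - d - star d + 1 := by noncomm_ring
    have e2 : (star d - 1) * (d - 1) = star d * d - d - star d + 1 := by noncomm_ring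
    rw [hqd, CliffordAlgebra.star_smul, smul_mul_smul_comm, smul_mul_smul_comm, star_sub, star_one, e1, e2,
      h1]
  rw [eq_zero_of_pow_eq_zero hnormal hqm, smul_zero, sub_eq_zero] at h
  exact h

/-- For `N ≥ 3` the elements of `Γ[N]` with `c = 0` are translations. -/
theorem eq_transl_of_mem_GamN (hI : IsInvolutiveOrder I) {N : ℕ} (hN : 3 ≤ N) {M : Mat n}
    (hM : M ∈ GamN I N) (hc : M 1 0 = 0) : M = transl (M 0 1) := by
  obtain ⟨δ, hδ, hI'⟩ := exists_le_norm hI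
  have h := GamN.sav hM
  have hm : ∀ i j, M i j ∈ pvProd n := fun i j => mem_pvProd_of_mem_lowProd (h.mem i j)
  have hdet := h.det
  rw [hc, map_zero, mul_zero, sub_zero] at hdet
  have hnorm : ‖M 0 0‖ * ‖M 1 1‖ = 1 := by
    rw [← norm_reverse (M 1 1), ← norm_mul_left (hm 0 0), hdet, norm_one']
  -- powers of a shorter entry would tend to zero in the discrete order
  have h1 : ∀ i j, M i j ≠ 0 → 1 ≤ ‖M i j‖ := by
    intro i j h0
    by_contra! hlt
    have hp : ∀ m : ℕ, ‖M i j ^ m‖ = ‖M i j‖ ^ m := fun m => by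
      induction m with
      | zero => simp
      | succ m ih => rw [pow_succ', norm_mul_left (hm i j), ih, pow_succ']
    obtain ⟨m, hm'⟩ := exists_pow_lt_of_lt_one hδ hlt
    have h2 : M i j ^ m ≠ 0 := by
      rw [← norm_ne_zero_iff, hp]; exact pow_ne_zero _ (norm_ne_zero_iff.2 h0)
    linarith [hI' _ (pow_mem (hM.1.2.2 i j) m) h2, hp m]
  have ha0 : M 0 0 ≠ 0 := by intro h0; simp [h0] at hnorm
  have hd0 : M 1 1 ≠ 0 := by intro h0; simp [h0] at hnorm
  have ha1 : ‖M 0 0‖ = 1 := by nlinarith [h1 0 0 ha0, h1 1 1 hd0]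
  have hd1 : ‖M 1 1‖ = 1 := by nlinarith [h1 0 0 ha0, h1 1 1 hd0]
  obtain ⟨p, hp, hp'⟩ := hM.2 0 0
  obtain ⟨q, hq, hq'⟩ := hM.2 1 1
  have hd : M 1 1 = 1 := eq_one_of_congruent hI hN (hm 1 1) hd1 hq (by simpa using hq')
  have ha : M 0 0 = 1 := eq_one_of_congruent hI hN (hm 0 0) ha1 hp (by simpa using hp')
  ext i j
  fin_cases i <;> fin_cases j <;> simp [transl, hd, ha, hc]

end

/-! ### Lattice sums -/

/-- Summation along a map with fibres of bounded cardinality. -/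
theorem summable_comp_of_card_fiber_le {α β : Type*} {f : α → β} {g : β → ℝ} {K : ℕ}
    (hg : Summable g) (hg0 : ∀ b, 0 ≤ g b)
    (hK : ∀ (s : Finset α) (b : β), (∀ a ∈ s, f a = b) → s.card ≤ K) :
    Summable (fun a => g (f a)) ∧ ∑' a, g (f a) ≤ K * ∑' b, g b := by
  classical
  have key : ∀ s : Finset α, ∑ a ∈ s, g (f a) ≤ K * ∑' b, g b := by
    intro s
    rw [Finset.sum_comp g f]
    calc ∑ b ∈ s.image f, (s.filter fun a => f a = b).card • g b
        ≤ ∑ b ∈ s.image f, K * g b := by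
          refine Finset.sum_le_sum fun b _ => ?_
          rw [nsmul_eq_mul]
          refine mul_le_mul_of_nonneg_right ?_ (hg0 b)
          exact_mod_cast hK _ b fun a ha => (Finset.mem_filter.1 ha).2
      _ = K * ∑ b ∈ s.image f, g b := by rw [Finset.mul_sum]
      _ ≤ K * ∑' b, g b := by
          gcongr
          exact hg.sum_le_tsum _ fun b _ => hg0 b
  have hs := summable_of_sum_le (fun a => hg0 (f a)) key
  exact ⟨hs, hs.tsum_le_of_sum_le key⟩

theorem summable_one_add_norm_pow {n α : ℕ} (hα : n < α) :
    Summable fun z : Fin n → ℤ => ((1 + ‖z‖) ^ α)⁻¹ := by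
  let L : Submodule ℤ (Fin n → ℝ) := Submodule.span ℤ (Set.range (Pi.basisFun ℝ (Fin n)))
  have hrank : Module.finrank ℤ L = n := by
    rw [ZLattice.rank ℝ L]; simp
  have hs := ZLattice.summable_norm_pow_inv L α (by rw [hrank]; exact hα)
  have hmem : ∀ z : Fin n → ℤ, (fun i => (z i : ℝ)) ∈ L := by
    intro z
    have : (fun i => (z i : ℝ)) = ∑ i, z i • Pi.basisFun ℝ (Fin n) i := by
      ext j
      simp [Finset.sum_apply, Pi.single_apply]
    rw [this]
    exact sum_mem fun i _ => Submodule.smul_mem _ _ (Submodule.subset_span ⟨i, rfl⟩)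
  have hinj : Function.Injective (fun z : Fin n → ℤ => (⟨_, hmem z⟩ : L)) := by
    intro z z' h
    ext i
    have h1 : (z i : ℝ) = z' i := congrFun (congrArg Subtype.val h) i
    exact_mod_cast h1
  have hnorm : ∀ z : Fin n → ℤ, ‖(⟨_, hmem z⟩ : L)‖ = ‖z‖ := by
    intro z
    rw [Submodule.coe_norm, Pi.norm_def, Pi.norm_def]
    congr 1
  have h1 := hs.comp_injective hinj
  have h2 : Summable (fun z : Fin n → ℤ => if z = 0 then (1 : ℝ) else 0) :=
    (hasSum_ite_eq 0 1).summable
  refine Summable.of_nonneg_of_le (fun z => by positivity) (fun z => ?_) (h1.add h2)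
  simp only [Function.comp, hnorm]
  rcases eq_or_ne z 0 with rfl | hz
  · have : α ≠ 0 := by omega
    simp [this]
  · have hz' : 0 < ‖z‖ := norm_pos_iff.2 hz
    rw [if_neg hz, add_zero, inv_pow]
    gcongr
    linarith

/-- The sum over `ℤⁿ` at scale `Q` grows at most like `Qⁿ`. -/
theorem summable_one_add_norm_div_pow {n α : ℕ} (hα : n < α) {Q : ℕ} (hQ : 0 < Q) :
    Summable (fun z : Fin n → ℤ => ((1 + ‖z‖ / Q) ^ α)⁻¹) ∧
      ∑' z : Fin n → ℤ, ((1 + ‖z‖ / Q) ^ α)⁻¹ ≤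
        Q ^ n * (2 ^ α * ∑' z : Fin n → ℤ, ((1 + ‖z‖) ^ α)⁻¹) := by
  have hQ' : (0 : ℝ) < Q := by exact_mod_cast hQ
  have hQz : (0 : ℤ) < Q := by exact_mod_cast hQ
  have hs := summable_one_add_norm_pow hα
  have h := summable_comp_of_card_fiber_le (f := fun (z : Fin n → ℤ) i => z i / (Q : ℤ))
    (g := fun z => 2 ^ α * ((1 + ‖z‖) ^ α)⁻¹) (K := Q ^ n) (hs.mul_left _) (fun z => by positivity) (by
      intro s b hb
      have : s ⊆ Fintype.piFinset fun i => Finset.Ico (b i * Q) (b i * Q + Q) := by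
        intro z hz
        rw [Fintype.mem_piFinset]
        intro i
        have : z i / (Q : ℤ) = b i := congrFun (hb z hz) i
        rw [Finset.mem_Ico, ← this]
        have h1 := Int.mul_ediv_self_le (x := z i) hQz.ne'
        have h2 := Int.lt_mul_ediv_self_add (x := z i) hQz
        constructor <;> linarith
      refine (Finset.card_le_card this).trans ?_
      simp [Fintype.card_piFinset])
  have hle : ∀ z : Fin n → ℤ, ((1 + ‖z‖ / Q) ^ α)⁻¹ ≤
      2 ^ α * ((1 + ‖fun i => z i / (Q : ℤ)‖) ^ α)⁻¹ := by
    intro z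
    have h1 : ‖fun i => z i / (Q : ℤ)‖ ≤ ‖z‖ / Q + 1 := by
      refine (pi_norm_le_iff_of_nonneg (by positivity)).2 fun i => ?_
      have h2 : ‖z i‖ ≤ ‖z‖ := norm_le_pi_norm z i
      rw [Int.norm_eq_abs] at *
      have h3 : (z i / (Q : ℤ)) * Q ≤ z i := Int.ediv_mul_le _ hQz.ne'
      have h4 : z i < (z i / (Q : ℤ) + 1) * Q := Int.lt_ediv_add_one_mul_self _ hQz
      have h3' : ((z i / (Q : ℤ) : ℤ) : ℝ) * Q ≤ z i := by exact_mod_cast h3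
      have h4' : (z i : ℝ) < (((z i / (Q : ℤ) : ℤ) : ℝ) + 1) * Q := by exact_mod_cast h4
      obtain ⟨h5, h6⟩ := abs_le.1 h2
      rw [div_add_one hQ'.ne', le_div_iff₀ hQ', ← abs_of_pos hQ', ← abs_mul, abs_of_pos hQ', abs_le]
      constructor <;> nlinarith
    have h2 : 1 + ‖fun i => z i / (Q : ℤ)‖ ≤ 2 * (1 + ‖z‖ / Q) := by
      have : 0 ≤ ‖z‖ / Q := by positivity
      linarith
    have h3 : (1 + ‖fun i => z i / (Q : ℤ)‖) ^ α ≤ 2 ^ α * (1 + ‖z‖ / Q) ^ α := by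
      rw [← mul_pow]; gcongr
    rw [inv_le_iff_one_le_mul₀ (by positivity), mul_right_comm, ← div_eq_mul_inv, one_le_div (by positivity)]
    exact h3
  have hsum := Summable.of_nonneg_of_le (fun z => by positivity) hle h.1
  refine ⟨hsum, (hsum.tsum_le_tsum hle h.1).trans (h.2.trans ?_)⟩
  rw [tsum_mul_left]
  push_cast
  exact le_rfl

/-- The sum over Whitney cubes that dominates the Poincaré series. -/
theorem summable_whitney {n α : ℕ} (hα : 2 * n < α) :
    Summable fun p : ℕ × (Fin n → ℤ) => ((2 ^ p.1 * (1 + ‖p.2‖ / 4 ^ p.1)) ^ α)⁻¹ := by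
  have hα' : n < α := by omega
  have h : ∀ m : ℕ, _ := fun m => summable_one_add_norm_div_pow hα' (Q := 4 ^ m) (by positivity)
  push_cast at h
  set C := 2 ^ α * ∑' z : Fin n → ℤ, ((1 + ‖z‖) ^ α)⁻¹
  have hC : 0 ≤ C := by positivity
  rw [summable_prod_of_nonneg (fun p => by positivity)]
  simp only [mul_pow, mul_inv]
  refine ⟨fun m => (h m).1.mul_left _, ?_⟩
  simp only [tsum_mul_left]
  refine Summable.of_nonneg_of_le (fun m => by positivity) (fun m => ?_)
    ((summable_geometric_of_lt_one (by norm_num) (by norm_num : (1 / 2 : ℝ) < 1)).mul_right C)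
  calc (((2 : ℝ) ^ m) ^ α)⁻¹ * ∑' z : Fin n → ℤ, ((1 + ‖z‖ / 4 ^ m) ^ α)⁻¹
      ≤ (((2 : ℝ) ^ m) ^ α)⁻¹ * ((4 ^ m) ^ n * C) := by gcongr; exact (h m).2
    _ = ((((2 : ℝ) ^ m) ^ α)⁻¹ * (4 ^ m) ^ n) * C := by ring
    _ ≤ (1 / 2) ^ m * C := by
      gcongr
      rw [inv_mul_le_iff₀ (by positivity), one_div, inv_pow, ← div_eq_mul_inv, le_div_iff₀ (by positivity)]
      have : (4 : ℝ) = 2 ^ 2 := by norm_num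
      rw [this, ← pow_mul, ← pow_mul, ← pow_mul, ← pow_add]
      refine pow_le_pow_right₀ (by norm_num) ?_
      nlinarith

theorem finite_matrices_norm_le {n : ℕ} {I : Subring (Cl n)} (hI : IsInvolutiveOrder I) (R : ℝ) :
    {M : Mat n | ∀ i j, M i j ∈ I ∧ ‖M i j‖ ≤ R}.Finite := by
  have h := Set.Finite.pi' (fun _ : Fin 2 => Set.Finite.pi' fun _ : Fin 2 => finite_norm_le hI R)
  exact h

section
variable {n : ℕ} [NeZero n]

/-! ### Horizontal coordinates -/

/-- The `n` horizontal coordinates `x_0, x_1, …, x_{n-1}` of a paravector, as a linear map; the index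
of `e_n` is used for `x_0`. -/
def hor (i : Fin n) : Cl n →ₗ[ℝ] ℝ := if i = lastIdx n then coeffLin ∅ else coeffLin {i}

theorem abs_hor_le_norm (i : Fin n) (x : Cl n) : |hor i x| ≤ ‖x‖ := by
  rw [hor]; split_ifs <;> exact abs_coeff_le_norm _ _

theorem hor_en (i : Fin n) : hor i (en n) = 0 := by
  rw [hor, en, ← eA_singleton]
  split_ifs with h
  · rw [coeffLin_apply, coeff_eA, if_neg (Finset.singleton_ne_empty _).symm]
  · rw [coeffLin_apply, coeff_eA, if_neg (by simpa using h)]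

theorem norm_le_of_coordinates {x : Cl n} (hx : x ∈ paravec n) {B : ℝ} (h : ∀ i, |hor i x| ≤ B)
    (hn : |xn x| ≤ B) : ‖x‖ ≤ (n + 1) * B := by
  have h0 : |coeff ∅ x| ≤ B := by simpa [hor] using h (lastIdx n)
  have h1 : ∀ i, |coeff {i} x| ≤ B := by
    intro i
    rcases eq_or_ne i (lastIdx n) with rfl | hi
    · exact hn
    · simpa [hor, hi] using h i
  rw [paravec_eq_sum hx]
  refine (norm_add_le _ _).trans ?_
  have h2 : ‖∑ i, coeff {i} x • e i‖ ≤ n * B := by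
    refine (norm_sum_le _ _).trans ?_
    refine (Finset.sum_le_sum (g := fun _ => B) fun i _ => ?_).trans (by simp)
    rw [norm_smul, norm_e, mul_one]; exact h1 i
  rw [norm_smul, norm_one', mul_one]
  have : ‖coeff ∅ x‖ ≤ B := h0
  linarith

/-- The cube of side `t` that contains the horizontal part of `x`. -/
def cube (t : ℝ) (x : Cl n) : Fin n → ℤ := fun i => ⌊hor i x / t⌋

theorem mul_norm_cube_le {t R : ℝ} (ht : 0 < t) {x : Cl n} (hR : 0 ≤ R) (h : ∀ i, |hor i x| ≤ R) :
    t * ‖cube t x‖ ≤ R + t := by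
  rw [← le_div_iff₀' ht]
  refine (pi_norm_le_iff_of_nonneg (by positivity)).2 fun i => ?_
  rw [cube, Int.norm_eq_abs, add_div, div_self ht.ne']
  have h1 : |hor i x / t| ≤ R / t := by rw [abs_div, abs_of_pos ht]; gcongr; exact h i
  have h2 := Int.floor_le (hor i x / t)
  have h3 := Int.lt_floor_add_one (hor i x / t)
  rw [abs_le] at *
  constructor <;> linarith

theorem abs_hor_sub_lt {t : ℝ} (ht : 0 < t) {x y : Cl n} (h : cube t x = cube t y) (i : Fin n) :
    |hor i (x - y)| < t := by
  have h1 := Int.abs_sub_lt_one_of_floor_eq_floor (congrFun h i)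
  rwa [← sub_div, abs_div, abs_of_pos ht, div_lt_one ht, ← map_sub] at h1

/-! ### Absolute convergence -/

/-- The denominators `c e_n + d` are bounded away from zero on `Γ`. -/
theorem Gam.exists_le_norm_den {I : Subring (Cl n)} (hI : IsInvolutiveOrder I) :
    ∃ δ : ℝ, 0 < δ ∧ ∀ M ∈ Gam I, δ ≤ ‖den M (en n)‖ := by
  obtain ⟨δ, hδ, h⟩ := exists_le_norm hI
  refine ⟨δ, hδ, fun M hM => (le_abs_self _).trans (abs_le_of_sq_le_sq ?_ (norm_nonneg _))⟩
  have h1 := norm_den_axis_sq (Gam.sav hM) 1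
  rw [one_smul, one_pow, one_mul] at h1
  rw [h1]
  have h2 := den_ne_zero (Gam.sav hM) en_mem_upperHalf
  have h3 : M 1 0 ≠ 0 ∨ M 1 1 ≠ 0 := by
    by_contra! hc
    exact h2 (by rw [den, hc.1, hc.2]; simp)
  rcases h3 with h3 | h3
  · have := h _ (hM.2.2 1 0) h3
    nlinarith [sq_nonneg ‖M 1 1‖]
  · have := h _ (hM.2.2 1 1) h3
    nlinarith [sq_nonneg ‖M 1 0‖]

/-- The size of `G` in terms of the hyperbolic displacement of `e_n`, measured between the images under
`M` of `e_n` and `G⟨e_n⟩`. -/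
theorem norm_entry_sq_le_displacement {M G : Mat n} (hM : SAV M) (hG : SAV G) (i j : Fin 2) :
    ‖G i j‖ ^ 2 ≤ (‖mob M (en n) - mob (M * G) (en n)‖ * ‖den M (en n)‖ * ‖den (M * G) (en n)‖) ^ 2 + 2 := by
  -- `V_G(e_n, -e_n) = (G⟨e_n⟩ - e_n)(c e_n + d)`
  have h1 := norm_vVal_axis_sq hG 1 (-1)
  simp only [one_smul, neg_smul] at h1
  rw [norm_vVal hG en_mem_upperHalf] at h1
  have h2 := norm_mob_sub_mob hM en_mem_upperHalf (mob_mem_upperHalf hG en_mem_upperHalf)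
  have h3 : ‖mob M (en n) - mob (M * G) (en n)‖ * ‖den M (en n)‖ * ‖den (M * G) (en n)‖
      = ‖-en n + mob G (en n)‖ * ‖den G (en n)‖ := by
    rw [mob_mul hM hG en_mem_upperHalf, den_mul hG en_mem_upperHalf,
      norm_mul_right (den_mem_pvProd hG en_mem_paravec), ← mul_assoc, h2, neg_add_eq_sub, norm_sub_rev]
  rw [h3, h1]
  have := sq_nonneg ‖G 0 0‖; have := sq_nonneg ‖G 0 1‖
  have := sq_nonneg ‖G 1 0‖; have := sq_nonneg ‖G 1 1‖
  fin_cases i <;> fin_cases j <;> simp only [Fin.zero_eta, Fin.mk_one] <;> linarith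

/-- Absolute convergence at `x = w = e_n` for the full arithmetic group: the points `M⟨e_n⟩` are spread
over Whitney cubes of the half-space, with a bounded number of matrices for each cube. -/
theorem summable_Gam_en {I : Subring (Cl n)} (hI : IsInvolutiveOrder I) {α : ℕ} (hα : 2 * n < α) :
    Summable fun M : Gam I => (‖vVal (M : Mat n) (en n) (en n)‖ ^ α)⁻¹ := by
  obtain ⟨δ, hδ, hden⟩ := Gam.exists_le_norm_den hI
  have hlev : ∀ M : Gam I, ∃ m : ℕ, 2 ^ m ≤ ‖den (M : Mat n) (en n)‖ / δ ∧
      ‖den (M : Mat n) (en n)‖ / δ < 2 ^ (m + 1) := fun M =>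
    exists_nat_pow_near ((one_le_div hδ).2 (hden M M.2)) one_lt_two
  choose m hm1 hm2 using hlev
  -- `M⟨e_n⟩` has height comparable to `4⁻ᵐ`, and the cubes at this level have side `4⁻ᵐ`
  let f : Gam I → ℕ × (Fin n → ℤ) := fun M => (m M, cube ((4 ^ m M)⁻¹ : ℝ) (mob (M : Mat n) (en n)))
  set B : ℝ := 4 * ((n + 1) * (1 + δ ^ 2)) with hB
  have hB0 : 0 ≤ B := by positivity
  have hfin := finite_matrices_norm_le hI (B + 2)
  have hfib := summable_comp_of_card_fiber_le (f := f) (K := hfin.toFinset.card)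
    ((summable_whitney hα).mul_left ((3 / δ) ^ α)) (fun p => by positivity) (by
      intro s b hb
      rcases s.eq_empty_or_nonempty with rfl | ⟨M₀, hM₀⟩
      · simp
      -- quotients of two matrices in the same fibre have bounded entries
      refine Finset.card_le_card_of_injOn (fun M => adj (M₀ : Mat n) * (M : Mat n)) ?_ ?_
      · intro M hM
        have hM0 := Gam.sav M₀.2
        have hG := mul_mem_Gam hI (adj_mem_Gam hI M₀.2) M.2
        have hMG : (M₀ : Mat n) * (adj (M₀ : Mat n) * (M : Mat n)) = M := by
          rw [← mul_assoc, hM0.mul_adj, one_mul]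
        simp only [Set.Finite.coe_toFinset, Set.mem_ofPred_eq]
        intro i j
        refine ⟨hG.2.2 i j, ?_⟩
        have h1 := norm_entry_sq_le_displacement hM0 (Gam.sav hG) i j
        rw [hMG] at h1
        have hfM : f M = f M₀ := by rw [hb M hM, hb M₀ hM₀]
        have hmM : m M = m M₀ := congrArg Prod.fst hfM
        have hcM : cube ((4 ^ m M₀)⁻¹ : ℝ) (mob (M₀ : Mat n) (en n))
            = cube ((4 ^ m M₀)⁻¹ : ℝ) (mob (M : Mat n) (en n)) := by
          have := congrArg Prod.snd hfM
          simp only [f, hmM] at this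
          exact this.symm
        set q : ℝ := (4 ^ m M₀)⁻¹ with hq
        have hq0 : 0 < q := by positivity
        have hq4 : q * (2 ^ m M₀ * 2 ^ m M₀) = 1 := by
          rw [hq, ← mul_pow]; norm_num
        have hxn : ∀ M : Gam I, m M = m M₀ → 0 < xn (mob (M : Mat n) (en n)) ∧
            xn (mob (M : Mat n) (en n)) ≤ q * (1 / δ ^ 2) := by
          intro M hmM
          refine ⟨(mob_mem_upperHalf (Gam.sav M.2) en_mem_upperHalf).2, ?_⟩
          have h2 := hm1 M
          rw [hmM, le_div_iff₀ hδ] at h2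
          rw [xn_mob (Gam.sav M.2) en_mem_paravec, xn_en, div_le_iff₀ (pow_pos (norm_den_pos (Gam.sav M.2)
            en_mem_upperHalf) 2)]
          calc (1 : ℝ) = q * (1 / δ ^ 2) * (2 ^ m M₀ * δ) ^ 2 := by
                field_simp; linear_combination -hq4
            _ ≤ _ := by gcongr
        have hdist : ‖mob (M₀ : Mat n) (en n) - mob (M : Mat n) (en n)‖ ≤ (n + 1) * (q * (1 + 1 / δ ^ 2)) := by
          refine norm_le_of_coordinates (sub_mem (mob_mem_paravec hM0 en_mem_paravec)
            (mob_mem_paravec (Gam.sav M.2) en_mem_paravec)) (fun i => ?_) ?_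
          · refine (abs_hor_sub_lt hq0 hcM i).le.trans ?_
            have : 0 ≤ 1 / δ ^ 2 := by positivity
            nlinarith
          · obtain ⟨h3, h4⟩ := hxn M hmM
            obtain ⟨h5, h6⟩ := hxn M₀ rfl
            rw [xn_sub, abs_le]
            constructor <;> nlinarith
        have hd : ∀ M : Gam I, m M = m M₀ → ‖den (M : Mat n) (en n)‖ ≤ 2 * 2 ^ m M₀ * δ := by
          intro M hmM
          have h2 := (hm2 M).le
          rw [hmM, div_le_iff₀ hδ, pow_succ'] at h2
          exact h2
        have hprod : ‖mob (M₀ : Mat n) (en n) - mob (M : Mat n) (en n)‖ * ‖den (M₀ : Mat n) (en n)‖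
            * ‖den (M : Mat n) (en n)‖ ≤ B := by
          calc _ ≤ ((n + 1) * (q * (1 + 1 / δ ^ 2))) * (2 * 2 ^ m M₀ * δ) * (2 * 2 ^ m M₀ * δ) := by
                gcongr
                · exact hd M₀ rfl
                · exact hd M hmM
            _ = (4 * ((n + 1) * (1 + δ ^ 2))) * (q * (2 ^ m M₀ * 2 ^ m M₀)) := by field_simp; ring
            _ = B := by rw [hq4, mul_one]
        refine (le_abs_self _).trans (abs_le_of_sq_le_sq (h1.trans ?_) (by positivity))
        have h9 : (‖mob (M₀ : Mat n) (en n) - mob (M : Mat n) (en n)‖ * ‖den (M₀ : Mat n) (en n)‖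
            * ‖den (M : Mat n) (en n)‖) ^ 2 ≤ B ^ 2 := by gcongr
        nlinarith
      · intro M _ M' _ h
        have h1 := congrArg (fun X => (M₀ : Mat n) * X) h
        simp only [← mul_assoc, (Gam.sav M₀.2).mul_adj, one_mul] at h1
        exact Subtype.ext h1)
  refine Summable.of_nonneg_of_le (fun M => by positivity) (fun M => ?_) hfib.1
  have hS := Gam.sav M.2
  have hU := mob_mem_upperHalf hS en_mem_upperHalf
  set y := mob (M : Mat n) (en n) with hy
  have h1 : (1 : ℝ) ≤ ‖en n + y‖ := by
    refine le_trans ?_ xn_le_norm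
    rw [xn_add, xn_en]; linarith [hU.2]
  have hq1 : ((4 ^ m M)⁻¹ : ℝ) ≤ 1 := inv_le_one_of_one_le₀ (one_le_pow₀ (by norm_num))
  have h2 := mul_norm_cube_le (t := (4 ^ m M)⁻¹) (x := y) (by positivity) (norm_nonneg (en n + y)) (fun i => by
    have := abs_hor_le_norm i (en n + y)
    rwa [map_add, hor_en, zero_add] at this)
  have h3 : 1 + ‖cube ((4 ^ m M)⁻¹ : ℝ) y‖ / 4 ^ m M ≤ 3 * ‖en n + y‖ := by
    rw [div_eq_inv_mul]; linarith
  have h4 := hm1 M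
  rw [le_div_iff₀ hδ] at h4
  have h5 : 2 ^ m M * (1 + ‖cube ((4 ^ m M)⁻¹ : ℝ) y‖ / 4 ^ m M) ≤
      (3 / δ) * ‖vVal (M : Mat n) (en n) (en n)‖ := by
    rw [norm_vVal hS en_mem_upperHalf, ← hy, div_mul_eq_mul_div, le_div_iff₀ hδ]
    calc 2 ^ m M * (1 + ‖cube ((4 ^ m M)⁻¹ : ℝ) y‖ / 4 ^ m M) * δ
        = (1 + ‖cube ((4 ^ m M)⁻¹ : ℝ) y‖ / 4 ^ m M) * (2 ^ m M * δ) := by ring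
      _ ≤ (3 * ‖en n + y‖) * ‖den (M : Mat n) (en n)‖ := by gcongr
      _ = _ := by ring
  have h6 : 0 < ‖vVal (M : Mat n) (en n) (en n)‖ :=
    norm_pos_iff.2 (vVal_ne_zero hS en_mem_upperHalf en_mem_upperHalf)
  change _ ≤ (3 / δ) ^ α * ((2 ^ m M * (1 + ‖cube ((4 ^ m M)⁻¹ : ℝ) y‖ / 4 ^ m M)) ^ α)⁻¹
  rw [inv_le_iff_one_le_mul₀ (by positivity), mul_right_comm, ← div_eq_mul_inv, one_le_div (by positivity),
    ← mul_pow]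
  gcongr

/-- Convergence at `e_n` implies convergence at all points of the half-space. -/
theorem summable_of_summable_en {S : Set (Mat n)} (hS : ∀ M ∈ S, SAV M) {α : ℕ}
    (h : Summable fun M : S => (‖vVal (M : Mat n) (en n) (en n)‖ ^ α)⁻¹) {x w : Cl n}
    (hx : x ∈ upperHalf n) (hw : w ∈ upperHalf n) :
    Summable fun M : S => (‖vVal (M : Mat n) x w‖ ^ α)⁻¹ := by
  set C := (1 + 2 * (‖x - en n‖ / xn x)) * (1 + ‖w - en n‖ / xn w) with hC
  have hx2 := hx.2
  have hw2 := hw.2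
  have hC0 : 0 < C := by positivity
  refine Summable.of_nonneg_of_le (fun M => by positivity) (fun M => ?_) (h.mul_left (C ^ α))
  have h1 := norm_vVal_en_le (hS M M.2) hx hw
  have h2 : 0 < ‖vVal (M : Mat n) x w‖ := norm_pos_iff.2 (vVal_ne_zero (hS M M.2) hx hw)
  have h3 : 0 < ‖vVal (M : Mat n) (en n) (en n)‖ :=
    norm_pos_iff.2 (vVal_ne_zero (hS M M.2) en_mem_upperHalf en_mem_upperHalf)
  rw [inv_le_iff_one_le_mul₀ (by positivity), mul_right_comm, ← div_eq_mul_inv, one_le_div (by positivity),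
    ← mul_pow]
  gcongr

end

/-! ### Translations -/

theorem transl_mul_one_apply {n : ℕ} (M : Mat n) (b : Cl n) (j : Fin 2) : (transl b * M) 1 j = M 1 j := by
  simp [transl, Matrix.mul_apply, Fin.sum_univ_two]

section
variable {n : ℕ} [NeZero n]

theorem mob_transl_mul {M : Mat n} {b : Cl n} (hb : b ∈ lowParavec n) (hM : SAV M) {x : Cl n}
    (hx : x ∈ upperHalf n) : mob (transl b * M) x = mob M x + b := by
  rw [mob_mul (SAV.transl hb) hM hx]
  simp [mob, transl]

/-- The horizontal unit vector with `hor j (horVec i) = δ_{ij}`: `e_i` for `i ≠ n`, and `1` for the index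
of `e_n`, which stands for the coordinate `x_0`. -/
def horVec (i : Fin n) : Cl n := if i = lastIdx n then 1 else e i

theorem horVec_mem (i : Fin n) : horVec i ∈ lowParavec n := by
  rw [horVec]
  split_ifs with h
  · exact Submodule.subset_span (by simp)
  · exact Submodule.subset_span (Set.mem_insert_of_mem _ ⟨i, h, rfl⟩)

theorem hor_horVec (i j : Fin n) : hor j (horVec i) = if j = i then 1 else 0 := by
  rw [hor, horVec]
  by_cases hj : j = lastIdx n <;> by_cases hi : i = lastIdx n
  · simp [hj, hi, coeff_one]
  · rw [if_pos hj, if_neg hi, ← eA_singleton, coeffLin_apply, coeff_eA,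
      if_neg (Finset.singleton_ne_empty _).symm, if_neg (by rintro rfl; exact hi hj)]
  · rw [if_neg hj, if_pos hi, coeffLin_apply, coeff_one, if_neg (Finset.singleton_ne_empty _),
      if_neg (by rintro rfl; exact hj hi)]
  · rw [if_neg hj, if_neg hi, ← eA_singleton, coeffLin_apply, coeff_eA]
    simp

variable {I : Subring (Cl n)}

/-- Every matrix in `Γ[N]` can be changed by a translation so that the image of `x` has bounded
horizontal part. -/
theorem exists_bounded_representative (hI : IsInvolutiveOrder I) {N : ℕ} (hN : 0 < N) :
    ∃ B : ℝ, 0 < B ∧ ∀ M ∈ GamN I N, ∀ x ∈ upperHalf n, ∃ M' ∈ GamN I N,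
      (∀ j, M' 1 j = M 1 j) ∧ ∀ i, |hor i (mob M' x)| ≤ B := by
  obtain ⟨m, hm, hmI⟩ := exists_nsmul_e_mem hI
  have hB : (0 : ℝ) < N * m := by
    have : (0 : ℝ) < N := by exact_mod_cast hN
    have : (0 : ℝ) < m := by exact_mod_cast hm
    positivity
  refine ⟨N * m, hB, fun M hM x hx => ?_⟩
  set z := cube ((N : ℝ) * m) (mob M x) with hz
  set b : Cl n := -∑ i, z i • (m • horVec i) with hb
  have hbI : b ∈ I := neg_mem (sum_mem fun i _ => zsmul_mem (by
    rw [horVec]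
    split_ifs
    · exact nsmul_mem (one_mem _) _
    · exact hmI i) _)
  have hbl : b ∈ lowParavec n := neg_mem (sum_mem fun i _ => zsmul_mem (nsmul_mem (horVec_mem i) _) _)
  refine ⟨transl (N • b) * M, mul_mem_GamN hI (transl_mem_GamN hI hbI hbl) hM,
    fun j => transl_mul_one_apply _ _ _, fun i => ?_⟩
  rw [mob_transl_mul (nsmul_mem hbl N) (GamN.sav hM) hx]
  have h1 : hor i b = -(z i * m) := by
    rw [hb, map_neg, map_sum]
    simp only [map_zsmul, map_nsmul, hor_horVec]
    simp
  have h2 := Int.floor_le (hor i (mob M x) / (N * m))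
  have h3 := Int.lt_floor_add_one (hor i (mob M x) / (N * m))
  have h4 : z i = ⌊hor i (mob M x) / (N * m)⌋ := rfl
  rw [← h4, le_div_iff₀ hB] at h2
  rw [← h4, div_lt_iff₀ hB] at h3
  rw [map_add, map_nsmul, h1, nsmul_eq_mul, abs_le]
  constructor <;> nlinarith

/-! ### Domination by the cusp -/

/-- The translations in `Γ[N]` whose horizontal coordinates are less than `t`. -/
def shortTransl (I : Subring (Cl n)) (N : ℕ) (t : ℝ) : Set (GamN I N) :=
  {M | (M : Mat n) 1 0 = 0 ∧ ∀ i, |hor i ((M : Mat n) 0 1)| < t}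

/-- The elements of `Γ[N]` that do not fix the cusp at infinity. -/
def movesCusp (I : Subring (Cl n)) (N : ℕ) : Set (GamN I N) := {M | (M : Mat n) 1 0 ≠ 0}

theorem entry_mem_lowParavec_of_transl {b : Cl n} (h : SAV (transl b)) : b ∈ lowParavec n := by
  refine mem_lowParavec_iff.2 ⟨by simpa [transl] using h.bd, ?_⟩
  simpa [transl] using mem_lowAlg_of_mem_lowProd (h.mem 0 1)

theorem finite_shortTransl (hI : IsInvolutiveOrder I) {N : ℕ} (hN : 3 ≤ N) (t : ℝ) :
    (shortTransl I N t).Finite := by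
  refine Set.Finite.of_injOn (f := fun M : GamN I N => (M : Mat n) 0 1) (t := {a | a ∈ I ∧ ‖a‖ ≤ (n + 1) * t})
    ?_ ?_ (finite_norm_le hI _)
  · rintro M ⟨hM, hM'⟩
    have h1 := eq_transl_of_mem_GamN hI hN M.2 hM
    have hS := GamN.sav M.2
    rw [h1] at hS
    have hb := entry_mem_lowParavec_of_transl hS
    refine ⟨M.2.1.2.2 0 1, norm_le_of_coordinates (lowParavec_le_paravec hb) (fun i => (hM' i).le) ?_⟩
    rw [xn_of_mem_lowAlg (mem_lowAlg_of_mem_lowParavec hb), abs_zero]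
    exact (abs_nonneg _).trans (hM' (lastIdx n)).le
  · rintro M ⟨hM, -⟩ M' ⟨hM', -⟩ h
    apply Subtype.ext
    rw [eq_transl_of_mem_GamN hI hN M.2 hM, eq_transl_of_mem_GamN hI hN M'.2 hM']
    exact congrArg transl h

/-- The bottom rows `(c, d)` with `c ≠ 0` that occur in `Γ[N]`. -/
def cuspRows (I : Subring (Cl n)) (N : ℕ) : Set (Cl n × Cl n) :=
  (fun M : GamN I N => ((M : Mat n) 1 0, (M : Mat n) 1 1)) '' movesCusp I N

theorem den_axis_ge {M : Mat n} (h : SAV M) {t : ℝ} (ht : 1 ≤ t) :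
    ‖den M (en n)‖ ≤ ‖den M (t • en n)‖ := by
  refine (le_abs_self _).trans (abs_le_of_sq_le_sq ?_ (norm_nonneg _))
  have h1 := norm_den_axis_sq h 1
  rw [one_smul, one_pow, one_mul] at h1
  rw [h1, norm_den_axis_sq h]
  have := le_mul_of_one_le_left (sq_nonneg ‖M 1 0‖) (one_le_pow₀ ht (n := 2))
  linarith

/-- Summation over the bottom rows converges if the series over `Γ[N]` does. -/
theorem summable_cuspRows (hI : IsInvolutiveOrder I) {N : ℕ} (hN : 3 ≤ N) {α : ℕ}
    (hs : Summable fun M : GamN I N => (‖vVal (M : Mat n) (en n) (en n)‖ ^ α)⁻¹) :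
    Summable fun r : cuspRows I N => (‖r.1.1 * en n + r.1.2‖ ^ α)⁻¹ := by
  obtain ⟨B, hB, hrep⟩ := exists_bounded_representative hI (N := N) (by omega)
  obtain ⟨δ, hδ, hden⟩ := Gam.exists_le_norm_den hI
  have h : ∀ r : cuspRows I N, ∃ M : GamN I N, ((M : Mat n) 1 0, (M : Mat n) 1 1) = r.1 ∧
      ∀ i, |hor i (mob (M : Mat n) (en n))| ≤ B := by
    rintro ⟨_, M, -, rfl⟩
    obtain ⟨M', hM', hrow, hh⟩ := hrep M M.2 (en n) en_mem_upperHalf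
    exact ⟨⟨M', hM'⟩, by simp [hrow], hh⟩
  choose g hg hgB using h
  have hinj : Function.Injective g := fun r r' h => Subtype.ext (by rw [← hg r, h, hg r'])
  set C : ℝ := 1 + (n + 1) * (B + 1 / δ ^ 2) with hC
  refine Summable.of_nonneg_of_le (fun r => by positivity) (fun r => ?_)
    ((hs.comp_injective hinj).mul_left (C ^ α))
  have hS := GamN.sav (g r).2
  have hU := mob_mem_upperHalf hS en_mem_upperHalf
  have h1 : ‖mob (g r : Mat n) (en n)‖ ≤ (n + 1) * (B + 1 / δ ^ 2) := by
    have hδ2 : 0 ≤ 1 / δ ^ 2 := by positivity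
    refine norm_le_of_coordinates hU.1 (fun i => (hgB r i).trans (by linarith)) ?_
    rw [abs_of_pos hU.2, xn_mob hS en_mem_paravec, xn_en]
    have : 1 / ‖den (g r : Mat n) (en n)‖ ^ 2 ≤ 1 / δ ^ 2 := by
      gcongr; exact hden _ (g r).2.1
    linarith
  have h2 : ‖en n + mob (g r : Mat n) (en n)‖ ≤ C :=
    (norm_add_le _ _).trans (by rw [norm_e]; linarith)
  have h3 : r.1.1 * en n + r.1.2 = den (g r : Mat n) (en n) := by rw [← hg r]; rfl
  have h4 := norm_den_pos hS en_mem_upperHalf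
  have h5 : 0 < ‖vVal (g r : Mat n) (en n) (en n)‖ :=
    norm_pos_iff.2 (vVal_ne_zero hS en_mem_upperHalf en_mem_upperHalf)
  have h6 : ‖vVal (g r : Mat n) (en n) (en n)‖ ≤ C * ‖den (g r : Mat n) (en n)‖ := by
    rw [norm_vVal hS en_mem_upperHalf]; gcongr
  rw [h3, Function.comp, inv_le_iff_one_le_mul₀ (by positivity), mul_right_comm, ← div_eq_mul_inv,
    one_le_div (by positivity), ← mul_pow]
  gcongr

theorem tendsto_tsum_cuspRows (hI : IsInvolutiveOrder I) {N : ℕ} (hN : 3 ≤ N) {α : ℕ} (hα : α ≠ 0)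
    (hs : Summable fun M : GamN I N => (‖vVal (M : Mat n) (en n) (en n)‖ ^ α)⁻¹) :
    Filter.Tendsto (fun t : ℝ => ∑' r : cuspRows I N, (‖r.1.1 * (t • en n) + r.1.2‖ ^ α)⁻¹)
      Filter.atTop (𝓝 0) := by
  have h0 : (0 : ℝ) = ∑' _ : cuspRows I N, (0 : ℝ) := by simp
  rw [h0]
  refine tendsto_tsum_of_dominated_convergence (summable_cuspRows hI hN hs) ?_ ?_
  · rintro ⟨_, M, hM, rfl⟩
    have hS := GamN.sav M.2
    have hc : 0 < ‖(M : Mat n) 1 0‖ := norm_pos_iff.2 hM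
    refine Filter.Tendsto.inv_tendsto_atTop ((Filter.tendsto_pow_atTop hα).comp ?_)
    refine Filter.tendsto_atTop_mono' _ ?_ (Filter.tendsto_id.atTop_mul_const hc)
    filter_upwards [Filter.eventually_gt_atTop 0] with t ht
    have := xn_mul_norm_le_norm_den hS (smul_en_mem_upperHalf ht)
    rwa [xn_smul, xn_en, mul_one] at this
  · filter_upwards [Filter.eventually_ge_atTop 1] with t ht
    rintro ⟨_, M, hM, rfl⟩
    have hS := GamN.sav M.2
    rw [Real.norm_of_nonneg (by positivity)]
    have h4 := norm_den_pos hS en_mem_upperHalf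
    have h5 := den_axis_ge hS ht
    change (‖den (M : Mat n) (t • en n)‖ ^ α)⁻¹ ≤ (‖den (M : Mat n) (en n)‖ ^ α)⁻¹
    gcongr

/-- The elements of `Γ[N]` that move the cusp, summed over at height `t`, are negligible compared with
the translations of length at most `t`. They are sorted by their bottom row and by the cube of side
`t` containing the image point; elements in the same class differ by a short translation. -/
theorem tsum_movesCusp_le (hI : IsInvolutiveOrder I) {N : ℕ} (hN : 3 ≤ N) {α : ℕ} (hα : n < α)
    (hs : Summable fun M : GamN I N => (‖vVal (M : Mat n) (en n) (en n)‖ ^ α)⁻¹) {t : ℝ} (ht : 1 ≤ t) :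
    (Summable fun M : movesCusp I N => (‖vVal (M.1 : Mat n) (t • en n) (t • en n)‖ ^ α)⁻¹) ∧
    ∑' M : movesCusp I N, (‖vVal (M.1 : Mat n) (t • en n) (t • en n)‖ ^ α)⁻¹ ≤
      (shortTransl I N t).ncard * (t ^ α)⁻¹ * (3 ^ α * (∑' z : Fin n → ℤ, ((1 + ‖z‖) ^ α)⁻¹) *
        ∑' r : cuspRows I N, (‖r.1.1 * (t • en n) + r.1.2‖ ^ α)⁻¹) := by
  have ht0 : 0 < t := by linarith
  have hx := smul_en_mem_upperHalf (n := n) ht0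
  have hZ := summable_one_add_norm_pow hα
  have hR : Summable fun r : cuspRows I N => (‖r.1.1 * (t • en n) + r.1.2‖ ^ α)⁻¹ := by
    refine Summable.of_nonneg_of_le (fun r => by positivity) ?_ (summable_cuspRows hI hN hs)
    rintro ⟨_, M, hM, rfl⟩
    have h4 := norm_den_pos (GamN.sav M.2) en_mem_upperHalf
    have h5 := den_axis_ge (GamN.sav M.2) ht
    change (‖den (M : Mat n) (t • en n)‖ ^ α)⁻¹ ≤ (‖den (M : Mat n) (en n)‖ ^ α)⁻¹
    gcongr
  let f : movesCusp I N → cuspRows I N × (Fin n → ℤ) := fun M =>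
    (⟨_, M.1, M.2, rfl⟩, cube t (mob (M.1 : Mat n) (t • en n)))
  have hprod := hR.mul_of_nonneg hZ (fun r => by positivity) (fun z => by positivity)
  have hfib := summable_comp_of_card_fiber_le (f := f) (K := (shortTransl I N t).ncard)
    (hprod.mul_left ((3 / t) ^ α)) (fun p => by positivity) (by
      intro s b hb
      rcases s.eq_empty_or_nonempty with rfl | ⟨M₀, hM₀⟩
      · simp
      rw [Set.ncard_eq_toFinset_card _ (finite_shortTransl hI hN t)]
      refine Finset.card_le_card_of_injOn
        (fun M => (⟨_, mul_mem_GamN hI M.1.2 (adj_mem_GamN hI M₀.1.2)⟩ : GamN I N)) ?_ ?_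
      · intro M hM
        have hS0 := GamN.sav M₀.1.2
        have hfM : f M = f M₀ := by rw [hb M hM, hb M₀ hM₀]
        have hrow : ((M.1 : Mat n) 1 0, (M.1 : Mat n) 1 1) = ((M₀.1 : Mat n) 1 0, (M₀.1 : Mat n) 1 1) :=
          congrArg (fun p => (p.1 : Cl n × Cl n)) hfM
        have hcube : cube t (mob (M.1 : Mat n) (t • en n)) = cube t (mob (M₀.1 : Mat n) (t • en n)) :=
          congrArg Prod.snd hfM
        obtain ⟨hr0, hr1⟩ := Prod.mk.inj hrow
        have hT := mul_mem_GamN hI M.1.2 (adj_mem_GamN hI M₀.1.2)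
        have hc : ((M.1 : Mat n) * adj (M₀.1 : Mat n)) 1 0 = 0 := by
          have := congrFun (congrFun hS0.mul_adj 1) 0
          rw [Matrix.mul_apply, Fin.sum_univ_two] at this ⊢
          rw [hr0, hr1, this]; simp
        have htr := eq_transl_of_mem_GamN hI hN hT hc
        set β := ((M.1 : Mat n) * adj (M₀.1 : Mat n)) 0 1 with hβ
        have hβl : β ∈ lowParavec n := entry_mem_lowParavec_of_transl (htr ▸ GamN.sav hT)
        have hM' : (M.1 : Mat n) = transl β * (M₀.1 : Mat n) := by
          rw [← htr, mul_assoc, hS0.adj_mul_self, mul_one]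
        simp only [Set.Finite.coe_toFinset]
        refine ⟨hc, fun i => ?_⟩
        have h1 := abs_hor_sub_lt ht0 hcube i
        rw [hM', mob_transl_mul hβl hS0 hx, add_sub_cancel_left] at h1
        exact h1
      · intro M _ M' _ h
        have h1 := congrArg (fun X : GamN I N => (X : Mat n) * (M₀.1 : Mat n)) h
        simp only [mul_assoc, (GamN.sav M₀.1.2).adj_mul_self, mul_one] at h1
        exact Subtype.ext (Subtype.ext h1))
  have hle : ∀ M : movesCusp I N, (‖vVal (M.1 : Mat n) (t • en n) (t • en n)‖ ^ α)⁻¹ ≤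
      (3 / t) ^ α * ((‖(f M).1.1.1 * (t • en n) + (f M).1.1.2‖ ^ α)⁻¹ * ((1 + ‖(f M).2‖) ^ α)⁻¹) := by
    intro M
    have hS := GamN.sav M.1.2
    have hU := mob_mem_upperHalf hS hx
    set y := mob (M.1 : Mat n) (t • en n) with hy
    have h1 : t ≤ ‖t • en n + y‖ := by
      refine le_trans ?_ xn_le_norm
      rw [xn_add, xn_smul, xn_en]; linarith [hU.2]
    have h2 := mul_norm_cube_le (x := y) ht0 (norm_nonneg (t • en n + y)) (fun i => by
      have := abs_hor_le_norm i (t • en n + y)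
      rwa [map_add, map_smul, hor_en, smul_zero, zero_add] at this)
    have h3 : t * (1 + ‖cube t y‖) ≤ 3 * ‖t • en n + y‖ := by linarith
    have h4 := norm_den_pos hS hx
    have h6 : 0 < ‖vVal (M.1 : Mat n) (t • en n) (t • en n)‖ := norm_pos_iff.2 (vVal_ne_zero hS hx hx)
    have h5 : ‖den (M.1 : Mat n) (t • en n)‖ * (1 + ‖cube t y‖) ≤
        (3 / t) * ‖vVal (M.1 : Mat n) (t • en n) (t • en n)‖ := by
      rw [norm_vVal hS hx, ← hy, div_mul_eq_mul_div, le_div_iff₀ ht0]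
      calc _ = (t * (1 + ‖cube t y‖)) * ‖den (M.1 : Mat n) (t • en n)‖ := by ring
        _ ≤ (3 * ‖t • en n + y‖) * ‖den (M.1 : Mat n) (t • en n)‖ := by gcongr
        _ = _ := by ring
    change _ ≤ (3 / t) ^ α * ((‖den (M.1 : Mat n) (t • en n)‖ ^ α)⁻¹ * ((1 + ‖cube t y‖) ^ α)⁻¹)
    rw [← mul_inv, ← mul_pow, inv_le_iff_one_le_mul₀ (by positivity), mul_right_comm, ← div_eq_mul_inv,
      one_le_div (by positivity), ← mul_pow]
    gcongr
  have hsum := Summable.of_nonneg_of_le (fun M => by positivity) hle hfib.1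
  refine ⟨hsum, (hsum.tsum_le_tsum hle hfib.1).trans (hfib.2.trans_eq ?_)⟩
  rw [tsum_mul_left, ← hR.tsum_mul_tsum hZ hprod, div_pow]
  ring

/-- A family of real functions on `Γ[N]` whose values at translations are non-negative, and not too small
at the short ones, cannot have sum zero at all heights `t`. -/
theorem not_hasSum_zero (hI : IsInvolutiveOrder I) {N : ℕ} (hN : 3 ≤ N) {α : ℕ} (hα : n < α)
    (hs : Summable fun M : GamN I N => (‖vVal (M : Mat n) (en n) (en n)‖ ^ α)⁻¹)
    {u : ℝ → GamN I N → ℝ} {c₀ C : ℝ} (hc₀ : 0 < c₀) (hC : 0 ≤ C)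
    (hu : ∀ t, 1 ≤ t → HasSum (u t) 0)
    (hshort : ∀ t, 1 ≤ t → ∀ M ∈ shortTransl I N t, c₀ * (t ^ α)⁻¹ ≤ u t M)
    (hcusp : ∀ t, 1 ≤ t → ∀ M ∉ movesCusp I N, 0 ≤ u t M)
    (hmoves : ∀ t, 1 ≤ t → ∀ M ∈ movesCusp I N,
      |u t M| ≤ C * (‖vVal (M : Mat n) (t • en n) (t • en n)‖ ^ α)⁻¹) : False := by
  have hlim := tendsto_tsum_cuspRows hI hN (by omega : α ≠ 0) hs
  have hlim2 := hlim.const_mul (C * (3 ^ α * ∑' z : Fin n → ℤ, ((1 + ‖z‖) ^ α)⁻¹))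
  rw [mul_zero] at hlim2
  obtain ⟨t, ht1, htlt⟩ := ((Filter.eventually_ge_atTop (1 : ℝ)).and
    (hlim2.eventually (gt_mem_nhds hc₀))).exists
  obtain ⟨hs1, hle⟩ := tsum_movesCusp_le hI hN hα hs ht1
  set E := ∑' M : movesCusp I N, (‖vVal (M.1 : Mat n) (t • en n) (t • en n)‖ ^ α)⁻¹ with hE
  have hind : HasSum ((movesCusp I N).indicator
      fun M : GamN I N => C * (‖vVal (M : Mat n) (t • en n) (t • en n)‖ ^ α)⁻¹) (C * E) :=
    hasSum_subtype_iff_indicator.1 (hs1.hasSum.mul_left C)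
  -- the sum of `u` and the bound on the elements that move the cusp has non-negative terms
  have hv := (hu t ht1).add hind
  rw [zero_add] at hv
  have hnn : ∀ M : GamN I N, 0 ≤ u t M + (movesCusp I N).indicator
      (fun M : GamN I N => C * (‖vVal (M : Mat n) (t • en n) (t • en n)‖ ^ α)⁻¹) M := by
    intro M
    by_cases hM : M ∈ movesCusp I N
    · rw [Set.indicator_of_mem hM]
      linarith [(abs_le.1 (hmoves t ht1 M hM)).1]
    · rw [Set.indicator_of_notMem hM, add_zero]
      exact hcusp t ht1 M hM
  have hfin := finite_shortTransl hI hN t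
  have h1 := sum_le_hasSum hfin.toFinset (fun M _ => hnn M) hv
  have h2 : (hfin.toFinset.card : ℝ) * (c₀ * (t ^ α)⁻¹) ≤ ∑ M ∈ hfin.toFinset, (u t M +
      (movesCusp I N).indicator
      (fun M : GamN I N => C * (‖vVal (M : Mat n) (t • en n) (t • en n)‖ ^ α)⁻¹) M) := by
    rw [← nsmul_eq_mul]
    refine Finset.card_nsmul_le_sum _ _ _ fun M hM => ?_
    have hM' := hfin.mem_toFinset.1 hM
    have hM2 : M ∉ movesCusp I N := fun h => (show (M : Mat n) 1 0 ≠ 0 from h) hM'.1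
    rw [Set.indicator_of_notMem hM2, add_zero]
    exact hshort t ht1 M hM'
  rw [← Set.ncard_eq_toFinset_card _ hfin] at h2
  have hcard : (0 : ℝ) < (shortTransl I N t).ncard := by
    have : (⟨1, one_mem_GamN hI N⟩ : GamN I N) ∈ shortTransl I N t :=
      ⟨by simp, fun i => by simp; linarith⟩
    exact_mod_cast (Set.ncard_pos hfin).2 ⟨_, this⟩
  have ht0 : 0 < t := by linarith
  have hK : 0 < (shortTransl I N t).ncard * (t ^ α)⁻¹ := by positivity
  have h3 : C * E < (shortTransl I N t).ncard * (t ^ α)⁻¹ * c₀ := by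
    refine (mul_le_mul_of_nonneg_left hle hC).trans_lt ?_
    calc _ = (shortTransl I N t).ncard * (t ^ α)⁻¹ * (C * (3 ^ α * ∑' z : Fin n → ℤ, ((1 + ‖z‖) ^ α)⁻¹) *
          ∑' r : cuspRows I N, (‖r.1.1 * (t • en n) + r.1.2‖ ^ α)⁻¹) := by ring
      _ < _ := by gcongr
  linarith

end

/-! ### The derivative of the kernel -/

/-- Conjugation as a continuous linear map. -/
def starL (n : ℕ) : Cl n →L[ℝ] Cl n := LinearMap.toContinuousLinearMap starLin

@[simp] theorem starL_apply {n : ℕ} (a : Cl n) : starL n a = star a := rfl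

/-- Left multiplication as a continuous linear map. -/
def mulLeftL {n : ℕ} (a : Cl n) : Cl n →L[ℝ] Cl n := LinearMap.toContinuousLinearMap (LinearMap.mulLeft ℝ a)

@[simp] theorem mulLeftL_apply {n : ℕ} (a b : Cl n) : mulLeftL a b = a * b := rfl

/-- The scalar part as a continuous linear form. -/
def scL (n : ℕ) : Cl n →L[ℝ] ℝ := LinearMap.toContinuousLinearMap sc

/-- The derivative at `y` of `y ↦ ȳ / ‖y‖^m`. -/
def kernelDeriv {n : ℕ} (m : ℕ) (y : Cl n) : Cl n →L[ℝ] Cl n :=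
  (‖y‖ ^ m)⁻¹ • starL n - (m * (‖y‖ ^ m)⁻¹ * (‖y‖ ^ 2)⁻¹) • (innerSL ℝ y).smulRight (star y)

theorem kernelDeriv_apply {n : ℕ} (m : ℕ) (y v : Cl n) :
    kernelDeriv m y v =
      (‖y‖ ^ m)⁻¹ • star v - (m * (‖y‖ ^ m)⁻¹ * (‖y‖ ^ 2)⁻¹ * ⟪y, v⟫) • star y := by
  simp [kernelDeriv, mul_smul]

theorem hasFDerivAt_kernel {n : ℕ} {m : ℕ} (hm : 2 ≤ m) {y : Cl n} (hy : y ≠ 0) :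
    HasFDerivAt (fun y : Cl n => (‖y‖ ^ m)⁻¹ • star y) (kernelDeriv m y) y := by
  have hy' : ‖y‖ ≠ 0 := norm_ne_zero_iff.2 hy
  have h1 := hasFDerivAt_norm_rpow y (p := m) (by exact_mod_cast hm)
  simp only [Real.rpow_natCast] at h1
  have h2 := (hasFDerivAt_inv (pow_ne_zero m hy')).comp y h1
  have h3 := h2.smul (starL n).hasFDerivAt
  refine h3.congr_fderiv ?_
  have h4 : ‖y‖ ^ ((m : ℝ) - 2) = ‖y‖ ^ m * (‖y‖ ^ 2)⁻¹ := by
    rw [Real.rpow_sub (by positivity), Real.rpow_natCast, div_eq_mul_inv]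
    norm_cast
  ext v
  simp only [kernelDeriv, h4]
  simp [smul_smul, sub_eq_add_neg]
  congr 1
  field_simp

theorem norm_kernelDeriv_apply_le {n : ℕ} (m : ℕ) {y : Cl n} (hy : y ≠ 0) (v : Cl n) :
    ‖kernelDeriv m y v‖ ≤ (m + 1) * (‖y‖ ^ m)⁻¹ * ‖v‖ := by
  have hy' : 0 < ‖y‖ := norm_pos_iff.2 hy
  rw [kernelDeriv_apply]
  refine (norm_sub_le _ _).trans ?_
  rw [norm_smul, norm_smul, norm_star', norm_star', Real.norm_of_nonneg (by positivity), norm_mul,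
    Real.norm_of_nonneg (by positivity)]
  have h1 : ‖⟪y, v⟫‖ ≤ ‖y‖ * ‖v‖ := norm_inner_le_norm y v
  have h2 : m * (‖y‖ ^ m)⁻¹ * (‖y‖ ^ 2)⁻¹ * ‖⟪y, v⟫‖ * ‖y‖ ≤
      m * (‖y‖ ^ m)⁻¹ * (‖y‖ ^ 2)⁻¹ * (‖y‖ * ‖v‖) * ‖y‖ := by gcongr
  have h3 : m * (‖y‖ ^ m)⁻¹ * (‖y‖ ^ 2)⁻¹ * (‖y‖ * ‖v‖) * ‖y‖ = m * (‖y‖ ^ m)⁻¹ * ‖v‖ := by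
    field_simp
  linarith

theorem norm_sq_of_mem_paravec {n : ℕ} {y : Cl n} (hy : y ∈ paravec n) :
    ‖y‖ ^ 2 = ⟪y, 1⟫ ^ 2 + ∑ i, ⟪y, e i⟫ ^ 2 := by
  have h1 : ⟪y, 1⟫ = coeff ∅ y := by rw [real_inner_comm, ← eA_empty, inner_eA]
  have h2 : ∀ i, ⟪y, e i⟫ = coeff {i} y := fun i => by rw [real_inner_comm, ← eA_singleton, inner_eA]
  have h3 : ⟪y, coeff ∅ y • 1 + ∑ i, coeff {i} y • e i⟫ = ‖y‖ ^ 2 := by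
    rw [← paravec_eq_sum hy, real_inner_self_eq_norm_sq]
  rw [← h3, inner_add_right, inner_sum, real_inner_smul_right]
  simp only [real_inner_smul_right, h1, h2, sq]

/-- The scalar part of the Dirac operator, expressed through the derivative. -/
def scDiv {n : ℕ} (L : Cl n →L[ℝ] Cl n) : ℝ := sc (L 1) + ∑ i, sc (e i * L (e i))

theorem abs_scDiv_le {n : ℕ} {L : Cl n →L[ℝ] Cl n} {C : ℝ} (h1 : ‖L 1‖ ≤ C) (h : ∀ i, ‖L (e i)‖ ≤ C) :
    |scDiv L| ≤ (n + 1) * C := by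
  have h2 : ∀ i, |sc (e i * L (e i))| ≤ C := fun i => by
    refine (abs_sc_le_norm _).trans ?_
    rw [norm_mul_left (mem_pvProd_of_mem_paravec (e_mem_paravec i)), norm_e, one_mul]
    exact h i
  have h3 : |∑ i, sc (e i * L (e i))| ≤ n * C := by
    refine (Finset.abs_sum_le_sum_abs _ _).trans ?_
    refine (Finset.sum_le_sum fun i _ => h2 i).trans (by simp)
  have h4 := (abs_sc_le_norm (L 1)).trans h1
  refine (abs_add_le _ _).trans ?_
  linarith

/-- The kernel has divergence `(n + 1 - m) / ‖y‖^m`. -/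
theorem scDiv_kernelDeriv {n : ℕ} (m : ℕ) {y : Cl n} (hy : y ∈ paravec n) (h0 : y ≠ 0) {L : Cl n →L[ℝ] Cl n}
    (hL : ∀ v ∈ paravec n, L v = kernelDeriv m y v) :
    scDiv L = (n + 1 - m) * (‖y‖ ^ m)⁻¹ := by
  have hy' : ‖y‖ ≠ 0 := norm_ne_zero_iff.2 h0
  have h1 : sc (star y) = ⟪y, 1⟫ := by rw [inner_def, mul_one]
  have h2 : ∀ i, sc (e i * star y) = ⟪y, e i⟫ := fun i => by rw [inner_def, sc_mul_comm]
  have h3 : ∀ i : Fin n, sc (e i * star (e i)) = 1 := fun i => by rw [star_e, mul_neg, e_mul_self]; simp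
  have h4 : ∀ i, sc (e i * L (e i)) = (‖y‖ ^ m)⁻¹ -
      m * (‖y‖ ^ m)⁻¹ * (‖y‖ ^ 2)⁻¹ * ⟪y, e i⟫ ^ 2 := fun i => by
    rw [hL _ (e_mem_paravec i), kernelDeriv_apply, mul_sub, mul_smul_comm, mul_smul_comm, map_sub, map_smul,
      map_smul, h2, h3, smul_eq_mul, smul_eq_mul]
    ring
  rw [scDiv, hL _ one_mem_paravec, kernelDeriv_apply]
  simp only [h4, Finset.sum_sub_distrib, ← Finset.mul_sum]
  rw [map_sub, map_smul, map_smul, h1, star_one, sc_one, smul_eq_mul, smul_eq_mul]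
  simp only [Finset.sum_const, Finset.card_univ, Fintype.card_fin, nsmul_eq_mul]
  have h5 := norm_sq_of_mem_paravec hy
  have h6 : ∑ i, ⟪y, e i⟫ ^ 2 = ‖y‖ ^ 2 - ⟪y, 1⟫ ^ 2 := by rw [h5]; ring
  rw [h6]
  field_simp
  ring

/-- The orthogonal projection onto the paravectors. -/
def paraProj (n : ℕ) : Cl n →L[ℝ] Cl n := LinearMap.toContinuousLinearMap
  ((coeffLin ∅).smulRight 1 + ∑ i, (coeffLin {i}).smulRight (e i))

theorem paraProj_apply {n : ℕ} (x : Cl n) : paraProj n x = coeff ∅ x • 1 + ∑ i, coeff {i} x • e i := by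
  simp [paraProj]

theorem paraProj_of_mem {n : ℕ} {x : Cl n} (hx : x ∈ paravec n) : paraProj n x = x := by
  rw [paraProj_apply, ← paravec_eq_sum hx]

theorem paraProj_mem {n : ℕ} (x : Cl n) : paraProj n x ∈ paravec n := by
  rw [paraProj_apply]
  exact add_mem (Submodule.smul_mem _ _ one_mem_paravec)
    (sum_mem fun i _ => Submodule.smul_mem _ _ (e_mem_paravec i))

section
variable {n : ℕ} [NeZero n] {I : Subring (Cl n)}

theorem xn_paraProj (x : Cl n) : xn (paraProj n x) = xn x := by
  have h : ∀ i : Fin n, xn (e i) = if i = lastIdx n then 1 else 0 := fun i => by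
    rw [xn, ← eA_singleton, coeff_eA]
    simp [eq_comm]
  rw [paraProj_apply, xn_add, xn_smul, xn_of_mem_lowAlg (one_mem _), mul_zero, zero_add,
    xn, ← coeffLin_apply, map_sum]
  simp only [map_smul, coeffLin_apply]
  change ∑ i, coeff {i} x • xn (e i) = _
  simp [h]
  rfl

/-! ### Sums over the translations -/

theorem vVal_transl {n : ℕ} (b x w : Cl n) : vVal (transl b) x w = x + b + w := by
  simp [vVal, transl]

theorem xn_star_of_mem_paravec {y : Cl n} (hy : y ∈ paravec n) : xn (star y) = -xn y := by
  have h1 := sub_xn_smul_mem_lowParavec hy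
  have h2 : star y = star (y - xn y • en n) + -(xn y) • en n := by
    rw [star_sub, CliffordAlgebra.star_smul, star_e, smul_neg, neg_smul]; abel
  rw [h2, xn_add, xn_smul, xn_en, xn_of_mem_lowAlg (star_mem_lowAlg (mem_lowAlg_of_mem_lowParavec h1))]
  ring

/-- At `x = w = t e_n` a translation contributes a paravector with last coordinate `2 t`. -/
theorem vVal_translation (hI : IsInvolutiveOrder I) {N : ℕ} (hN : 3 ≤ N) {M : GamN I N}
    (hM : M ∉ movesCusp I N) (t : ℝ) :
    (M : Mat n) = transl ((M : Mat n) 0 1) ∧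
    vVal (M : Mat n) (t • en n) (t • en n) ∈ paravec n ∧
    xn (vVal (M : Mat n) (t • en n) (t • en n)) = 2 * t := by
  have hc : (M : Mat n) 1 0 = 0 := by by_contra h; exact hM h
  have h1 := eq_transl_of_mem_GamN hI hN M.2 hc
  have hS := GamN.sav M.2
  rw [h1] at hS
  have hb := entry_mem_lowParavec_of_transl hS
  have ht : t • en n ∈ paravec n := Submodule.smul_mem _ _ en_mem_paravec
  refine ⟨h1, ?_, ?_⟩
  · rw [h1, vVal_transl]
    exact add_mem (add_mem ht (lowParavec_le_paravec hb)) ht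
  · rw [h1, vVal_transl, xn_add, xn_add, xn_of_mem_lowAlg (mem_lowAlg_of_mem_lowParavec hb), xn_smul, xn_en]
    ring

theorem norm_vVal_shortTransl_le (hI : IsInvolutiveOrder I) {N : ℕ} (hN : 3 ≤ N) {t : ℝ} (ht : 1 ≤ t)
    {M : GamN I N} (hM : M ∈ shortTransl I N t) :
    ‖vVal (M : Mat n) (t • en n) (t • en n)‖ ≤ (n + 3) * t := by
  have h1 := eq_transl_of_mem_GamN hI hN M.2 hM.1
  have hS := GamN.sav M.2
  rw [h1] at hS
  have hb := entry_mem_lowParavec_of_transl hS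
  have h2 : ‖(M : Mat n) 0 1‖ ≤ (n + 1) * t := by
    refine norm_le_of_coordinates (lowParavec_le_paravec hb) (fun i => (hM.2 i).le) ?_
    rw [xn_of_mem_lowAlg (mem_lowAlg_of_mem_lowParavec hb), abs_zero]
    linarith
  have h3 : ‖t • en n‖ = t := by rw [norm_smul, norm_e, mul_one, Real.norm_of_nonneg (by linarith)]
  rw [h1, vVal_transl]
  refine (norm_add_le _ _).trans ?_
  have := norm_add_le (t • en n) ((M : Mat n) 0 1)
  rw [h3] at this ⊢
  linarith

theorem norm_term {k : ℤ} {κ : ℕ} (hk : k = -κ) {M : Mat n} (h : SAV M) {x w : Cl n}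
    (hx : x ∈ upperHalf n) (hw : w ∈ upperHalf n) :
    ‖term k M x w‖ = (‖vVal M x w‖ ^ (n + κ))⁻¹ := by
  rw [term_eq_kernel k h hx, norm_kernel hk (vVal_ne_zero h hx hw)]

theorem le_inv_norm_vVal_shortTransl (hI : IsInvolutiveOrder I) {N : ℕ} (hN : 3 ≤ N) {t : ℝ} (ht : 1 ≤ t)
    {M : GamN I N} (hM : M ∈ shortTransl I N t) (α : ℕ) :
    ((n + 3 : ℝ) ^ (α + 1))⁻¹ * (t ^ α)⁻¹ ≤ t * (‖vVal (M : Mat n) (t • en n) (t • en n)‖ ^ (α + 1))⁻¹ := by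
  have ht0 : 0 < t := by linarith
  have h1 := norm_vVal_shortTransl_le hI hN ht hM
  have h2 := vVal_ne_zero (GamN.sav M.2) (smul_en_mem_upperHalf (n := n) ht0) (smul_en_mem_upperHalf ht0)
  have h3 : 0 < ‖vVal (M : Mat n) (t • en n) (t • en n)‖ := norm_pos_iff.2 h2
  calc ((n + 3 : ℝ) ^ (α + 1))⁻¹ * (t ^ α)⁻¹ = t * ((((n + 3) * t) ^ (α + 1))⁻¹) := by
        rw [mul_pow, pow_succ t]; field_simp
    _ ≤ _ := by gcongr

/-- Non-vanishing: at `x = w = t e_n`, `t → ∞`, the `e_n`-components of the summands of the translations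
have the same sign, and they dominate. -/
theorem not_forall_hasSum_zero (hI : IsInvolutiveOrder I) {N : ℕ} (hN : 3 ≤ N) {k : ℤ} {κ : ℕ}
    (hk : k = -κ) (hκ : 0 < κ)
    (h : ∀ x ∈ upperHalf n, ∀ w ∈ upperHalf n, HasSum (fun M : GamN I N => term k (M : Mat n) x w) 0) :
    False := by
  have hs : Summable fun M : GamN I N => (‖vVal (M : Mat n) (en n) (en n)‖ ^ (n + κ))⁻¹ := by
    have h1 := summable_norm_iff.2 (h _ en_mem_upperHalf _ en_mem_upperHalf).summable
    refine h1.congr fun M => ?_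
    rw [norm_term hk (GamN.sav M.2) en_mem_upperHalf en_mem_upperHalf]
  have hval : ∀ t : ℝ, 1 ≤ t → ∀ M ∉ movesCusp I N, -xn (term k (M : Mat n) (t • en n) (t • en n)) =
      2 * (t * (‖vVal (M : Mat n) (t • en n) (t • en n)‖ ^ (n + κ + 1))⁻¹) := by
    intro t ht M hM
    have hx : t • en n ∈ upperHalf n := smul_en_mem_upperHalf (by linarith)
    obtain ⟨-, h1, h2⟩ := vVal_translation hI hN hM t
    rw [term_eq_kernel k (GamN.sav M.2) hx, kernel_eq hk, xn_smul, xn_star_of_mem_paravec h1, h2]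
    ring
  refine not_hasSum_zero hI hN (by omega : n < n + κ) hs
    (u := fun t M => -xn (term k (M : Mat n) (t • en n) (t • en n)))
    (c₀ := 2 * ((n + 3 : ℝ) ^ (n + κ + 1))⁻¹) (C := 1) (by positivity) (by positivity) ?_ ?_ ?_ ?_
  · intro t ht
    have hx : t • en n ∈ upperHalf n := smul_en_mem_upperHalf (by linarith)
    have h1 := ((h _ hx _ hx).mapL (LinearMap.toContinuousLinearMap (coeffLin {lastIdx n}))).neg
    rw [map_zero, neg_zero] at h1
    exact h1
  · intro t ht M hM
    have hM' : M ∉ movesCusp I N := fun h => (show (M : Mat n) 1 0 ≠ 0 from h) hM.1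
    rw [hval t ht M hM', mul_assoc]
    have := le_inv_norm_vVal_shortTransl hI hN ht hM (n + κ)
    gcongr
  · intro t ht M hM
    have : 0 ≤ t := by linarith
    rw [hval t ht M hM]
    positivity
  · intro t ht M hM
    have hx : t • en n ∈ upperHalf n := smul_en_mem_upperHalf (by linarith)
    rw [abs_neg, one_mul, ← norm_term hk (GamN.sav M.2) hx hx]
    exact abs_xn_le_norm _

/-! ### Convergence, automorphy and cusps -/

theorem summable_GamN_en (hI : IsInvolutiveOrder I) (N : ℕ) {α : ℕ} (hα : 2 * n < α) :
    Summable fun M : GamN I N => (‖vVal (M : Mat n) (en n) (en n)‖ ^ α)⁻¹ :=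
  (summable_Gam_en hI hα).comp_injective (i := fun M : GamN I N => (⟨M, M.2.1⟩ : Gam I))
    fun _ _ h => Subtype.ext (congrArg (fun M : Gam I => (M : Mat n)) h)

theorem summable_norm_term (hI : IsInvolutiveOrder I) (N : ℕ) {k : ℤ} {κ : ℕ} (hk : k = -κ)
    (hκ : n < κ) {x w : Cl n} (hx : x ∈ upperHalf n) (hw : w ∈ upperHalf n) :
    Summable fun M : GamN I N => ‖term k (M : Mat n) x w‖ := by
  refine (summable_of_summable_en (fun M hM => GamN.sav hM) (summable_GamN_en hI N (by omega : 2 * n < n + κ))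
    hx hw).congr fun M => ?_
  rw [norm_term hk (GamN.sav M.2) hx hw]

/-- Right translation by an element of `Γ[N]`. -/
def mulRightEquiv (hI : IsInvolutiveOrder I) {N : ℕ} {M : Mat n} (hM : M ∈ GamN I N) :
    GamN I N ≃ GamN I N where
  toFun M' := ⟨M' * M, mul_mem_GamN hI M'.2 hM⟩
  invFun M' := ⟨M' * adj M, mul_mem_GamN hI M'.2 (adj_mem_GamN hI hM)⟩
  left_inv M' := Subtype.ext (by simp only [mul_assoc, (GamN.sav hM).mul_adj, mul_one])
  right_inv M' := Subtype.ext (by simp only [mul_assoc, (GamN.sav hM).adj_mul_self, mul_one])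

/-- The slashed series is the sum over the right coset `Γ[N] R`. -/
theorem autFactor_mul_poincare (hI : IsInvolutiveOrder I) (N : ℕ) {k : ℤ} {κ : ℕ} (hk : k = -κ)
    (hκ : n < κ) {R : Mat n} (hR : R ∈ Gam I) {x w : Cl n} (hx : x ∈ upperHalf n) (hw : w ∈ upperHalf n) :
    autFactor k R x * poincare I N k (mob R x) w = ∑' M : GamN I N, term k ((M : Mat n) * R) x w := by
  have hs := (summable_norm_term hI N hk hκ (mob_mem_upperHalf (Gam.sav hR) hx) hw).of_norm
  rw [poincare, ← mulLeftL_apply, (mulLeftL (autFactor k R x)).map_tsum hs]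
  refine tsum_congr fun M => ?_
  rw [mulLeftL_apply, term_mul k (Gam.sav hR) (GamN.sav M.2) hx]

theorem poincare_automorphy (hI : IsInvolutiveOrder I) (N : ℕ) {k : ℤ} {κ : ℕ} (hk : k = -κ)
    (hκ : n < κ) {M : Mat n} (hM : M ∈ GamN I N) {x w : Cl n} (hx : x ∈ upperHalf n)
    (hw : w ∈ upperHalf n) :
    poincare I N k x w = autFactor k M x * poincare I N k (mob M x) w := by
  rw [autFactor_mul_poincare hI N hk hκ hM.1 hx hw, poincare, ← (mulRightEquiv hI hM).tsum_eq]
  rfl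

/-- Decay at the cusps: `‖V_M(t e_n, e_n)‖ ≥ t max(‖a‖, ‖c‖)` for each matrix of the coset `Γ[N] R`, and
`‖V_M(e_n, e_n)‖` is a lower bound uniform in `t ≥ 1`. -/
theorem tendsto_cusp (hI : IsInvolutiveOrder I) (N : ℕ) {k : ℤ} {κ : ℕ} (hk : k = -κ)
    (hκ : n < κ) {R : Mat n} (hR : R ∈ Gam I) {w : Cl n} (hw : w ∈ upperHalf n) :
    Filter.Tendsto (fun t : ℝ => autFactor k R (t • en n) * poincare I N k (mob R (t • en n)) w)
      Filter.atTop (𝓝 0) := by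
  set C := 1 + ‖w - en n‖ / xn w with hC
  have hw2 := hw.2
  have hC0 : 0 < C := by positivity
  have hmem : ∀ M : GamN I N, (M : Mat n) * R ∈ Gam I := fun M => mul_mem_Gam hI M.2.1 hR
  have hinj : Function.Injective (fun M : GamN I N => (⟨_, hmem M⟩ : Gam I)) := by
    intro M M' h
    have h1 := congrArg (fun X : Gam I => (X : Mat n) * adj R) h
    simp only [mul_assoc, (Gam.sav hR).mul_adj, mul_one] at h1
    exact Subtype.ext h1
  have hsum := ((summable_Gam_en hI (by omega : 2 * n < n + κ)).comp_injective hinj).mul_left (C ^ (n + κ))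
  have hcomp : ∀ M : GamN I N, ∀ t : ℝ, 1 ≤ t →
      ‖vVal ((M : Mat n) * R) (t • en n) (en n)‖ ≤ C * ‖vVal ((M : Mat n) * R) (t • en n) w‖ :=
    fun M t ht => norm_vVal_le_right (Gam.sav (hmem M)) (smul_en_mem_upperHalf (by linarith)) hw
  have h0 : (0 : Cl n) = ∑' _ : GamN I N, (0 : Cl n) := by simp
  have key : Filter.Tendsto (fun t : ℝ => ∑' M : GamN I N, term k ((M : Mat n) * R) (t • en n) w)
      Filter.atTop (𝓝 (∑' _ : GamN I N, (0 : Cl n))) := by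
    refine tendsto_tsum_of_dominated_convergence hsum ?_ ?_
    · intro M
      have hS := Gam.sav (hmem M)
      obtain ⟨i, hi⟩ : ∃ i, ((M : Mat n) * R) i 0 ≠ 0 := by
        by_contra! hc
        have := congrFun (congrFun hS.adj_mul_self 0) 0
        rw [Matrix.mul_apply, Fin.sum_univ_two, hc, hc] at this
        simpa using congrArg sc this
      have hi' : 0 < ‖((M : Mat n) * R) i 0‖ := norm_pos_iff.2 hi
      have hlow : ∀ t : ℝ, 1 ≤ t → t * (‖((M : Mat n) * R) i 0‖ / C) ≤
          ‖vVal ((M : Mat n) * R) (t • en n) w‖ := by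
        intro t ht
        have h1 : t * ‖((M : Mat n) * R) i 0‖ ≤ ‖vVal ((M : Mat n) * R) (t • en n) (en n)‖ := by
          refine (le_abs_self _).trans (abs_le_of_sq_le_sq ?_ (norm_nonneg _))
          have h2 := norm_vVal_axis_sq hS t 1
          rw [one_smul] at h2
          rw [h2, mul_pow]
          have := mul_nonneg (sq_nonneg t) (sq_nonneg ‖((M : Mat n) * R) 0 0‖)
          have := mul_nonneg (sq_nonneg t) (sq_nonneg ‖((M : Mat n) * R) 1 0‖)
          have := sq_nonneg ‖((M : Mat n) * R) 0 1‖
          have := sq_nonneg ‖((M : Mat n) * R) 1 1‖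
          fin_cases i <;> simp only [Fin.zero_eta, Fin.mk_one] <;> linarith
        rw [← mul_div_assoc, div_le_iff₀ hC0, mul_comm _ C]
        exact h1.trans (hcomp M t ht)
      have hlim : Filter.Tendsto (fun t : ℝ => ((t * (‖((M : Mat n) * R) i 0‖ / C)) ^ (n + κ))⁻¹)
          Filter.atTop (𝓝 0) :=
        Filter.Tendsto.inv_tendsto_atTop ((Filter.tendsto_pow_atTop (by omega)).comp
          (Filter.tendsto_id.atTop_mul_const (by positivity)))
      refine squeeze_zero_norm' ?_ hlim
      filter_upwards [Filter.eventually_ge_atTop 1] with t ht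
      have ht0 : 0 < t := by linarith
      rw [norm_term hk hS (smul_en_mem_upperHalf ht0) hw]
      gcongr
      exact hlow t ht
    · filter_upwards [Filter.eventually_ge_atTop 1] with t ht M
      have hS := Gam.sav (hmem M)
      have ht0 : 0 < t := by linarith
      have h1 := norm_vVal_axis_mono hS ht le_rfl
      rw [one_smul] at h1
      have h2 := h1.trans (hcomp M t ht)
      have h3 : 0 < ‖vVal ((M : Mat n) * R) (en n) (en n)‖ :=
        norm_pos_iff.2 (vVal_ne_zero hS en_mem_upperHalf en_mem_upperHalf)
      have h4 : 0 < ‖vVal ((M : Mat n) * R) (t • en n) w‖ :=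
        norm_pos_iff.2 (vVal_ne_zero hS (smul_en_mem_upperHalf ht0) hw)
      rw [norm_term hk hS (smul_en_mem_upperHalf ht0) hw, Function.comp, inv_le_iff_one_le_mul₀ (by positivity),
        mul_right_comm, ← div_eq_mul_inv, one_le_div (by positivity), ← mul_pow]
      gcongr
  rw [← h0] at key
  refine key.congr' ?_
  filter_upwards [Filter.eventually_gt_atTop 0] with t ht
  rw [autFactor_mul_poincare hI N hk hκ hR (smul_en_mem_upperHalf ht) hw]

/-- The law of the companion series of parameter `-k`. -/
theorem companion_automorphy (hI : IsInvolutiveOrder I) (N : ℕ) {k : ℤ} {κ : ℕ} (hk : k = -κ)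
    (hκ : n < κ) {M : Mat n} (hM : M ∈ GamN I N) {x w : Cl n} (hx : x ∈ upperHalf n)
    (hw : w ∈ upperHalf n) :
    xn x ^ (-k) • poincare I N k x w =
      autFactor (-k) M x * (xn (mob M x) ^ (-k) • poincare I N k (mob M x) w) := by
  have hS := GamN.sav hM
  have hr : ‖den M x‖ ≠ 0 := (norm_den_pos hS hx).ne'
  rw [poincare_automorphy hI N hk hκ hM hx hw, xn_mob hS hx.1]
  change xn x ^ (-k) • (kernel k (den M x) * _) = kernel (-k) (den M x) * _
  rw [kernel, kernel, smul_mul_assoc, smul_mul_assoc, mul_smul_comm, smul_smul, smul_smul]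
  congr 1
  rw [div_zpow, ← zpow_natCast, ← zpow_mul, mul_comm, div_eq_mul_inv, ← zpow_neg, ← zpow_neg, ← zpow_neg,
    mul_comm (xn x ^ (-k)) (‖den M x‖ ^ _), ← mul_assoc, ← zpow_add₀ hr]
  congr 2
  push_cast
  ring

/-! ### Differentiability -/

/-- The derivative at `x` of `x ↦ kernel k (vVal M (π x) w)`, where `π` is the projection onto the
paravectors and `k = n + 1 - m`. -/
def termDeriv (m : ℕ) (M : Mat n) (x w : Cl n) : Cl n →L[ℝ] Cl n :=
  (kernelDeriv m (vVal M (paraProj n x) w)).comp ((mulLeftL (M 0 0 + w * M 1 0)).comp (paraProj n))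

theorem hasFDerivAt_vVal {n : ℕ} (M : Mat n) (x w : Cl n) :
    HasFDerivAt (fun x => vVal M (paraProj n x) w) ((mulLeftL (M 0 0 + w * M 1 0)).comp (paraProj n)) x := by
  have h : (fun x => vVal M (paraProj n x) w) = fun x =>
      ((mulLeftL (M 0 0 + w * M 1 0)).comp (paraProj n)) x + (M 0 1 + w * M 1 1) := by
    ext1 x
    simp only [vVal, ContinuousLinearMap.comp_apply, mulLeftL_apply]
    noncomm_ring
  rw [h]
  exact (ContinuousLinearMap.hasFDerivAt _).add_const _

theorem hasFDerivAt_term {n m : ℕ} (hm : 2 ≤ m) {M : Mat n} {x w : Cl n}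
    (h : vVal M (paraProj n x) w ≠ 0) :
    HasFDerivAt (fun x => (‖vVal M (paraProj n x) w‖ ^ m)⁻¹ • star (vVal M (paraProj n x) w))
      (termDeriv m M x w) x :=
  HasFDerivAt.comp (g := fun y : Cl n => (‖y‖ ^ m)⁻¹ • star y) x (hasFDerivAt_kernel hm h)
    (hasFDerivAt_vVal M x w)

theorem norm_termDeriv_apply_le {n : ℕ} (m : ℕ) {M : Mat n} {x w : Cl n} (h : vVal M (paraProj n x) w ≠ 0)
    (v : Cl n) :
    ‖termDeriv m M x w v‖ ≤
      (m + 1) * (‖vVal M (paraProj n x) w‖ ^ m)⁻¹ * (‖M 0 0 + w * M 1 0‖ * ‖paraProj n v‖) := by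
  refine (norm_kernelDeriv_apply_le m h _).trans_eq ?_
  change _ * ‖(M 0 0 + w * M 1 0) * paraProj n v‖ = _
  rw [norm_mul_right (mem_pvProd_of_mem_paravec (paraProj_mem v))]

theorem paraProj_mem_upperHalf {x : Cl n} (hx : 0 < xn x) : paraProj n x ∈ upperHalf n :=
  ⟨paraProj_mem x, by rwa [xn_paraProj]⟩

/-- Termwise differentiation of the Poincaré series, extended to an open subset of `Cl_n` by the
projection onto the paravectors. -/
theorem hasFDerivAt_poincare (hI : IsInvolutiveOrder I) (N : ℕ) {k : ℤ} {κ : ℕ} (hk : k = -κ)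
    (hκ : n < κ) {x w : Cl n} (hx : x ∈ upperHalf n) (hw : w ∈ upperHalf n) :
    (Summable fun M : GamN I N => termDeriv (n + κ + 1) (M : Mat n) x w) ∧
    HasFDerivAt (fun y => poincare I N k (paraProj n y) w)
      (∑' M : GamN I N, termDeriv (n + κ + 1) (M : Mat n) x w) x := by
  set m := n + κ + 1 with hm
  set ρ := xn x / 2 with hρ
  have hx2 := hx.2
  have hw2 := hw.2
  have hρ0 : 0 < ρ := by positivity
  have hball : ∀ y ∈ Metric.ball x ρ, ρ < xn y := by
    intro y hy
    rw [Metric.mem_ball, dist_eq_norm] at hy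
    have h1 := (abs_le.1 (abs_xn_le_norm (y - x))).1
    rw [xn_sub] at h1
    linarith
  have hup : ∀ y ∈ Metric.ball x ρ, paraProj n y ∈ upperHalf n := fun y hy =>
    paraProj_mem_upperHalf (hρ0.trans (hball y hy))
  set R := ‖paraProj n‖ * (‖x‖ + ρ) + 1 with hR
  set C := (1 + 2 * (R / ρ)) * (1 + ‖w - en n‖ / xn w) with hC
  have hC0 : 0 < C := by positivity
  have hcomp : ∀ M : GamN I N, ∀ y ∈ Metric.ball x ρ,
      ‖vVal (M : Mat n) (en n) (en n)‖ ≤ C * ‖vVal (M : Mat n) (paraProj n y) w‖ := by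
    intro M y hy
    refine (norm_vVal_en_le (GamN.sav M.2) (hup y hy) hw).trans ?_
    have h1 : ‖paraProj n y - en n‖ ≤ R := by
      refine (norm_sub_le _ _).trans ?_
      rw [norm_e, hR]
      have h2 := (paraProj n).le_opNorm y
      have h3 : ‖y‖ ≤ ‖x‖ + ρ := by
        rw [Metric.mem_ball, dist_eq_norm] at hy
        have := norm_add_le x (y - x)
        rw [add_sub_cancel] at this
        linarith
      have h4 : ‖paraProj n‖ * ‖y‖ ≤ ‖paraProj n‖ * (‖x‖ + ρ) := by gcongr
      linarith
    have h2 : ρ ≤ xn (paraProj n y) := by rw [xn_paraProj]; exact (hball y hy).le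
    rw [hC]
    gcongr
  have hbound : ∀ M : GamN I N, ∀ y ∈ Metric.ball x ρ, ‖termDeriv m (M : Mat n) y w‖ ≤
      ((m + 1) * C ^ m * (1 + ‖w‖) * ‖paraProj n‖) * (‖vVal (M : Mat n) (en n) (en n)‖ ^ (n + κ))⁻¹ := by
    intro M y hy
    have hS := GamN.sav M.2
    have h0 := vVal_ne_zero hS (hup y hy) hw
    have h1 : 0 < ‖vVal (M : Mat n) (en n) (en n)‖ :=
      norm_pos_iff.2 (vVal_ne_zero hS en_mem_upperHalf en_mem_upperHalf)
    have h2 : 0 < ‖vVal (M : Mat n) (paraProj n y) w‖ := norm_pos_iff.2 h0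
    have h3 : ‖(M : Mat n) 0 0 + w * (M : Mat n) 1 0‖ ≤ (1 + ‖w‖) * ‖vVal (M : Mat n) (en n) (en n)‖ := by
      refine (norm_add_le _ _).trans ?_
      rw [norm_mul_left (mem_pvProd_of_mem_paravec hw.1)]
      have h4 := norm_entry_le hS 0 0
      have h5 := mul_le_mul_of_nonneg_left (norm_entry_le hS 1 0) (norm_nonneg w)
      linarith
    have h6 : (‖vVal (M : Mat n) (paraProj n y) w‖ ^ m)⁻¹ ≤
        C ^ m * (‖vVal (M : Mat n) (en n) (en n)‖ ^ m)⁻¹ := by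
      rw [inv_le_iff_one_le_mul₀ (by positivity), mul_right_comm, ← div_eq_mul_inv, one_le_div (by positivity),
        ← mul_pow]
      gcongr
      exact hcomp M y hy
    refine ContinuousLinearMap.opNorm_le_bound _ (by positivity) fun v => ?_
    refine (norm_termDeriv_apply_le m h0 v).trans ?_
    have h7 := (paraProj n).le_opNorm v
    calc _ ≤ (m + 1) * (C ^ m * (‖vVal (M : Mat n) (en n) (en n)‖ ^ m)⁻¹) *
          (((1 + ‖w‖) * ‖vVal (M : Mat n) (en n) (en n)‖) * (‖paraProj n‖ * ‖v‖)) := by gcongr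
      _ = _ := by rw [hm, pow_succ ‖vVal (M : Mat n) (en n) (en n)‖]; field_simp
  have hs := (summable_GamN_en hI N (by omega : 2 * n < n + κ)).mul_left
    ((m + 1) * C ^ m * (1 + ‖w‖) * ‖paraProj n‖)
  have hx0 : x ∈ Metric.ball x ρ := Metric.mem_ball_self hρ0
  have hterm : ∀ M : GamN I N, ∀ y ∈ Metric.ball x ρ, term k (M : Mat n) (paraProj n y) w =
      (‖vVal (M : Mat n) (paraProj n y) w‖ ^ m)⁻¹ • star (vVal (M : Mat n) (paraProj n y) w) :=
    fun M y hy => by rw [term_eq_kernel k (GamN.sav M.2) (hup y hy), kernel_eq hk]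
  refine ⟨Summable.of_norm_bounded hs fun M => hbound M x hx0, ?_⟩
  have h1 := hasFDerivAt_tsum_of_isPreconnected hs Metric.isOpen_ball (convex_ball x ρ).isPreconnected
    (fun (M : GamN I N) y hy => hasFDerivAt_term (m := m) (by omega) (vVal_ne_zero (GamN.sav M.2) (hup y hy) hw))
    hbound hx0 ?_ hx0
  · refine h1.congr_of_eventuallyEq ?_
    filter_upwards [Metric.isOpen_ball.mem_nhds hx0] with y hy
    exact tsum_congr fun M => hterm M y hy
  · refine ((summable_norm_term hI N hk hκ (hup x hx0) hw).of_norm).congr fun M => hterm M x hx0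

theorem differentiableOn_poincare (hI : IsInvolutiveOrder I) (N : ℕ) {k : ℤ} {κ : ℕ} (hk : k = -κ)
    (hκ : n < κ) {w : Cl n} (hw : w ∈ upperHalf n) :
    DifferentiableOn ℝ (fun x => poincare I N k x w) (upperHalf n) := by
  intro x hx
  have h := (hasFDerivAt_poincare hI N hk hκ hx hw).2.differentiableAt.differentiableWithinAt
    (s := upperHalf n)
  refine h.congr (fun y hy => ?_) ?_
  · rw [paraProj_of_mem hy.1]
  · rw [paraProj_of_mem hx.1]

theorem lineDeriv_poincare (hI : IsInvolutiveOrder I) (N : ℕ) {k : ℤ} {κ : ℕ} (hk : k = -κ)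
    (hκ : n < κ) {x w v : Cl n} (hx : x ∈ upperHalf n) (hw : w ∈ upperHalf n) (hv : v ∈ paravec n) :
    lineDeriv ℝ (fun x => poincare I N k x w) x v =
      (∑' M : GamN I N, termDeriv (n + κ + 1) (M : Mat n) x w) v := by
  have h := ((hasFDerivAt_poincare hI N hk hκ hx hw).2.hasLineDerivAt v).lineDeriv
  rw [← h, lineDeriv, lineDeriv]
  congr 1
  ext1 s
  rw [paraProj_of_mem (add_mem hx.1 (Submodule.smul_mem _ _ hv))]

/-! ### Failure of hypermonogenicity -/

theorem sc_involute_qPart (a : Cl n) : sc (involute (qPart a)) = xn a := by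
  rw [sc_involute, qPart, map_sum, Finset.sum_eq_single ∅]
  · rw [map_smul, eA_empty, sc_one, smul_eq_mul, mul_one]; rfl
  · intro A _ hA
    rw [map_smul, sc_eA (Finset.nonempty_iff_ne_empty.2 hA), smul_zero]
  · intro h; simp at h

/-- The leading coefficient `a + w c` of `V_M(·, w)` at `w = t e_n` is of size at most `‖V_M‖ / t`. -/
theorem norm_leading_le {M : Mat n} (h : SAV M) (t : ℝ) :
    t * ‖M 0 0 + (t • en n) * M 1 0‖ ≤ ‖vVal M (t • en n) (t • en n)‖ := by
  have hl : ∀ i j, M i j ∈ lowAlg n := fun i j => mem_lowAlg_of_mem_lowProd (h.mem i j)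
  refine (le_abs_self _).trans (abs_le_of_sq_le_sq ?_ (norm_nonneg _))
  rw [mul_pow, smul_mul_assoc, en_mul (hl 1 0), ← smul_mul_assoc,
    norm_sq_add_mul_en (hl 0 0) (Subalgebra.smul_mem _ (involute_mem_lowAlg (hl 1 0)) _), norm_smul, norm_involute,
    norm_vVal_axis_sq h, mul_pow, Real.norm_eq_abs, sq_abs]
  have := sq_nonneg ‖M 0 1‖
  have := mul_nonneg (sq_nonneg t) (sq_nonneg ‖M 1 1‖)
  nlinarith

/-- Failure of hypermonogenicity: the scalar part of `D f + k (Q f)' / x_n`. For the kernel it equals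
`-k w_n / x_n · ‖w + x‖^{-(n + 1 - k)}`, which has constant sign, so that the translations dominate again. -/
theorem not_forall_isHypermonogenic (hI : IsInvolutiveOrder I) {N : ℕ} (hN : 3 ≤ N) {k : ℤ} {κ : ℕ}
    (hk : k = -κ) (hκ : n < κ)
    (h : ∀ w ∈ upperHalf n, IsHypermonogenic k (fun x => poincare I N k x w)) : False := by
  set m := n + κ + 1 with hm
  let H : ℝ → GamN I N → ℝ := fun t M => t * (scDiv (termDeriv m (M : Mat n) (t • en n) (t • en n)) +
    (k : ℝ) / t * xn (term k (M : Mat n) (t • en n) (t • en n)))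
  have hκ0 : 0 < κ := by omega
  have hk' : (k : ℝ) = -κ := by rw [hk]; push_cast; rfl
  have hproj : ∀ t : ℝ, paraProj n (t • en n) = t • en n := fun t =>
    paraProj_of_mem (Submodule.smul_mem _ _ en_mem_paravec)
  have hval : ∀ t : ℝ, 1 ≤ t → ∀ M ∉ movesCusp I N, H t M =
      κ * (t * (‖vVal (M : Mat n) (t • en n) (t • en n)‖ ^ m)⁻¹) := by
    intro t ht M hM
    have ht0 : 0 < t := by linarith
    have hx : t • en n ∈ upperHalf n := smul_en_mem_upperHalf ht0
    obtain ⟨h0, h1, h2⟩ := vVal_translation hI hN hM t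
    have hne := vVal_ne_zero (GamN.sav M.2) hx hx
    have h3 : scDiv (termDeriv m (M : Mat n) (t • en n) (t • en n)) =
        (n + 1 - m) * (‖vVal (M : Mat n) (t • en n) (t • en n)‖ ^ m)⁻¹ := by
      refine scDiv_kernelDeriv m h1 hne fun v hv => ?_
      rw [termDeriv, hproj, ContinuousLinearMap.comp_apply, ContinuousLinearMap.comp_apply, mulLeftL_apply,
        paraProj_of_mem hv]
      congr 1
      rw [h0]
      simp [transl]
    have h4 : xn (term k (M : Mat n) (t • en n) (t • en n)) =
        -(2 * t) * (‖vVal (M : Mat n) (t • en n) (t • en n)‖ ^ m)⁻¹ := by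
      rw [term_eq_kernel k (GamN.sav M.2) hx, kernel_eq hk, xn_smul, xn_star_of_mem_paravec h1, h2]
      ring
    have h5 : ((n : ℝ) + 1 - m) = -κ := by rw [hm]; push_cast; ring
    simp only [H]
    rw [h3, h4, h5, hk']
    field_simp
    ring
  refine not_hasSum_zero hI hN (by omega : n < n + κ) (summable_GamN_en hI N (by omega)) (u := H)
    (c₀ := κ * ((n + 3 : ℝ) ^ m)⁻¹) (C := (n + 1) * (m + 1) + κ) (by positivity) (by positivity) ?_ ?_ ?_ ?_
  · intro t ht
    have ht0 : 0 < t := by linarith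
    have hx : t • en n ∈ upperHalf n := smul_en_mem_upperHalf ht0
    have hL := (hasFDerivAt_poincare hI N hk hκ hx hx).1.hasSum
    set L := ∑' M : GamN I N, termDeriv m (M : Mat n) (t • en n) (t • en n) with hLdef
    have hLv : ∀ v, HasSum (fun M : GamN I N => termDeriv m (M : Mat n) (t • en n) (t • en n) v) (L v) :=
      fun v => hL.mapL (ContinuousLinearMap.apply ℝ (Cl n) v)
    have hdiv : HasSum (fun M : GamN I N => scDiv (termDeriv m (M : Mat n) (t • en n) (t • en n)))
        (scDiv L) :=
      ((hLv 1).mapL (scL n)).add (hasSum_sum fun i _ => (hLv (e i)).mapL ((scL n).comp (mulLeftL (e i))))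
    have hP := (((summable_norm_term hI N hk hκ hx hx).of_norm).hasSum.mapL
      (LinearMap.toContinuousLinearMap (coeffLin {lastIdx n}))).mul_left ((k : ℝ) / t)
    have hall := (hdiv.add hP).mul_left t
    have hzero : scDiv L + (k : ℝ) / t * xn (poincare I N k (t • en n) (t • en n)) = 0 := by
      have h1 := congrArg sc ((h _ hx).2 _ hx)
      rw [map_add, map_smul, sc_involute_qPart, map_zero, xn_smul, xn_en, mul_one, smul_eq_mul] at h1
      rw [← h1, dirac, map_add, map_sum, scDiv]
      rw [lineDeriv_poincare hI N hk hκ hx hx one_mem_paravec]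
      congr 2
      refine Finset.sum_congr rfl fun i _ => ?_
      rw [lineDeriv_poincare hI N hk hκ hx hx (e_mem_paravec i)]
    have hz : t * (scDiv L + (k : ℝ) / t * xn (poincare I N k (t • en n) (t • en n))) = 0 := by
      rw [hzero, mul_zero]
    rw [← hz]
    exact hall
  · intro t ht M hM
    have hM' : M ∉ movesCusp I N := fun h => (show (M : Mat n) 1 0 ≠ 0 from h) hM.1
    rw [hval t ht M hM', mul_assoc]
    have := le_inv_norm_vVal_shortTransl hI hN ht hM (n + κ)
    gcongr
  · intro t ht M hM
    have : 0 ≤ t := by linarith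
    rw [hval t ht M hM]
    positivity
  · intro t ht M hM
    have ht0 : 0 < t := by linarith
    have hx : t • en n ∈ upperHalf n := smul_en_mem_upperHalf ht0
    have hS := GamN.sav M.2
    have hne := vVal_ne_zero hS hx hx
    have hpos : 0 < ‖vVal (M : Mat n) (t • en n) (t • en n)‖ := norm_pos_iff.2 hne
    have hlead := norm_leading_le hS t
    set r := (‖vVal (M : Mat n) (t • en n) (t • en n)‖ ^ (n + κ))⁻¹ with hr
    have hv : ∀ v ∈ paravec n, ‖v‖ = 1 →
        ‖termDeriv m (M : Mat n) (t • en n) (t • en n) v‖ ≤ (m + 1) * r / t := by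
      intro v hv hv1
      have h1 := norm_termDeriv_apply_le m (M := (M : Mat n)) (x := t • en n) (w := t • en n)
        (by rw [hproj]; exact hne) v
      rw [hproj, paraProj_of_mem hv, hv1, mul_one] at h1
      refine h1.trans ?_
      rw [le_div_iff₀ ht0]
      calc _ = (m + 1) * (‖vVal (M : Mat n) (t • en n) (t • en n)‖ ^ m)⁻¹ *
            (t * ‖(M : Mat n) 0 0 + (t • en n) * (M : Mat n) 1 0‖) := by ring
        _ ≤ (m + 1) * (‖vVal (M : Mat n) (t • en n) (t • en n)‖ ^ m)⁻¹ *
            ‖vVal (M : Mat n) (t • en n) (t • en n)‖ := by gcongr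
        _ = (m + 1) * r := by
            rw [hr, hm, pow_succ ‖vVal (M : Mat n) (t • en n) (t • en n)‖]; field_simp
    have h1 := abs_scDiv_le (hv 1 one_mem_paravec norm_one') (fun i => hv (e i) (e_mem_paravec i) (norm_e i))
    have h2 : |xn (term k (M : Mat n) (t • en n) (t • en n))| ≤ r := by
      rw [hr, ← norm_term hk hS hx hx]; exact abs_xn_le_norm _
    have h3 : |(k : ℝ) / t * xn (term k (M : Mat n) (t • en n) (t • en n))| ≤ κ / t * r := by
      rw [abs_mul, abs_div, hk', abs_neg, Nat.abs_cast, abs_of_pos ht0]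
      gcongr
    simp only [H]
    rw [abs_mul, abs_of_pos ht0]
    calc t * |_| ≤ t * ((n + 1) * ((m + 1) * r / t) + κ / t * r) := by
          gcongr
          exact (abs_add_le _ _).trans (add_le_add h1 h3)
      _ = _ := by field_simp

end

end CliffordPoincare

end

theorem theorem5 {n : ℕ} [NeZero n] (I : Subring (Cl n)) (hI : IsInvolutiveOrder I)
    (N : ℕ) (hN : N0 I ≤ N) (k : ℤ) (hk : k < -1) (hk_even : Even k) :
    -- the series is not identically zero
    (¬ ∀ x ∈ upperHalf n, ∀ w ∈ upperHalf n,
      HasSum (fun M : GamN I N => term k (M : Mat n) x w) 0) ∧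
    (k < -(n : ℤ) →
      -- absolute convergence
      (∀ x ∈ upperHalf n, ∀ w ∈ upperHalf n,
        Summable (fun M : GamN I N => ‖term k (M : Mat n) x w‖)) ∧
      -- the sum is not the zero function
      (∃ x ∈ upperHalf n, ∃ w ∈ upperHalf n, poincare I N k x w ≠ 0) ∧
      -- automorphy
      (∀ M ∈ GamN I N, ∀ x ∈ upperHalf n, ∀ w ∈ upperHalf n,
        mob M x ∈ upperHalf n ∧
        poincare I N k x w = autFactor k M x * poincare I N k (mob M x) w) ∧
      -- decay at every cusp that is equivalent to infinity under the full group
      (∀ R ∈ Gam I, ∀ w ∈ upperHalf n,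
        Filter.Tendsto (fun t : ℝ => autFactor k R (t • e (lastIdx n)) *
          poincare I N k (mob R (t • e (lastIdx n))) w) Filter.atTop (𝓝 0)) ∧
      -- differentiable in `x`, but not `k`-hypermonogenic
      (∀ w ∈ upperHalf n, DifferentiableOn ℝ (fun x => poincare I N k x w) (upperHalf n)) ∧
      (∃ w ∈ upperHalf n, ¬ IsHypermonogenic k (fun x => poincare I N k x w)) ∧
      -- the companion series of positive parameter `-k`
      (∀ M ∈ GamN I N, ∀ x ∈ upperHalf n, ∀ w ∈ upperHalf n,
        xn x ^ (-k) • poincare I N k x w =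
          autFactor (-k) M x * (xn (mob M x) ^ (-k) • poincare I N k (mob M x) w)) ∧
      (∃ x ∈ upperHalf n, ∃ w ∈ upperHalf n, xn x ^ (-k) • poincare I N k x w ≠ 0)) := by
  obtain ⟨κ, hκ⟩ : ∃ κ : ℕ, k = -κ := ⟨(-k).toNat, by omega⟩
  have hN3 := three_le_of_N0_le hI hN
  refine ⟨fun h => not_forall_hasSum_zero hI hN3 hκ (by omega) h, fun hkn => ?_⟩
  have hκn : n < κ := by omega
  have hsum : ∀ x ∈ upperHalf n, ∀ w ∈ upperHalf n,
      Summable (fun M : GamN I N => ‖term k (M : Mat n) x w‖) :=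
    fun x hx w hw => summable_norm_term hI N hκ hκn hx hw
  have hne : ∃ x ∈ upperHalf n, ∃ w ∈ upperHalf n, poincare I N k x w ≠ 0 := by
    by_contra! hc
    refine not_forall_hasSum_zero hI hN3 hκ (by omega) fun x hx w hw => ?_
    rw [← hc x hx w hw]
    exact (hsum x hx w hw).of_norm.hasSum
  refine ⟨hsum, hne, fun M hM x hx w hw => ⟨mob_mem_upperHalf (GamN.sav hM) hx,
    poincare_automorphy hI N hκ hκn hM hx hw⟩, fun R hR w hw => tendsto_cusp hI N hκ hκn hR hw,
    fun w hw => differentiableOn_poincare hI N hκ hκn hw, ?_,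
    fun M hM x hx w hw => companion_automorphy hI N hκ hκn hM hx hw, ?_⟩
  · by_contra! hc
    exact not_forall_isHypermonogenic hI hN3 hκ hκn hc
  · obtain ⟨x, hx, w, hw, h⟩ := hne
    exact ⟨x, hx, w, hw, smul_ne_zero (zpow_ne_zero _ hx.2.ne') h⟩
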